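/- Relational structures have finitely many relations of finite arity. An embedding of a relational structure $\mathcal{A}$ with carrier $A$ is an injective map $A\to A$ that preserves and reflects all relations of $\mathcal{A}$. The lexicographic product $\mathcal{A}\otimes\mathcal{B}$ has carrier $A\times B$ and the disjoint union of the two sets of relation symbols: a relation $r$ of $\mathcal{A}$ holds of $((a_1,b_1),\dots,(a_k,b_k))$ iff $r(a_1,\dots,a_k)$, and a relation $r$ of $\mathcal{B}$ holds of it iff $a_1=\dots=a_k$ and $r(b_1,\dots,b_k)$. Let $\mathcal{Q}=(\mathbb{Q},\le)$, let $\mathcal{Q}^{\ell}=\mathcal{Q}\otimes\dots\otimes\mathcal{Q}$ ($\ell$ factors), and let $\mathbf{d}=(\{0,\dots,d-1\},\le)$. A Petri net with data $\mathcal{A}$ and $d$ places is a set of rules $\mathcal{T}=\{(\iota(h),\iota(h')) : (h,h')\in T,\ \iota \text{ an embedding of } \mathcal{A}\otimes\mathbf{d}\}$, where $T$, its presentation, is a finite set of pairs of monomials (finite multisets) over the elements of $\mathcal{A}\otimes\mathbf{d}$, and embeddings act on monomials by renaming variables. Its transitions are $g\cdot h\longrightarrow_{\mathcal{T}} g\cdot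 h'$ for all monomials $g$ and all $(h,h')\in\mathcal{T}$; reachability $\longrightarrow^*_{\mathcal{T}}$ is the reflexive-transitive closure of $\longrightarrow_{\mathcal{T}}$. The net is reversible if $c\longrightarrow^*_{\mathcal{T}}c'$ implies $c'\longrightarrow^*_{\mathcal{T}}c$ for all monomials $c,c'$. **Theorem.** For every $\ell\ge 1$, the reachability problem is decidable in reversible Petri nets with data $\mathcal{Q}^{\ell}$: there is an algorithm which, given a number $d\in\mathbb{N}$ of places, a finite presentation $T$ of a Petri net $\mathcal{T}$ with data $\mathcal{Q}^{\ell}$ and $d$ places, and monomials $s,t$ over $\mathcal{Q}^{\ell}\otimes\mathbf{d}$, always halts and, whenever $\mathcal{T}$ is reversible, correctly decides whether $s\longrightarrow^*_{\mathcal{T}}t$. -/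

import Mathlib

namespace PetriData

/-! ### Relational structures and lexicographic products -/

/-- A relational structure: a carrier with relations of finite arities (and no function symbols). -/
structure RelStr where
  Lang : FirstOrder.Language.{0, 0}
  relational : Lang.IsRelational
  Carrier : Type
  str : Lang.Structure Carrier

attribute [instance] RelStr.relational RelStr.str

namespace RelStr

/-- Embeddings of a structure into itself: maps preserving and reflecting all relations
(injectivity is part of Mathlib's notion; it is automatic when equality is definable). -/
abbrev Emb (A : RelStr) : Type := FirstOrder.Language.Embedding A.Lang A.Carrier A.Carrier

/-- A totally ordered set as a relational structure, with the single binary relation `≤`. -/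
def ofOrder (α : Type) [LinearOrder α] : RelStr where
  Lang := FirstOrder.Language.order
  relational := inferInstance
  Carrier := α
  str := FirstOrder.Language.orderStructure α

/-- The lexicographic product. The relation symbols are the disjoint union of those of the factors.
A relation of the first factor ignores second coordinates; a relation of the second factor
requires in addition that all first coordinates are equal. -/
def lex (A B : RelStr) : RelStr where
  Lang := A.Lang.sum B.Lang
  relational := inferInstance
  Carrier := A.Carrier × B.Carrier
  str :=
    { funMap := fun {n} f _ =>
        ((inferInstance : (A.Lang.sum B.Lang).IsRelational) n).elim f
      RelMap := fun {_} r x =>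
        match r with
        | Sum.inl r₁ => FirstOrder.Language.Structure.RelMap r₁ (fun i => (x i).1)
        | Sum.inr r₂ =>
            (∀ i j, (x i).1 = (x j).1) ∧ FirstOrder.Language.Structure.RelMap r₂ (fun i => (x i).2) }

/-- The one-point structure without relations. -/
def point : RelStr where
  Lang := FirstOrder.Language.empty
  relational := inferInstance
  Carrier := Unit
  str := { funMap := fun {_} f _ => f.elim, RelMap := fun {_} r _ => r.elim }

/-- The `ℓ`-fold lexicographic product `A ⊗ (A ⊗ (⋯ ⊗ A))`, used for `ℓ ≥ 1`. -/
def pow (A : RelStr) : ℕ → RelStr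
  | 0 => point
  | 1 => A
  | n + 2 => A.lex (A.pow (n + 1))

end RelStr

/-- The rational order `(ℚ, ≤)`. -/
def ratOrder : RelStr := RelStr.ofOrder ℚ

/-- The finite ordinal `0 < 1 < ⋯ < d - 1`. -/
def finiteOrd (d : ℕ) : RelStr := RelStr.ofOrder (Fin d)

/-! ### Monomial rewriting and Petri nets with data -/

/-- Monomials over the variables of `A`, given by their exponents as in `MvPolynomial`:
the product of monomials is `+`, the unit monomial is `0`. -/
abbrev Monom (A : RelStr) : Type := A.Carrier →₀ ℕ

/-- The action of an embedding on monomials, renaming the variables. -/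
noncomputable def rename {A : RelStr} (ι : A.Emb) (m : Monom A) : Monom A :=
  m.mapDomain fun a => ι a

/-- A set of rewriting rules over monomials. -/
abbrev Rules (A : RelStr) : Type := Set (Monom A × Monom A)

/-- The set of rules presented by `T`: all images of rules of `T` under embeddings. -/
def orbit {A : RelStr} (T : Rules A) : Rules A :=
  {p | ∃ ι : A.Emb, ∃ r ∈ T, p = (rename ι r.1, rename ι r.2)}

/-- Transitions: `g · h ⟶ g · h'` for a monomial `g` and a rule `(h, h')`. -/
def Step {A : RelStr} (R : Rules A) (c c' : Monom A) : Prop :=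
  ∃ g : Monom A, ∃ r ∈ R, c = g + r.1 ∧ c' = g + r.2

/-- Reachability: finitely many (possibly zero) transitions. -/
def Reach {A : RelStr} (R : Rules A) : Monom A → Monom A → Prop :=
  Relation.ReflTransGen (Step R)

/-- The rewriting system is reversible: reachability is symmetric. -/
def Reversible {A : RelStr} (R : Rules A) : Prop :=
  ∀ c c' : Monom A, Reach R c c' → Reach R c' c

/-! ### Finite inputs

A monomial is input as a list of variables (with repetitions), whose product it is. -/

/-- The monomial `a₁ · a₂ ⋯ aₖ` denoted by a list of variables. -/
noncomputable def monomOf {A : RelStr} (w : List A.Carrier) : Monom A :=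
  (w.map fun a => Finsupp.single a 1).sum

/-- The finite set of rules denoted by a list of pairs of words. -/
def rulesOf {A : RelStr} (T : List (List A.Carrier × List A.Carrier)) : Rules A :=
  {p | ∃ r ∈ T, p = (monomOf r.1, monomOf r.2)}

/-- The domain `ℚ^ℓ ⊗ d` of tokens of a Petri net with `d` places and data `ℚ^ℓ`. -/
abbrev tokens (ℓ d : ℕ) : RelStr := (ratOrder.pow ℓ).lex (finiteOrd d)

/-- A rational number, written as its sign bit, the absolute value of its numerator, and its
denominator, in lowest terms. -/
def codeRat (q : ℚ) : Bool × ℕ × ℕ := (decide (q < 0), q.num.natAbs, q.den)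

/-- A data value in `ℚ^ℓ`, written as the list of its `ℓ` coordinates. -/
def codeData : (ℓ : ℕ) → (ratOrder.pow ℓ).Carrier → List (Bool × ℕ × ℕ)
  | 0, _ => []
  | 1, q => [codeRat q]
  | n + 2, p => codeRat p.1 :: codeData (n + 1) p.2

/-- Codes of tokens: the code of the data value and the number of the place. -/
abbrev TokenCode : Type := List (Bool × ℕ × ℕ) × ℕ

/-- The code of a token. -/
def codeToken {ℓ d : ℕ} (a : (tokens ℓ d).Carrier) : TokenCode :=
  (codeData ℓ a.1, Fin.val (n := d) a.2)

/-- Codes of instances of the reachability problem: the number of places, the rules, the source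
and the target. -/
abbrev InstanceCode : Type :=
  ℕ × List (List TokenCode × List TokenCode) × List TokenCode × List TokenCode

/-- The code of an instance of the reachability problem. -/
def codeInstance {ℓ : ℕ} (d : ℕ)
    (T : List (List (tokens ℓ d).Carrier × List (tokens ℓ d).Carrier))
    (s t : List (tokens ℓ d).Carrier) : InstanceCode :=
  (d, T.map (fun r => (r.1.map codeToken, r.2.map codeToken)), s.map codeToken, t.map codeToken)

end PetriData

/-!
In a reversible net, reachability is the congruence on monomials generated by the rules
(`Reversible.reach_iff_conn`). By homogeneity of `ℚ` the embeddings matter only through their action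
on finitely many tokens, where they are the maps that preserve the order types of pairs
(`sameTp_emb`, `exists_emb`, `exists_isEmb_of_pairs`), and an affine change of coordinates makes all
rational numbers of an instance natural (`reachC_scale_iff`). It remains to decide a congruence that
is invariant under the embeddings of `ℚ^ℓ`, and for this it suffices that congruence and
non-congruence are both recursively enumerable (`computablePred_reachC`). For congruence this is
clear: a derivation is a finite object, and it may be moved to natural coordinates (`reachC_iff`).

A certificate of non-congruence is an equivariant Gröbner basis. The order on variables that is
needed here, the lexicographic order of tokens, is not well-founded, and only its restriction to
finitely many variables gives a well-founded order of monomials. Hence all rewriting is restricted to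
the variables at hand: a basis has to decrease the larger one of two congruent monomials by an
instance of a rule *in the joint variables of the two* (`IsBasis`). A finite set of rules with this
property, up to embeddings, exists because of a well-quasi-order: one pair of a larger and a smaller
monomial is below another if an embedding maps the tokens of the one to tokens of the other, and the
larger monomial of the one to a divisor of that of the other. That this is a well-quasi-order is
Higman's lemma, iterated over the `ℓ` coordinates (`labelledLe_pwo`, `exists_finite_basis`).

Such a basis satisfies a condition that can be verified: whenever instances of two rules decrease
their least common multiple, the results are connected below it, in the variables of the two
instances (`CriticalPeaks`). Up to embeddings there are finitely many pairs of instances, which makes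
the condition recursively enumerable (`CritC`). Conversely the condition implies confluence over every
finite set of variables (`exists_common_descendant`), but a derivation between two monomials may
involve variables that occur in neither. These are eliminated one by one (`connIn_support`): the
condition is required for all the monomial orders that give the exponent of one marked variable the
first priority, and a descent in the order that marks `v` never introduces `v`. So two distinct
monomials that are irreducible in their joint variables are not congruent (`eq_of_conn_of_irred`), and
a certificate consists of a finite set of rules with the condition and of two such monomials,
congruent to the source and to the target (`nonReachC_iff`).
-/

namespace DataNet

/-! ### Abstract rewriting -/

section Abstract

variable {α : Type*}

/-- If any two elements below a peak are connected by elements smaller than the top of the peak,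
then connected elements have a common descendant. -/
theorem join_of_peaks_connected_below {lt : α → α → Prop} (hwf : WellFounded lt)
    {S : α → α → Prop} (hS : ∀ x y, S x y → S y x)
    (htot : ∀ x y, S x y → x = y ∨ lt x y ∨ lt y x)
    (hpk : ∀ m x y, S m x → S m y → lt x m → lt y m →
      Relation.ReflTransGen (fun u w => S u w ∧ lt u m ∧ lt w m) x y)
    {s t : α} (hst : Relation.ReflTransGen S s t) :
    ∃ u, Relation.ReflTransGen (fun x y => S x y ∧ lt y x) s u ∧
      Relation.ReflTransGen (fun x y => S x y ∧ lt y x) t u := by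
  set D : α → α → Prop := fun x y => S x y ∧ lt y x with hD
  have key : ∀ m x y, Relation.ReflTransGen D m x → Relation.ReflTransGen D m y →
      ∃ u, Relation.ReflTransGen D x u ∧ Relation.ReflTransGen D y u := by
    intro m
    induction m using hwf.induction with
    | _ m ih =>
    intro x y hx hy
    rcases hx.cases_head with rfl | ⟨x₁, hx₁, hx⟩
    · exact ⟨y, hy, .refl⟩
    rcases hy.cases_head with rfl | ⟨y₁, hy₁, hy⟩
    · exact ⟨x, .refl, .head hx₁ hx⟩
    have hc := hpk m x₁ y₁ hx₁.1 hy₁.1 hx₁.2 hy₁.2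
    -- the connection of `x₁` and `y₁` runs below `m`, so its peaks join by the induction hypothesis
    have hj : ∃ z, Relation.ReflTransGen D x₁ z ∧ Relation.ReflTransGen D y₁ z := by
      clear hx hx₁
      induction hc using Relation.ReflTransGen.head_induction_on with
      | refl => exact ⟨_, .refl, .refl⟩
      | @head a b hab _ ih' =>
        obtain ⟨z, hz₁, hz₂⟩ := ih'
        rcases htot a b hab.1 with rfl | h | h
        · exact ⟨z, hz₁, hz₂⟩
        · obtain ⟨p, hp₁, hp₂⟩ := ih b hab.2.2 a z (.single ⟨hS _ _ hab.1, h⟩) hz₁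
          exact ⟨p, hp₁, hz₂.trans hp₂⟩
        · exact ⟨z, .head ⟨hab.1, h⟩ hz₁, hz₂⟩
    obtain ⟨z, hz₁, hz₂⟩ := hj
    obtain ⟨p, hp₁, hp₂⟩ := ih x₁ hx₁.2 x z hx hz₁
    obtain ⟨q, hq₁, hq₂⟩ := ih y₁ hy₁.2 p y (hz₂.trans hp₂) hy
    exact ⟨q, hp₁.trans hq₁, hq₂⟩
  induction hst using Relation.ReflTransGen.head_induction_on with
  | refl => exact ⟨_, .refl, .refl⟩
  | @head a b hab _ ih' =>
    obtain ⟨z, hz₁, hz₂⟩ := ih'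
    rcases htot a b hab with rfl | h | h
    · exact ⟨z, hz₁, hz₂⟩
    · obtain ⟨p, hp₁, hp₂⟩ := key b a z (.single ⟨hS _ _ hab, h⟩) hz₁
      exact ⟨p, hp₁, hz₂.trans hp₂⟩
    · exact ⟨z, .head ⟨hab, h⟩ hz₁, hz₂⟩

end Abstract

/-! ### Orders on monomials -/

section Order

variable {X : Type*} [LinearOrder X]

/-- The exponent of the marked variable, if there is one. -/
def weight (o : Option X) (c : Multiset X) : ℕ := o.elim 0 fun v => c.count v

/-- The monomial order that compares the exponents of the marked variable first and then
compares lexicographically, small variables being the most significant ones. -/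
def Lt (o : Option X) (c c' : Multiset X) : Prop :=
  weight o c < weight o c' ∨ weight o c = weight o c' ∧
    ∃ a, (∀ b < a, c.count b = c'.count b) ∧ c.count a < c'.count a

theorem weight_add (o : Option X) (c c' : Multiset X) :
    weight o (c + c') = weight o c + weight o c' := by
  cases o <;> simp [weight]

theorem Lt.trans {o : Option X} {a b c : Multiset X} (h : Lt o a b) (h' : Lt o b c) :
    Lt o a c := by
  rcases h with h | ⟨h, x, hx, hx'⟩ <;> rcases h' with h' | ⟨h', y, hy, hy'⟩
  · exact .inl (h.trans h')
  · exact .inl (h'.symm ▸ h)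
  · exact .inl (h ▸ h')
  · refine .inr ⟨h.trans h', ?_⟩
    rcases lt_trichotomy x y with hxy | rfl | hxy
    · exact ⟨x, fun z hz => (hx z hz).trans (hy z (hz.trans hxy)), hy x hxy ▸ hx'⟩
    · exact ⟨x, fun z hz => (hx z hz).trans (hy z hz), hx'.trans hy'⟩
    · exact ⟨y, fun z hz => (hx z (hz.trans hxy)).trans (hy z hz), (hx y hxy).symm ▸ hy'⟩

theorem Lt.total (o : Option X) (a b : Multiset X) : a = b ∨ Lt o a b ∨ Lt o b a := by
  rcases lt_trichotomy (weight o a) (weight o b) with h | h | h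
  · exact .inr (.inl (.inl h))
  · rcases lt_trichotomy (toLex (Multiset.toFinsupp a)) (toLex (Multiset.toFinsupp b))
      with h' | h' | h'
    · obtain ⟨x, hx, hx'⟩ := h'
      exact .inr (.inl (.inr ⟨h, x, fun b hb => by simpa using hx b hb, by simpa using hx'⟩))
    · exact .inl (by simpa using h')
    · obtain ⟨x, hx, hx'⟩ := h'
      exact .inr (.inr (.inr ⟨h.symm, x, fun b hb => by simpa using hx b hb, by simpa using hx'⟩))
  · exact .inr (.inr (.inl h))

theorem Lt.add_left_iff {o : Option X} {a b : Multiset X} (g : Multiset X) :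
    Lt o (g + a) (g + b) ↔ Lt o a b := by
  simp [Lt, weight_add]

/-- The monomials in finitely many variables are well-ordered. -/
theorem Lt.wellFounded (o : Option X) (V : Finset X) :
    WellFounded fun c c' : Multiset X => (∀ x ∈ c, x ∈ V) ∧ (∀ x ∈ c', x ∈ V) ∧ Lt o c c' := by
  let f : Multiset X → ℕ ×ₗ Lex (V →₀ ℕ) := fun c =>
    toLex (weight o c, toLex ((Multiset.toFinsupp c).subtypeDomain (· ∈ V)))
  have : WellFoundedLT (Lex (V →₀ ℕ)) := Finsupp.Lex.wellFoundedLT_of_finite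
  refine Subrelation.wf (r := InvImage (· < ·) f) ?_ (InvImage.wf f wellFounded_lt)
  rintro c c' ⟨hc, hc', h⟩
  rw [InvImage, Prod.Lex.lt_iff]
  rcases h with h | ⟨h, x, hx, hx'⟩
  · exact .inl h
  · have hxV : x ∈ V := hc' x (Multiset.count_pos.1 (by omega))
    refine .inr ⟨h, ?_⟩
    refine ⟨⟨x, hxV⟩, fun y hy => ?_, ?_⟩
    · have := hx y.1 hy
      simpa [f] using this
    · simpa [f] using hx'

end Order


/-! ### Rewriting with rules of restricted support -/

section Rewriting

variable {X : Type*}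

/-- A step `g · a ⟶ g · b` for a rule `(a, b)` in `O` whose variables lie in `V`, between
monomials that satisfy `Q`. -/
def StepOn (O : Set (Multiset X × Multiset X)) (Q : Multiset X → Prop) (V : Set X)
    (c c' : Multiset X) : Prop :=
  Q c ∧ Q c' ∧ ∃ r ∈ O, ∃ g, (∀ x ∈ r.1, x ∈ V) ∧ (∀ x ∈ r.2, x ∈ V) ∧ c = g + r.1 ∧ c' = g + r.2

/-- The congruence generated by a symmetric set of rules. -/
abbrev Conn (O : Set (Multiset X × Multiset X)) : Multiset X → Multiset X → Prop :=
  Relation.ReflTransGen (StepOn O (fun _ => True) Set.univ)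

/-- Connection by steps that use, in monomials and in rules, variables from `V` only. -/
abbrev ConnIn (O : Set (Multiset X × Multiset X)) (V : Set X) : Multiset X → Multiset X → Prop :=
  Relation.ReflTransGen (StepOn O (fun c => ∀ x ∈ c, x ∈ V) V)

variable {O : Set (Multiset X × Multiset X)}

theorem StepOn.mono {Q Q' : Multiset X → Prop} {V V' : Set X} {c c' : Multiset X}
    (h : StepOn O Q V c c') (hQ : ∀ c, Q c → Q' c) (hV : V ⊆ V') : StepOn O Q' V' c c' := by
  obtain ⟨h₁, h₂, r, hr, g, hr₁, hr₂, h⟩ := h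
  exact ⟨hQ _ h₁, hQ _ h₂, r, hr, g, fun x hx => hV (hr₁ x hx), fun x hx => hV (hr₂ x hx), h⟩

theorem StepOn.symm (hO : ∀ r ∈ O, r.swap ∈ O) {Q : Multiset X → Prop} {V : Set X}
    {c c' : Multiset X} (h : StepOn O Q V c c') : StepOn O Q V c' c := by
  obtain ⟨h₁, h₂, r, hr, g, hr₁, hr₂, h, h'⟩ := h
  exact ⟨h₂, h₁, r.swap, hO r hr, g, hr₂, hr₁, h', h⟩

theorem StepOn.add_left {Q Q' : Multiset X → Prop} {V : Set X} {c c' : Multiset X}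
    (h : StepOn O Q V c c') (g : Multiset X) (hQ : ∀ c, Q c → Q' (g + c)) :
    StepOn O Q' V (g + c) (g + c') := by
  obtain ⟨h₁, h₂, r, hr, e, hr₁, hr₂, rfl, rfl⟩ := h
  exact ⟨hQ _ h₁, hQ _ h₂, r, hr, g + e, hr₁, hr₂, by rw [add_assoc], by rw [add_assoc]⟩

theorem reflTransGen_mono {α : Type*} {r p : α → α → Prop} (hrp : ∀ x y, r x y → p x y) {x y : α}
    (h : Relation.ReflTransGen r x y) : Relation.ReflTransGen p x y := by
  induction h with
  | refl => exact .refl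
  | tail _ h ih => exact ih.tail (hrp _ _ h)

theorem reflTransGen_symm {α : Type*} {S : α → α → Prop} (hS : ∀ x y, S x y → S y x) {x y : α}
    (h : Relation.ReflTransGen S x y) : Relation.ReflTransGen S y x := by
  induction h with
  | refl => exact .refl
  | tail _ h ih => exact .head (hS _ _ h) ih

theorem Conn.symm (hO : ∀ r ∈ O, r.swap ∈ O) {c c' : Multiset X} (h : Conn O c c') :
    Conn O c' c :=
  reflTransGen_symm (fun _ _ h => StepOn.symm hO h) h

theorem Conn.add_left {c c' : Multiset X} (g : Multiset X) (h : Conn O c c') :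
    Conn O (g + c) (g + c') :=
  Relation.ReflTransGen.lift (g + ·) (fun _ _ h => StepOn.add_left h g fun _ _ => trivial) _ _ h

theorem Conn.of_mem {r : Multiset X × Multiset X} (hr : r ∈ O) (g : Multiset X) :
    Conn O (g + r.1) (g + r.2) :=
  .single ⟨trivial, trivial, r, hr, g, fun _ _ => trivial, fun _ _ => trivial, rfl, rfl⟩

theorem Conn.of_rules {O' : Set (Multiset X × Multiset X)} (h : ∀ r ∈ O, Conn O' r.1 r.2)
    {c c' : Multiset X} (hc : Conn O c c') : Conn O' c c' := by
  induction hc with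
  | refl => exact .refl
  | tail _ hs ih =>
    obtain ⟨-, -, r, hr, g, -, -, rfl, rfl⟩ := hs
    exact ih.trans (Conn.add_left g (h r hr))

theorem ConnIn.mono {V V' : Set X} (hV : V ⊆ V') {c c' : Multiset X} (h : ConnIn O V c c') :
    ConnIn O V' c c' :=
  reflTransGen_mono (fun _ _ h => StepOn.mono h (fun _ hc x hx => hV (hc x hx)) hV) h

/-- A derivation involves finitely many variables. -/
theorem Conn.exists_connIn [DecidableEq X] {s t : Multiset X} (h : Conn O s t) :
    ∃ V : Finset X, ConnIn O V s t := by
  induction h with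
  | refl => exact ⟨∅, .refl⟩
  | @tail b c _ hs ih =>
    obtain ⟨V, hV⟩ := ih
    obtain ⟨-, -, r, hr, g, -, -, hb, hc⟩ := hs
    let V' : Finset X := V ∪ ((g + r.1).toFinset ∪ (g + r.2).toFinset)
    refine ⟨V', (hV.mono fun x hx => ?_).tail ⟨?_, ?_, r, hr, g, ?_, ?_, hb, hc⟩⟩
    · exact Finset.mem_union_left _ hx
    all_goals
      intro x hx
      simp only [V', hb, hc, Multiset.mem_add, Finset.mem_coe, Finset.mem_union,
        Multiset.mem_toFinset] at hx ⊢
      tauto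

end Rewriting

section Elimination

variable {X : Type*} [LinearOrder X] {O : Set (Multiset X × Multiset X)}

/-- The critical peaks of `O`: whenever two rules decrease their least common multiple, the two
results are connected in the variables of the two rules, through monomials below that multiple. -/
def CriticalPeaks (O : Set (Multiset X × Multiset X)) : Prop :=
  ∀ r ∈ O, ∀ r' ∈ O, ∀ (o : Option X) (g g' : Multiset X), g + r.1 = g' + r'.1 → Disjoint g g' →
    Lt o r.2 r.1 → Lt o r'.2 r'.1 →
    Relation.ReflTransGen
      (StepOn O (fun c => (∀ x ∈ c, x ∈ r.1 + r.2 + r'.1 + r'.2) ∧ Lt o c (g + r.1))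
        {x | x ∈ r.1 + r.2 + r'.1 + r'.2})
      (g + r.2) (g' + r'.2)

/-- `u` cannot be decreased by a rule in the variables `V`. -/
def Irred (O : Set (Multiset X × Multiset X)) (o : Option X) (V : Set X) (u : Multiset X) : Prop :=
  ∀ r ∈ O, (∀ x ∈ r.1, x ∈ V) → (∀ x ∈ r.2, x ∈ V) → r.1 ≤ u → ¬ Lt o r.2 r.1

/-- A descending step in the variables `V`. -/
abbrev Descend (O : Set (Multiset X × Multiset X)) (o : Option X) (V : Set X)
    (c c' : Multiset X) : Prop :=
  StepOn O (fun c => ∀ x ∈ c, x ∈ V) V c c' ∧ Lt o c' c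

/-- Over finitely many variables the monomial order is well-founded, so that connected critical peaks
make the rules confluent: any peak is a critical one, multiplied by a common context. -/
theorem exists_common_descendant (hO : ∀ r ∈ O, r.swap ∈ O) (hcp : CriticalPeaks O)
    (o : Option X) (V : Finset X) {s t : Multiset X} (h : ConnIn O V s t) :
    ∃ u, Relation.ReflTransGen (Descend O o V) s u ∧ Relation.ReflTransGen (Descend O o V) t u := by
  have hj := fun h₁ h₂ => join_of_peaks_connected_below (Lt.wellFounded o V)
    (S := StepOn O (fun c => ∀ x ∈ c, x ∈ (V : Set X)) V) (fun _ _ h => h.symm hO) h₁ h₂ h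
  specialize hj ?_ ?_
  rotate_left 2
  · obtain ⟨u, hs, ht⟩ := hj
    exact ⟨u, reflTransGen_mono (fun _ _ h => ⟨h.1, h.2.2.2⟩) hs,
      reflTransGen_mono (fun _ _ h => ⟨h.1, h.2.2.2⟩) ht⟩
  · intro x y hxy
    rcases Lt.total o x y with h | h | h
    · exact .inl h
    · exact .inr (.inl ⟨hxy.1, hxy.2.1, h⟩)
    · exact .inr (.inr ⟨hxy.2.1, hxy.1, h⟩)
  · intro m x y hx hy hxm hym
    obtain ⟨hmV, hxV, r, hr, h, hr₁, hr₂, hm, rfl⟩ := hx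
    obtain ⟨-, hyV, r', hr', h', hr'₁, hr'₂, hm', rfl⟩ := hy
    have hlt : Lt o r.2 r.1 := by
      have := hxm.2.2
      rwa [hm, Lt.add_left_iff] at this
    have hlt' : Lt o r'.2 r'.1 := by
      have := hym.2.2
      rwa [hm', Lt.add_left_iff] at this
    -- the common context of the two rules splits off
    have he : h ∩ h' + (h - h ∩ h') = h := add_tsub_cancel_of_le (Multiset.inter_le_left)
    have he' : h ∩ h' + (h' - h ∩ h') = h' := add_tsub_cancel_of_le (Multiset.inter_le_right)
    set e := h ∩ h' with he_def
    set g := h - e with hg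
    set g' := h' - e with hg'
    have hdis : Disjoint g g' := by
      rw [Multiset.disjoint_left]
      intro a ha ha'
      have h1 := Multiset.count_pos.2 ha
      have h2 := Multiset.count_pos.2 ha'
      rw [hg, he_def, Multiset.count_sub, Multiset.count_inter] at h1
      rw [hg', he_def, Multiset.count_sub, Multiset.count_inter] at h2
      omega
    have hgg : g + r.1 = g' + r'.1 := by
      have := hm.symm.trans hm'
      rw [← he, ← he', add_assoc, add_assoc] at this
      exact add_left_cancel this
    have hme : m = e + (g + r.1) := by rw [hm, ← add_assoc, he]
    have hW : ∀ x ∈ r.1 + r.2 + r'.1 + r'.2, x ∈ (V : Set X) := by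
      intro x hx
      simp only [Multiset.mem_add] at hx
      rcases hx with ((hx | hx) | hx) | hx
      exacts [hr₁ x hx, hr₂ x hx, hr'₁ x hx, hr'₂ x hx]
    have hstart : ∀ x ∈ e + (g + r.2), x ∈ (V : Set X) := by
      rw [← add_assoc, he]
      exact hxV
    have hc := hcp r hr r' hr' o g g' hgg hdis hlt hlt'
    have hsx : h + r.2 = e + (g + r.2) := by rw [← add_assoc, he]
    have hsy : h' + r'.2 = e + (g' + r'.2) := by rw [← add_assoc, he']
    rw [hsx, hsy]
    refine Relation.ReflTransGen.lift (e + ·) (fun b c hs => ?_) _ _ hc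
    have heV : ∀ x ∈ e, x ∈ (V : Set X) := fun x hx => hstart x (Multiset.mem_add.2 (.inl hx))
    have hQ : ∀ c, (∀ x ∈ c, x ∈ r.1 + r.2 + r'.1 + r'.2) ∧ Lt o c (g + r.1) →
        (∀ x ∈ e + c, x ∈ (V : Set X)) ∧ Lt o (e + c) m := by
      refine fun c hc => ⟨fun x hx => ?_, ?_⟩
      · rcases Multiset.mem_add.1 hx with hx | hx
        exacts [heV x hx, hW x (hc.1 x hx)]
      · rw [hme]
        exact (Lt.add_left_iff e).2 hc.2
    have hb := hQ b hs.1
    have hc := hQ c hs.2.1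
    exact ⟨(hs.add_left e fun c hc => (hQ c hc).1).mono (fun _ h => h) hW,
      ⟨hb.1, hmV, hb.2⟩, ⟨hc.1, hmV, hc.2⟩⟩

/-- If `v` is marked, its exponent counts first. Hence a descent that starts without `v` never
introduces `v`. -/
theorem Descend.count_eq_zero {v : X} {V : Finset X} {s u : Multiset X}
    (h : Relation.ReflTransGen (Descend O (some v) V) s u) (hs : v ∉ s) :
    v ∉ u ∧ ConnIn O (V.erase v) s u := by
  induction h with
  | refl => exact ⟨hs, .refl⟩
  | @tail b c _ hd ih =>
    obtain ⟨⟨hbV, hcV, r, hr, g, hr₁, hr₂, rfl, rfl⟩, hlt⟩ := hd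
    have hb := ih.1
    have hw : weight (some v) (g + r.2) ≤ weight (some v) (g + r.1) := by
      rcases hlt with h | h
      · exact h.le
      · exact h.1.le
    have hc : v ∉ g + r.2 := by
      rw [← Multiset.count_eq_zero] at hb ⊢
      simp only [weight, Option.elim] at hw
      omega
    have aux : ∀ {a : Multiset X}, (∀ x ∈ a, x ∈ (V : Set X)) → v ∉ a →
        ∀ x ∈ a, x ∈ (V.erase v : Set X) := by
      intro a ha hva x hx
      exact Finset.mem_coe.2 (Finset.mem_erase.2 ⟨fun h => hva (h ▸ hx), ha x hx⟩)
    refine ⟨hc, ih.2.tail ?_⟩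
    exact ⟨aux hbV hb, aux hcV hc, r, hr, g, aux hr₁ fun h => hb (by simp [h]),
      aux hr₂ fun h => hc (by simp [h]), rfl, rfl⟩

/-- Variables that occur in neither end of a derivation can be eliminated from it, one by one,
by giving them the highest weight in the monomial order. -/
theorem connIn_support (hO : ∀ r ∈ O, r.swap ∈ O) (hcp : CriticalPeaks O)
    {s t : Multiset X} (h : Conn O s t) : ConnIn O {x | x ∈ s + t} s t := by
  obtain ⟨V, hV⟩ := h.exists_connIn
  let D : Finset X := (s + t).toFinset
  have key : ∀ F : Finset X, ConnIn O (D ∪ F : Finset X) s t → ConnIn O D s t := by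
    intro F
    induction F using Finset.induction_on with
    | empty => intro h; simpa using h
    | @insert v F _ ih =>
      intro h
      by_cases hv : v ∈ D
      · refine ih (h.mono fun x hx => ?_)
        simp only [Finset.coe_union, Finset.coe_insert, Set.mem_union, Set.mem_insert_iff] at hx ⊢
        rcases hx with hx | rfl | hx
        exacts [.inl hx, .inl hv, .inr hx]
      · have hvs : v ∉ s := fun h => hv (by simp [D, h])
        have hvt : v ∉ t := fun h => hv (by simp [D, h])
        obtain ⟨u, hsu, htu⟩ := exists_common_descendant hO hcp (some v) _ h
        have h₁ := (Descend.count_eq_zero hsu hvs).2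
        have h₂ := (Descend.count_eq_zero htu hvt).2
        have h₃ := h₁.trans (reflTransGen_symm (fun _ _ h => StepOn.symm hO h) h₂)
        refine ih (ConnIn.mono ?_ h₃)
        intro x hx
        simp only [Finset.coe_erase, Finset.coe_union, Finset.coe_insert, Set.mem_sdiff,
          Set.mem_union, Set.mem_insert_iff, Set.mem_singleton_iff] at hx ⊢
        tauto
  refine ConnIn.mono ?_ (key V (hV.mono ?_))
  · intro x hx
    simpa [D] using hx
  · intro x hx
    simp only [Finset.coe_union]
    exact .inr hx

/-- Distinct monomials that are irreducible in their joint variables are not congruent. A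
derivation between them can be taken in these variables, by `connIn_support`, and then they have a
common descendant in these variables. -/
theorem eq_of_conn_of_irred (hO : ∀ r ∈ O, r.swap ∈ O) (hcp : CriticalPeaks O)
    {s t : Multiset X} (o : Option X) (hs : Irred O o {x | x ∈ s + t} s)
    (ht : Irred O o {x | x ∈ s + t} t) (h : Conn O s t) : s = t := by
  have h' := connIn_support hO hcp h
  have hD : {x | x ∈ s + t} = (((s + t).toFinset : Finset X) : Set X) := by ext x; simp
  rw [hD] at h' hs ht
  obtain ⟨u, hsu, htu⟩ := exists_common_descendant hO hcp o _ h'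
  have aux : ∀ {c}, Irred O o ((s + t).toFinset : Finset X) c →
      Relation.ReflTransGen (Descend O o ((s + t).toFinset : Finset X)) c u → c = u := by
    intro c hc hcu
    rcases hcu.cases_head with h | ⟨d, ⟨⟨-, -, r, hr, g, hr₁, hr₂, rfl, rfl⟩, hlt⟩, -⟩
    · exact h
    · exact absurd ((Lt.add_left_iff g).1 hlt) (hc r hr hr₁ hr₂ (Multiset.le_add_left _ _))
  exact (aux hs hsu).trans (aux ht htu).symm

/-- Every monomial descends to an irreducible one. -/
theorem exists_irred_descendant (o : Option X) (V : Finset X) (s : Multiset X)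
    (hs : ∀ x ∈ s, x ∈ V) :
    ∃ u, (∀ x ∈ u, x ∈ V) ∧ Irred O o V u ∧ Relation.ReflTransGen (Descend O o V) s u := by
  induction s using (Lt.wellFounded o V).induction with
  | _ s ih =>
  by_cases h : Irred O o V s
  · exact ⟨s, hs, h, .refl⟩
  · simp only [Irred, not_forall, not_not] at h
    obtain ⟨r, hr, hr₁, hr₂, hle, hlt⟩ := h
    obtain ⟨g, rfl⟩ := Multiset.le_iff_exists_add.1 hle
    rw [add_comm] at hs ih ⊢
    have hs' : ∀ x ∈ g + r.2, x ∈ V := by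
      intro x hx
      rcases Multiset.mem_add.1 hx with hx | hx
      · exact hs x (by simp [hx])
      · exact hr₂ x hx
    have hlt' := (Lt.add_left_iff g).2 hlt
    obtain ⟨u, hu, hi, hd⟩ := ih (g + r.2) ⟨hs', hs, hlt'⟩ hs'
    exact ⟨u, hu, hi, .head ⟨⟨hs, hs', r, hr, g, hr₁, hr₂, rfl, rfl⟩, hlt'⟩ hd⟩

/-- `O` is a Gröbner basis of its congruence for all the orders `Lt o` and all sets of variables
at once: of two distinct congruent monomials, the larger one is decreased by a rule in their
joint variables. -/
def IsBasis (O : Set (Multiset X × Multiset X)) : Prop :=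
  ∀ (o : Option X) (s t : Multiset X), Conn O s t → Lt o t s →
    ∃ r ∈ O, (∀ x ∈ r.1, x ∈ s + t) ∧ (∀ x ∈ r.2, x ∈ s + t) ∧ r.1 ≤ s ∧ Lt o r.2 r.1

theorem IsBasis.eq_of_irred (hO : ∀ r ∈ O, r.swap ∈ O) (hB : IsBasis O) {o : Option X} {V : Set X}
    {s t : Multiset X} (hsV : ∀ x ∈ s, x ∈ V) (htV : ∀ x ∈ t, x ∈ V) (h : Conn O s t)
    (hs : Irred O o V s) (ht : Irred O o V t) : s = t := by
  have hV : ∀ x ∈ s + t, x ∈ V := by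
    intro x hx
    rcases Multiset.mem_add.1 hx with hx | hx
    exacts [hsV x hx, htV x hx]
  rcases Lt.total o s t with h' | h' | h'
  · exact h'
  · obtain ⟨r, hr, hr₁, hr₂, hle, hlt⟩ := hB o t s (h.symm hO) h'
    exact absurd hlt (ht r hr (fun x hx => hV x (add_comm s t ▸ hr₁ x hx))
      (fun x hx => hV x (add_comm s t ▸ hr₂ x hx)) hle)
  · obtain ⟨r, hr, hr₁, hr₂, hle, hlt⟩ := hB o s t h h'
    exact absurd hlt (hs r hr (fun x hx => hV x (hr₁ x hx)) (fun x hx => hV x (hr₂ x hx)) hle)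

/-- Both ends of a critical peak descend to irreducible monomials in the variables of the two rules.
These are congruent, hence equal, and the descents stay below the top of the peak. -/
theorem IsBasis.criticalPeaks (hO : ∀ r ∈ O, r.swap ∈ O) (hB : IsBasis O) : CriticalPeaks O := by
  intro r hr r' hr' o g g' hgg hdis hlt hlt'
  set W : Finset X := (r.1 + r.2 + r'.1 + r'.2).toFinset with hW
  have hg : ∀ x ∈ g, x ∈ r'.1 := by
    intro x hx
    have hx' : x ∈ g' + r'.1 := hgg ▸ Multiset.mem_add.2 (.inl hx)
    exact (Multiset.mem_add.1 hx').resolve_left (Multiset.disjoint_left.1 hdis hx)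
  have hg' : ∀ x ∈ g', x ∈ r.1 := by
    intro x hx
    have hx' : x ∈ g + r.1 := hgg ▸ Multiset.mem_add.2 (.inl hx)
    exact (Multiset.mem_add.1 hx').resolve_left (Multiset.disjoint_right.1 hdis hx)
  have hs : ∀ x ∈ g + r.2, x ∈ W := by
    intro x hx
    simp only [hW, Multiset.mem_toFinset, Multiset.mem_add] at hx ⊢
    rcases hx with hx | hx
    · exact .inl (.inr (hg x hx))
    · tauto
  have ht : ∀ x ∈ g' + r'.2, x ∈ W := by
    intro x hx
    simp only [hW, Multiset.mem_toFinset, Multiset.mem_add] at hx ⊢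
    rcases hx with hx | hx
    · exact .inl (.inl (.inl (hg' x hx)))
    · tauto
  obtain ⟨u, huV, hu, hsu⟩ := exists_irred_descendant (O := O) o W _ hs
  obtain ⟨w, hwV, hw, htw⟩ := exists_irred_descendant (O := O) o W _ ht
  have hconn : ∀ {a b}, Relation.ReflTransGen (Descend O o W) a b → Conn O a b := fun h =>
    reflTransGen_mono (fun _ _ h => h.1.mono (fun _ _ => trivial) (Set.subset_univ _)) h
  have huw : u = w := by
    refine hB.eq_of_irred hO huV hwV ?_ hu hw
    refine ((hconn hsu).symm hO).trans (.trans ?_ (hconn htw))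
    refine ((Conn.of_mem hr g).symm hO).trans ?_
    rw [hgg]
    exact Conn.of_mem hr' g'
  have hmem : ∀ x, x ∈ r.1 + r.2 + r'.1 + r'.2 ↔ x ∈ (W : Set X) := by
    intro x; simp [hW, or_assoc]
  simp only [hmem]
  have aux : ∀ {a z}, Lt o a (g + r.1) → Relation.ReflTransGen (Descend O o W) a z →
      Relation.ReflTransGen (StepOn O (fun c => (∀ x ∈ c, x ∈ (W : Set X)) ∧ Lt o c (g + r.1))
        {x | x ∈ (W : Set X)}) a z := by
    intro a z ha h
    have : (z = a ∨ Lt o z a) ∧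
        Relation.ReflTransGen (StepOn O (fun c => (∀ x ∈ c, x ∈ (W : Set X)) ∧
          Lt o c (g + r.1)) {x | x ∈ (W : Set X)}) a z := by
      induction h with
      | refl => exact ⟨.inl rfl, .refl⟩
      | @tail b c _ hd ih =>
        have hb : Lt o b (g + r.1) := by
          rcases ih.1 with h | h
          · rwa [h]
          · exact h.trans ha
        have hca : Lt o c a := by
          rcases ih.1 with h | h
          · exact h ▸ hd.2
          · exact hd.2.trans h
        obtain ⟨⟨hbW, hcW, r₀, hr₀, k, hk₁, hk₂, hbk, hck⟩, hlt⟩ := hd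
        exact ⟨.inr hca, ih.2.tail ⟨⟨hbW, hb⟩, ⟨hcW, hlt.trans hb⟩, r₀, hr₀, k, hk₁, hk₂, hbk, hck⟩⟩
    exact this.2
  refine (aux ((Lt.add_left_iff g).2 hlt) hsu).trans (reflTransGen_symm
    (fun _ _ h => StepOn.symm hO h) (huw ▸ aux ?_ htw))
  rw [hgg]
  exact (Lt.add_left_iff g').2 hlt'

end Elimination


/-! ### Tokens, order types and embeddings -/

/-- Tokens with `n` data coordinates in `α`, followed by the number of a place. -/
def Tok (α : Type) : ℕ → Type
  | 0 => ℕ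
  | n + 1 => α × Tok α n

namespace Tok

variable {α β γ : Type}

/-- The first coordinate of a token. -/
def head {n : ℕ} (x : Tok α (n + 1)) : α := Prod.fst x

/-- The remaining coordinates of a token. -/
def tail {n : ℕ} (x : Tok α (n + 1)) : Tok α n := Prod.snd x

/-- The token with a given first coordinate and given remaining coordinates. -/
def cons {n : ℕ} (a : α) (x : Tok α n) : Tok α (n + 1) := (a, x)

@[simp] theorem tail_cons {n : ℕ} (a : α) (x : Tok α n) : (cons a x).tail = x := rfl

theorem ext_iff {n : ℕ} {x y : Tok α (n + 1)} : x = y ↔ x.head = y.head ∧ x.tail = y.tail :=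
  Prod.ext_iff

/-- The place of a token. -/
def place : {n : ℕ} → Tok α n → ℕ
  | 0, x => x
  | _ + 1, x => place x.tail

/-- The list of the data coordinates of a token. -/
def coords : {n : ℕ} → Tok α n → List α
  | 0, _ => []
  | _ + 1, x => x.head :: coords x.tail

theorem length_coords : ∀ {n : ℕ} (x : Tok α n), x.coords.length = n
  | 0, _ => rfl
  | _ + 1, x => by simp [coords, length_coords x.tail]

/-- Applying a function to all data coordinates. -/
def map (f : α → β) : {n : ℕ} → Tok α n → Tok β n
  | 0, x => (x : ℕ)
  | _ + 1, x => cons (f x.head) (map f x.tail)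

@[simp] theorem head_map (f : α → β) {n : ℕ} (x : Tok α (n + 1)) : (x.map f).head = f x.head := rfl
@[simp] theorem tail_map (f : α → β) {n : ℕ} (x : Tok α (n + 1)) :
    (x.map f).tail = x.tail.map f := rfl

theorem map_map (g : β → γ) (f : α → β) :
    ∀ {n : ℕ} (x : Tok α n), (x.map f).map g = x.map (g ∘ f)
  | 0, _ => rfl
  | _ + 1, x => ext_iff.2 ⟨rfl, map_map g f x.tail⟩

theorem map_eq_self {f : α → α} : ∀ {n : ℕ} (x : Tok α n), (∀ a ∈ x.coords, f a = a) → x.map f = x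
  | 0, _, _ => rfl
  | _ + 1, x, h => ext_iff.2 ⟨h _ (by simp [coords]),
      map_eq_self x.tail fun a ha => h a (by simp [coords, ha])⟩

theorem coords_map (f : α → β) : ∀ {n : ℕ} (x : Tok α n), (x.map f).coords = x.coords.map f
  | 0, _ => rfl
  | _ + 1, x => by simp [coords, coords_map f x.tail]

/-- Tokens are ordered lexicographically. -/
instance instLinearOrder [LinearOrder α] : (n : ℕ) → LinearOrder (Tok α n)
  | 0 => inferInstanceAs (LinearOrder ℕ)
  | n + 1 =>
    letI : LinearOrder (Tok α n) := instLinearOrder n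
    LinearOrder.lift' (fun x : Tok α (n + 1) => toLex (x.head, x.tail)) fun x y h => by
      have h' := toLex.injective h
      exact ext_iff.2 (Prod.ext_iff.1 h')

theorem lt_iff [LinearOrder α] {n : ℕ} {x y : Tok α (n + 1)} :
    x < y ↔ x.head < y.head ∨ x.head = y.head ∧ x.tail < y.tail :=
  Prod.Lex.lt_iff

end Tok

section SameTp

variable {α β γ : Type} [LinearOrder α] [LinearOrder β] [LinearOrder γ]

/-- The pairs `(x, y)` and `(x', y')` of tokens have the same type: the same places, the same
first coordinate in which they differ, and the same order there. -/
def SameTp : {n : ℕ} → Tok α n → Tok α n → Tok β n → Tok β n → Prop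
  | 0, x, y, x', y' => x.place = x'.place ∧ y.place = y'.place
  | _ + 1, x, y, x', y' => (x.head < y.head ↔ x'.head < y'.head) ∧
      (y.head < x.head ↔ y'.head < x'.head) ∧
      (x.head = y.head → SameTp x.tail y.tail x'.tail y'.tail)

theorem eq_iff_of_lt_iff {a b : α} {a' b' : β} (h : a < b ↔ a' < b') (h' : b < a ↔ b' < a') :
    a = b ↔ a' = b' := by
  rw [le_antisymm_iff, le_antisymm_iff, ← not_lt, ← not_lt, ← not_lt, ← not_lt, h, h']

namespace SameTp

theorem refl : ∀ {n : ℕ} (x y : Tok α n), SameTp x y x y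
  | 0, _, _ => ⟨rfl, rfl⟩
  | _ + 1, x, y => ⟨Iff.rfl, Iff.rfl, fun _ => refl x.tail y.tail⟩

theorem symm : ∀ {n : ℕ} {x y : Tok α n} {x' y' : Tok β n}, SameTp x y x' y' → SameTp x' y' x y
  | 0, _, _, _, _, h => ⟨h.1.symm, h.2.symm⟩
  | _ + 1, _, _, _, _, h =>
    ⟨h.1.symm, h.2.1.symm, fun he => symm (h.2.2 ((eq_iff_of_lt_iff h.1 h.2.1).2 he))⟩

theorem swap : ∀ {n : ℕ} {x y : Tok α n} {x' y' : Tok β n}, SameTp x y x' y' → SameTp y x y' x'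
  | 0, _, _, _, _, h => ⟨h.2, h.1⟩
  | _ + 1, _, _, _, _, h => ⟨h.2.1, h.1, fun he => swap (h.2.2 he.symm)⟩

theorem trans : ∀ {n : ℕ} {x y : Tok α n} {x' y' : Tok β n} {x'' y'' : Tok γ n},
    SameTp x y x' y' → SameTp x' y' x'' y'' → SameTp x y x'' y''
  | 0, _, _, _, _, _, _, h, h' => ⟨h.1.trans h'.1, h.2.trans h'.2⟩
  | _ + 1, _, _, _, _, _, _, h, h' => ⟨h.1.trans h'.1, h.2.1.trans h'.2.1, fun he =>
      trans (h.2.2 he) (h'.2.2 ((eq_iff_of_lt_iff h.1 h.2.1).1 he))⟩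

theorem place_eq : ∀ {n : ℕ} {x : Tok α n} {x' : Tok β n}, SameTp x x x' x' → x.place = x'.place
  | 0, _, _, h => h.1
  | _ + 1, x, x', h => place_eq (x := x.tail) (x' := x'.tail) (h.2.2 rfl)

theorem lt_iff : ∀ {n : ℕ} {x y : Tok α n} {x' y' : Tok β n}, SameTp x y x' y' →
    (x < y ↔ x' < y')
  | 0, x, y, x', y', h => by
    change x.place < y.place ↔ x'.place < y'.place
    rw [h.1, h.2]
  | _ + 1, x, y, x', y', h => by
    rw [Tok.lt_iff, Tok.lt_iff, h.1]
    refine or_congr Iff.rfl ⟨fun h' => ?_, fun h' => ?_⟩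
    · exact ⟨(eq_iff_of_lt_iff h.1 h.2.1).1 h'.1, (lt_iff (h.2.2 h'.1)).1 h'.2⟩
    · have he := (eq_iff_of_lt_iff h.1 h.2.1).2 h'.1
      exact ⟨he, (lt_iff (h.2.2 he)).2 h'.2⟩

theorem eq_iff {n : ℕ} {x y : Tok α n} {x' y' : Tok β n} (h : SameTp x y x' y') :
    x = y ↔ x' = y' :=
  eq_iff_of_lt_iff h.lt_iff h.swap.lt_iff

/-- Coordinatewise application of a strictly monotone function preserves types. -/
theorem map {f : α → β} {s : Set α} (hf : StrictMonoOn f s) : ∀ {n : ℕ} {x y : Tok α n},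
    (∀ a ∈ x.coords, a ∈ s) → (∀ a ∈ y.coords, a ∈ s) → SameTp x y (x.map f) (y.map f)
  | 0, _, _, _, _ => ⟨rfl, rfl⟩
  | n + 1, x, y, hx, hy => by
    have hx' : x.head ∈ s := hx _ (by simp [Tok.coords])
    have hy' : y.head ∈ s := hy _ (by simp [Tok.coords])
    exact ⟨(hf.lt_iff_lt hx' hy').symm, (hf.lt_iff_lt hy' hx').symm, fun _ =>
      map hf (fun a ha => hx a (by simp [Tok.coords, ha]))
        fun a ha => hy a (by simp [Tok.coords, ha])⟩

end SameTp

/-- Embeddings of tokens: maps that preserve the types of pairs. -/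
def IsEmb {n : ℕ} (ι : Tok α n → Tok β n) : Prop := ∀ x y, SameTp x y (ι x) (ι y)

namespace IsEmb

theorem id {n : ℕ} : IsEmb (fun x : Tok α n => x) := SameTp.refl

theorem comp {n : ℕ} {κ : Tok β n → Tok γ n} {ι : Tok α n → Tok β n} (hκ : IsEmb κ)
    (hι : IsEmb ι) : IsEmb fun x => κ (ι x) :=
  fun x y => (hι x y).trans (hκ _ _)

theorem lt_iff {n : ℕ} {ι : Tok α n → Tok β n} (hι : IsEmb ι) {x y : Tok α n} :
    ι x < ι y ↔ x < y :=
  (hι x y).lt_iff.symm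

theorem injective {n : ℕ} {ι : Tok α n → Tok β n} (hι : IsEmb ι) : Function.Injective ι :=
  fun x y h => (hι x y).eq_iff.2 h

theorem place_eq {n : ℕ} {ι : Tok α n → Tok β n} (hι : IsEmb ι) (x : Tok α n) :
    (ι x).place = x.place :=
  (hι x x).place_eq.symm

theorem map {n : ℕ} {f : α → β} (hf : StrictMono f) :
    IsEmb (fun x : Tok α n => x.map f) := fun _ _ =>
  SameTp.map (s := Set.univ) (hf.strictMonoOn _) (fun _ _ => trivial) fun _ _ => trivial

end IsEmb

end SameTp

/-! ### Homogeneity -/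

/-- A strictly monotone map between finite sets of rationals extends to all rationals. -/
theorem exists_strictMono_eqOn (S : Finset ℚ) (f : ℚ → ℚ) (hf : StrictMonoOn f S) :
    ∃ g : ℚ → ℚ, StrictMono g ∧ ∀ x ∈ S, g x = f x := by
  induction S using Finset.induction_on_max with
  | empty => exact ⟨fun x => x, strictMono_id, by simp⟩
  | insert a S ha ih =>
    obtain ⟨g, hg, hgf⟩ := ih (hf.mono (by simp))
    rcases S.eq_empty_or_nonempty with rfl | hS
    · exact ⟨fun x => x + (f a - a), fun x y h => by simpa using h, by simp⟩
    · set b := S.max' hS with hb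
      have hbS : b ∈ S := S.max'_mem hS
      have hba : b < a := ha b hbS
      have hfb : f b < f a := hf (by simp [hbS]) (by simp) hba
      have hc : 0 < (f a - f b) / (a - b) := div_pos (sub_pos.2 hfb) (sub_pos.2 hba)
      refine ⟨fun x => if x ≤ b then g x else f b + (x - b) * ((f a - f b) / (a - b)), ?_, ?_⟩
      · intro x y hxy
        dsimp only
        by_cases hx : x ≤ b <;> by_cases hy : y ≤ b
        · simpa [hx, hy] using hg hxy
        · have h1 : g x ≤ f b := hgf b hbS ▸ hg.monotone hx
          have h2 := mul_pos (sub_pos.2 (not_le.1 hy)) hc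
          rw [if_pos hx, if_neg hy]
          linarith
        · exact absurd (hxy.le.trans hy) hx
        · rw [if_neg hx, if_neg hy]
          have := mul_lt_mul_of_pos_right (sub_lt_sub_right hxy b) hc
          linarith
      · intro x hx
        rcases Finset.mem_insert.1 hx with rfl | hx
        · have : x - b ≠ 0 := (sub_pos.2 hba).ne'
          simp only [not_le.2 hba, if_false]
          field_simp
          ring
        · exact (if_pos (S.le_max' x hx)).trans (hgf x hx)

/-- Homogeneity of the rational order, for a map given by its graph. -/
theorem exists_strictMono_of_pairs (Z : List (ℚ × ℚ))
    (hZ : ∀ p ∈ Z, ∀ q ∈ Z, p.1 < q.1 ↔ p.2 < q.2) :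
    ∃ g : ℚ → ℚ, StrictMono g ∧ ∀ p ∈ Z, g p.1 = p.2 := by
  classical
  let f : ℚ → ℚ := fun x => if h : ∃ y, (x, y) ∈ Z then h.choose else 0
  have hf : ∀ p ∈ Z, f p.1 = p.2 := by
    intro p hp
    have h : ∃ y, (p.1, y) ∈ Z := ⟨p.2, hp⟩
    have hc := h.choose_spec
    simp only [f, dif_pos h]
    exact (eq_iff_of_lt_iff (hZ _ hc _ hp) (hZ _ hp _ hc)).1 rfl
  have hmono : StrictMonoOn f (Z.map Prod.fst).toFinset := by
    intro x hx y hy hxy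
    simp only [List.coe_toFinset, List.mem_map, Set.mem_ofPred_eq] at hx hy
    obtain ⟨p, hp, rfl⟩ := hx
    obtain ⟨q, hq, rfl⟩ := hy
    rw [hf p hp, hf q hq]
    exact (hZ p hp q hq).1 hxy
  obtain ⟨g, hg, hgf⟩ := exists_strictMono_eqOn (Z.map Prod.fst).toFinset f hmono
  refine ⟨g, hg, fun p hp => ?_⟩
  rw [hgf p.1 (by simpa using ⟨p.2, hp⟩), hf p hp]

/-- Homogeneity: a finite partial map that preserves types extends to an embedding. -/
theorem exists_isEmb_of_pairs : ∀ {n : ℕ} (Z : List (Tok ℚ n × Tok ℚ n)),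
    (∀ p ∈ Z, ∀ q ∈ Z, SameTp p.1 q.1 p.2 q.2) → ∃ ι : Tok ℚ n → Tok ℚ n, IsEmb ι ∧
      ∀ p ∈ Z, ι p.1 = p.2
  | 0, Z, hZ => ⟨fun x => x, IsEmb.id, fun p hp => (hZ p hp p hp).1⟩
  | n + 1, Z, hZ => by
    obtain ⟨g, hg, hgZ⟩ := exists_strictMono_of_pairs (Z.map fun p => (p.1.head, p.2.head)) (by
      simp only [List.mem_map]
      rintro _ ⟨p, hp, rfl⟩ _ ⟨q, hq, rfl⟩
      exact (hZ p hp q hq).1)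
    have ih : ∀ a : ℚ, ∃ ι : Tok ℚ n → Tok ℚ n, IsEmb ι ∧
        ∀ p ∈ Z, p.1.head = a → ι p.1.tail = p.2.tail := by
      intro a
      obtain ⟨ι, hι, h⟩ := exists_isEmb_of_pairs
        ((Z.filter fun p => p.1.head = a).map fun p => (p.1.tail, p.2.tail)) (by
          simp only [List.mem_map, List.mem_filter, decide_eq_true_eq]
          rintro _ ⟨p, ⟨hp, hpa⟩, rfl⟩ _ ⟨q, ⟨hq, hqa⟩, rfl⟩
          exact (hZ p hp q hq).2.2 (hpa.trans hqa.symm))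
      refine ⟨ι, hι, fun p hp hpa => h (p.1.tail, p.2.tail) ?_⟩
      exact List.mem_map.2 ⟨p, List.mem_filter.2 ⟨hp, by simpa using hpa⟩, rfl⟩
    choose ι hι hιZ using ih
    refine ⟨fun x => .cons (g x.head) (ι x.head x.tail), fun x y => ?_, fun p hp => ?_⟩
    · refine ⟨hg.lt_iff_lt.symm, hg.lt_iff_lt.symm, fun h => ?_⟩
      simp only [Tok.tail_cons, ← h]
      exact hι _ _ _
    · exact Tok.ext_iff.2 ⟨hgZ _ (List.mem_map_of_mem hp), hιZ _ p hp rfl⟩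

/-! ### The well-quasi-order on finite labelled sets of tokens -/

/-- A finite set of labelled tokens embeds in another one, increasing the labels. -/
def LabelledLe {L : Type} (r : L → L → Prop) (n : ℕ)
    (A B : Finset (Tok ℚ n) × (Tok ℚ n → L)) : Prop :=
  ∃ ι : Tok ℚ n → Tok ℚ n, IsEmb ι ∧ ∀ x ∈ A.1, ι x ∈ B.1 ∧ r (A.2 x) (B.2 (ι x))

instance {L : Type} (r : L → L → Prop) [IsPreorder L r] (n : ℕ) :
    IsPreorder _ (LabelledLe r n) where
  refl A := ⟨fun x => x, IsEmb.id, fun x hx => ⟨hx, refl _⟩⟩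
  trans A B C := by
    rintro ⟨ι, hι, h⟩ ⟨κ, hκ, h'⟩
    exact ⟨fun x => κ (ι x), hκ.comp hι, fun x hx =>
      ⟨(h' _ (h x hx).1).1, _root_.trans (h x hx).2 (h' _ (h x hx).1).2⟩⟩

/-- Over finitely many places, finite labelled sets of tokens are well-quasi-ordered. This is
Higman's lemma, iterated over the coordinates: the set is read as the word of its first
coordinates, each labelled by the set of the remaining coordinates that go with it. -/
theorem labelledLe_pwo {L : Type} (r : L → L → Prop) [IsPreorder L r]
    (hr : WellQuasiOrdered r) (d : ℕ) : ∀ n : ℕ,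
    {A : Finset (Tok ℚ n) × (Tok ℚ n → L) | ∀ x ∈ A.1, x.place < d}.PartiallyWellOrderedOn
      (LabelledLe r n)
  | 0 => by
    classical
    rw [Set.partiallyWellOrderedOn_iff_exists_lt]
    intro f hf
    -- without coordinates a labelled set is a family, indexed by the places, of labels and bits
    -- that tell whether the place belongs to the set
    have : IsPreorder (Bool × L) fun a b => a.1 ≤ b.1 ∧ r a.2 b.2 :=
      { refl := fun a => ⟨le_rfl, refl_of r _⟩
        trans := fun a b c h h' => ⟨h.1.trans h'.1, trans_of r h.2 h'.2⟩ }
    have hw : WellQuasiOrdered fun a b : Fin d → Bool × L => ∀ i, (a i).1 ≤ (b i).1 ∧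
        r (a i).2 (b i).2 :=
      WellQuasiOrdered.pi (r := fun _ (a b : Bool × L) => a.1 ≤ b.1 ∧ r a.2 b.2) (fun _ =>
        WellQuasiOrdered.prod (Finite.wellQuasiOrdered _) hr)
    let e : Fin d → Tok ℚ 0 := fun x => (x : ℕ)
    obtain ⟨i, j, hij, h⟩ := hw fun i x => (decide (e x ∈ (f i).1), (f i).2 (e x))
    refine ⟨i, j, hij, fun x => x, IsEmb.id, fun x hx => ?_⟩
    have hx' := h ⟨x, hf i x hx⟩
    refine ⟨?_, hx'.2⟩
    exact of_decide_eq_true (Bool.le_iff_imp.1 hx'.1 (decide_eq_true hx))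
  | n + 1 => by
    classical
    rw [Set.partiallyWellOrderedOn_iff_exists_lt]
    intro f hf
    let E := ℚ × (Finset (Tok ℚ n) × (Tok ℚ n → L))
    let R : E → E → Prop := fun a b => LabelledLe r n a.2 b.2
    have : IsPreorder E R :=
      { refl := fun a => refl_of (LabelledLe r n) a.2
        trans := fun a b c h h' => trans_of (LabelledLe r n) h h' }
    have hR : {a : E | ∀ x ∈ a.2.1, x.place < d}.PartiallyWellOrderedOn R := by
      rw [Set.partiallyWellOrderedOn_iff_exists_lt]
      intro g hg
      exact (labelledLe_pwo r hr d n).exists_lt (f := fun i => (g i).2) hg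
    -- `w i` is the `i`-th set, as an increasing word of first coordinates and their slices
    let heads : ℕ → Finset ℚ := fun i => (f i).1.image Tok.head
    let slice : ℕ → ℚ → E := fun i a =>
      (a, (((f i).1.filter fun x => x.head = a).image Tok.tail, fun x => (f i).2 (.cons a x)))
    let w : ℕ → List E := fun i => ((heads i).sort (· ≤ ·)).map (slice i)
    obtain ⟨i, j, hij, h⟩ := (Set.PartiallyWellOrderedOn.partiallyWellOrderedOn_sublistForall₂ R
      hR).exists_lt (f := w) (by
        intro i e he
        obtain ⟨a, -, rfl⟩ := List.mem_map.1 he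
        intro x hx
        simp only [slice, Finset.mem_image, Finset.mem_filter] at hx
        obtain ⟨y, ⟨hy, -⟩, rfl⟩ := hx
        exact hf i y hy)
    refine ⟨i, j, hij, ?_⟩
    obtain ⟨l, hl, hsub⟩ := List.sublistForall₂_iff.1 h
    have hlen := hl.length_eq
    have hsort : ∀ i, ((w i).map Prod.fst).Pairwise (· < ·) := by
      intro i
      have : (w i).map Prod.fst = (heads i).sort (· ≤ ·) := by
        simp [w, slice, Function.comp_def]
      rw [this]
      exact ((heads i).sortedLT_sort).pairwise
    have hsl : (l.map Prod.fst).Pairwise (· < ·) := (hsort j).sublist (hsub.map _)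
    have hmono : ∀ {l : List E}, (l.map Prod.fst).Pairwise (· < ·) → ∀ (a b : ℕ)
        (ha : a < l.length) (hb : b < l.length), (l[a].1 < l[b].1 ↔ a < b) := by
      intro l hl a b ha hb
      rw [List.pairwise_iff_getElem] at hl
      have key : ∀ (a b : ℕ) (ha : a < l.length) (hb : b < l.length), a < b →
          l[a].1 < l[b].1 := by
        intro a b ha hb hab
        have := hl a b (by simpa using ha) (by simpa using hb) hab
        rwa [List.getElem_map, List.getElem_map] at this
      refine ⟨fun hlt => ?_, key a b ha hb⟩
      by_contra hab
      rcases (not_lt.1 hab).eq_or_lt with rfl | hab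
      · exact lt_irrefl _ hlt
      · exact lt_asymm hlt (key b a hb ha hab)
    -- `g` moves the letters of the smaller word to those of the subword of the larger one
    obtain ⟨g, hg, hgZ⟩ := exists_strictMono_of_pairs
      ((List.zip (w i) l).map fun p => (p.1.1, p.2.1)) (by
        simp only [List.mem_map]
        rintro _ ⟨p, hp, rfl⟩ _ ⟨q, hq, rfl⟩
        obtain ⟨a, ha, rfl⟩ := List.mem_iff_getElem.1 hp
        obtain ⟨b, hb, rfl⟩ := List.mem_iff_getElem.1 hq
        simp only [List.length_zip, lt_min_iff] at ha hb
        simp only [List.getElem_zip]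
        rw [hmono (hsort i) a b ha.1 hb.1, hmono hsl a b ha.2 hb.2])
    have hι : ∀ a : ℚ, ∃ ι : Tok ℚ n → Tok ℚ n, IsEmb ι ∧ ∀ x ∈ (f i).1, x.head = a →
        Tok.cons (g a) (ι x.tail) ∈ (f j).1 ∧
          r ((f i).2 x) ((f j).2 (.cons (g a) (ι x.tail))) := by
      intro a
      by_cases ha : a ∈ heads i
      · have hm : slice i a ∈ w i := List.mem_map_of_mem (by simpa using ha)
        obtain ⟨k, hk, hka⟩ := List.mem_iff_getElem.1 hm
        have hk' : k < l.length := hlen ▸ hk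
        have hz : (slice i a, l[k]) ∈ List.zip (w i) l :=
          List.mem_iff_getElem.2 ⟨k, by simp [hk, hk'], by simp [hka]⟩
        obtain ⟨ι, hι, hι'⟩ := (List.forall₂_iff_zip.1 hl).2 hz
        have hga : g a = l[k].1 := hgZ (a, l[k].1) (List.mem_map.2 ⟨_, hz, rfl⟩)
        obtain ⟨b, -, hb⟩ := List.mem_map.1 (hsub.subset (List.getElem_mem hk'))
        have hgb : g a = b := by rw [hga, ← hb]
        refine ⟨ι, hι, fun x hx hxa => ?_⟩
        have h2 := hι' x.tail (Finset.mem_image.2 ⟨x, Finset.mem_filter.2 ⟨hx, hxa⟩, rfl⟩)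
        rw [← hb] at h2
        simp only [slice, Finset.mem_image, Finset.mem_filter] at h2
        obtain ⟨⟨y, ⟨hy, hyb⟩, hyt⟩, h2⟩ := h2
        subst hxa hyb
        rw [hgb, ← hyt]
        rw [← hyt] at h2
        exact ⟨hy, h2⟩
      · refine ⟨fun x => x, IsEmb.id, fun x hx hxa => absurd ?_ ha⟩
        exact Finset.mem_image.2 ⟨x, hx, hxa⟩
    choose ι hι hι' using hι
    refine ⟨fun x => .cons (g x.head) (ι x.head x.tail), fun x y => ?_, fun x hx =>
      hι' x.head x hx rfl⟩
    refine ⟨hg.lt_iff_lt.symm, hg.lt_iff_lt.symm, fun h => ?_⟩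
    simp only [Tok.tail_cons, ← h]
    exact hι _ _ _


/-! ### Orbits of rules and finite bases -/

section Map

variable {X Y : Type*} [LinearOrder X] [LinearOrder Y] {κ : X → Y}

theorem weight_map (hκ : Function.Injective κ) {o : Option X} {o' : Option Y} {c : Multiset X}
    (h : ∀ x ∈ c, o = some x ↔ o' = some (κ x)) : weight o' (c.map κ) = weight o c := by
  have h0 : ∀ (o : Option X), (∀ x ∈ c, o ≠ some x) → weight o c = 0 := by
    rintro (_ | v) hv
    · rfl
    · exact Multiset.count_eq_zero.2 fun hvc => hv v hvc rfl
  by_cases hx : ∃ x ∈ c, o = some x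
  · obtain ⟨x, hxc, rfl⟩ := hx
    rw [(h x hxc).1 rfl]
    exact Multiset.count_map_eq_count' κ c hκ x
  · push Not at hx
    rw [h0 o hx]
    rcases o' with _ | w
    · rfl
    · refine Multiset.count_eq_zero.2 fun hw => ?_
      obtain ⟨x, hxc, rfl⟩ := Multiset.mem_map.1 hw
      exact hx x hxc ((h x hxc).2 rfl)

/-- Strictly monotone renamings that respect the marks preserve and reflect the monomial order. -/
theorem lt_map_iff (hκ : StrictMono κ) {o : Option X} {o' : Option Y} {c c' : Multiset X}
    (h : ∀ x ∈ c + c', o = some x ↔ o' = some (κ x)) :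
    Lt o' (c.map κ) (c'.map κ) ↔ Lt o c c' := by
  have hc := weight_map hκ.injective (fun x hx => h x (Multiset.mem_add.2 (.inl hx)))
  have hc' := weight_map hκ.injective (fun x hx => h x (Multiset.mem_add.2 (.inr hx)))
  rw [Lt, Lt, hc, hc']
  refine or_congr Iff.rfl (and_congr Iff.rfl ⟨?_, ?_⟩)
  · rintro ⟨a, ha, ha'⟩
    have hac : a ∈ c'.map κ := Multiset.count_pos.1 (by omega)
    obtain ⟨x, -, rfl⟩ := Multiset.mem_map.1 hac
    rw [Multiset.count_map_eq_count' κ _ hκ.injective,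
      Multiset.count_map_eq_count' κ _ hκ.injective] at ha'
    refine ⟨x, fun b hb => ?_, ha'⟩
    have := ha (κ b) (hκ hb)
    rwa [Multiset.count_map_eq_count' κ _ hκ.injective,
      Multiset.count_map_eq_count' κ _ hκ.injective] at this
  · rintro ⟨x, hx, hx'⟩
    refine ⟨κ x, fun b hb => ?_, ?_⟩
    · by_cases hbr : ∃ y, κ y = b
      · obtain ⟨y, rfl⟩ := hbr
        rw [Multiset.count_map_eq_count' κ _ hκ.injective,
          Multiset.count_map_eq_count' κ _ hκ.injective]
        exact hx y (hκ.lt_iff_lt.1 hb)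
      · push Not at hbr
        rw [Multiset.count_eq_zero.2, Multiset.count_eq_zero.2]
        all_goals
          intro hm
          obtain ⟨y, -, hy⟩ := Multiset.mem_map.1 hm
          exact hbr y hy
    · rwa [Multiset.count_map_eq_count' κ _ hκ.injective,
        Multiset.count_map_eq_count' κ _ hκ.injective]

end Map

section Orb

variable {n : ℕ}

theorem IsEmb.strictMono {α β : Type} [LinearOrder α] [LinearOrder β] {ι : Tok α n → Tok β n}
    (hι : IsEmb ι) : StrictMono ι :=
  fun _ _ h => hι.lt_iff.2 h

/-- All images of the rules in `G` under embeddings. -/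
def orb (G : Set (Multiset (Tok ℚ n) × Multiset (Tok ℚ n))) :
    Set (Multiset (Tok ℚ n) × Multiset (Tok ℚ n)) :=
  {p | ∃ r ∈ G, ∃ ι : Tok ℚ n → Tok ℚ n, IsEmb ι ∧ p = (r.1.map ι, r.2.map ι)}

variable {G T : Set (Multiset (Tok ℚ n) × Multiset (Tok ℚ n))}

theorem mem_orb_of_mem {r : Multiset (Tok ℚ n) × Multiset (Tok ℚ n)} (hr : r ∈ G) : r ∈ orb G :=
  ⟨r, hr, fun x => x, IsEmb.id, by simp⟩

theorem swap_mem_orb (hG : ∀ r ∈ G, r.swap ∈ G) : ∀ r ∈ orb G, r.swap ∈ orb G := by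
  rintro _ ⟨r, hr, ι, hι, rfl⟩
  exact ⟨r.swap, hG r hr, ι, hι, rfl⟩

theorem StepOn.map_emb {Q Q' : Multiset (Tok ℚ n) → Prop} {V V' : Set (Tok ℚ n)}
    {c c' : Multiset (Tok ℚ n)} (h : StepOn (orb G) Q V c c') {κ : Tok ℚ n → Tok ℚ n}
    (hκ : IsEmb κ) (hQ : ∀ c, Q c → Q' (c.map κ)) (hV : ∀ x ∈ V, κ x ∈ V') :
    StepOn (orb G) Q' V' (c.map κ) (c'.map κ) := by
  obtain ⟨hc, hc', _, ⟨r, hr, ι, hι, rfl⟩, g, hr₁, hr₂, rfl, rfl⟩ := h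
  refine ⟨hQ _ hc, hQ _ hc', _, ⟨r, hr, fun x => κ (ι x), hκ.comp hι, rfl⟩, g.map κ, ?_, ?_, ?_, ?_⟩
  · intro x hx
    obtain ⟨y, hy, rfl⟩ := Multiset.mem_map.1 hx
    exact hV _ (hr₁ _ (Multiset.mem_map_of_mem ι hy))
  · intro x hx
    obtain ⟨y, hy, rfl⟩ := Multiset.mem_map.1 hx
    exact hV _ (hr₂ _ (Multiset.mem_map_of_mem ι hy))
  · simp [Multiset.map_add]
  · simp [Multiset.map_add]

theorem Conn.map_emb {c c' : Multiset (Tok ℚ n)} (h : Conn (orb G) c c') {κ : Tok ℚ n → Tok ℚ n}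
    (hκ : IsEmb κ) : Conn (orb G) (c.map κ) (c'.map κ) :=
  Relation.ReflTransGen.lift (Multiset.map κ)
    (fun _ _ h => StepOn.map_emb h hκ (fun _ _ => trivial) fun _ _ => Set.mem_univ _) _ _ h

theorem Conn.of_orb (h : ∀ r ∈ G, Conn (orb T) r.1 r.2) {c c' : Multiset (Tok ℚ n)}
    (hc : Conn (orb G) c c') : Conn (orb T) c c' := by
  refine hc.of_rules ?_
  rintro _ ⟨r, hr, ι, hι, rfl⟩
  exact (h r hr).map_emb hι

/-- Tokens on places that do not occur in the rules take no part in a derivation. -/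
theorem Conn.filter_place {d : ℕ} (hT : ∀ r ∈ T, ∀ x ∈ r.1 + r.2, x.place < d)
    {s t : Multiset (Tok ℚ n)} (h : Conn (orb T) s t) :
    s.filter (fun x => ¬ x.place < d) = t.filter (fun x => ¬ x.place < d) ∧
      Conn (orb T) (s.filter fun x => x.place < d) (t.filter fun x => x.place < d) := by
  induction h with
  | refl => exact ⟨rfl, .refl⟩
  | tail _ hs ih =>
    obtain ⟨-, -, r, hr, g, -, -, rfl, rfl⟩ := hs
    have hr' : ∀ x ∈ r.1 + r.2, x.place < d := by
      obtain ⟨r, hr, ι, hι, rfl⟩ := hr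
      intro x hx
      rw [← Multiset.map_add] at hx
      obtain ⟨y, hy, rfl⟩ := Multiset.mem_map.1 hx
      rw [hι.place_eq]
      exact hT r hr y hy
    have h₁ : ∀ x ∈ r.1, x.place < d := fun x hx => hr' x (Multiset.mem_add.2 (.inl hx))
    have h₂ : ∀ x ∈ r.2, x.place < d := fun x hx => hr' x (Multiset.mem_add.2 (.inr hx))
    have e₁ := Multiset.filter_eq_self.2 h₁
    have e₂ := Multiset.filter_eq_self.2 h₂
    have e₁' : r.1.filter (fun x => ¬ x.place < d) = 0 :=
      Multiset.filter_eq_nil.2 fun x hx => not_not.2 (h₁ x hx)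
    have e₂' : r.2.filter (fun x => ¬ x.place < d) = 0 :=
      Multiset.filter_eq_nil.2 fun x hx => not_not.2 (h₂ x hx)
    simp only [Multiset.filter_add, e₁, e₂, e₁', e₂'] at ih ⊢
    exact ⟨ih.1, ih.2.trans (Conn.of_mem hr _)⟩

/-- Finitely many pairs of congruent monomials decrease, up to embeddings, every monomial that is
congruent to a smaller one, in the variables of the two, whatever variable is marked. This is
where the well-quasi-order is used, on the triples of a larger monomial, a smaller one congruent
to it, and a marked variable. -/
theorem exists_finite_basis {d : ℕ} (hT : ∀ r ∈ T, ∀ x ∈ r.1 + r.2, x.place < d) :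
    ∃ G : Finset (Multiset (Tok ℚ n) × Multiset (Tok ℚ n)),
      (∀ r ∈ G, Conn (orb T) r.1 r.2) ∧
      ∀ (o : Option (Tok ℚ n)) (s t : Multiset (Tok ℚ n)), Conn (orb T) s t → Lt o t s →
        ∃ r ∈ orb (G : Set (Multiset (Tok ℚ n) × Multiset (Tok ℚ n))),
          (∀ x ∈ r.1, x ∈ s + t) ∧ (∀ x ∈ r.2, x ∈ s + t) ∧ r.1 ≤ s ∧ Lt o r.2 r.1 := by
  classical
  -- a token is labelled with its exponent in the larger monomial and with whether it is marked
  let rL : ℕ × Bool → ℕ × Bool → Prop := fun a b => a.1 ≤ b.1 ∧ a.2 = b.2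
  have : IsPreorder (ℕ × Bool) rL :=
    { refl := fun a => ⟨le_rfl, rfl⟩
      trans := fun a b c h h' => ⟨h.1.trans h'.1, h.2.trans h'.2⟩ }
  have hrL : WellQuasiOrdered rL :=
    WellQuasiOrdered.prod wellQuasiOrdered_le (Finite.wellQuasiOrdered _)
  let A : Multiset (Tok ℚ n) × Multiset (Tok ℚ n) × Option (Tok ℚ n) →
      Finset (Tok ℚ n) × (Tok ℚ n → ℕ × Bool) := fun q =>
    ((q.1 + q.2.1).toFinset, fun x => (q.1.count x, decide (q.2.2 = some x)))
  let P : Multiset (Tok ℚ n) × Multiset (Tok ℚ n) × Option (Tok ℚ n) → Prop := fun q =>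
    Conn (orb T) q.1 q.2.1 ∧ Lt q.2.2 q.2.1 q.1 ∧ ∀ x ∈ q.1 + q.2.1, x.place < d
  have hF : ∃ F : Finset (Multiset (Tok ℚ n) × Multiset (Tok ℚ n) × Option (Tok ℚ n)),
      (∀ a ∈ F, P a) ∧ ∀ b, P b → ∃ a ∈ F, LabelledLe rL n (A a) (A b) := by
    by_contra hcon
    push Not at hcon
    obtain ⟨f, hf, hf'⟩ := exists_seq_of_forall_finset_exists P
      (fun a b => ¬ LabelledLe rL n (A a) (A b)) hcon
    obtain ⟨i, j, hij, h⟩ := (labelledLe_pwo rL hrL d n).exists_lt (f := fun i => A (f i))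
      (fun i x hx => (hf i).2.2 x (by simpa [A] using hx))
    exact hf' i j hij h
  obtain ⟨F, hFP, hF⟩ := hF
  refine ⟨F.image fun q => (q.1, q.2.1), ?_, ?_⟩
  · intro r hr
    obtain ⟨q, hq, rfl⟩ := Finset.mem_image.1 hr
    exact (hFP q hq).1
  · intro o s t hst hlt
    -- the tokens on places from `d` on are a common context of `s` and `t`
    obtain ⟨hfe, hfc⟩ := hst.filter_place hT
    set s₀ := s.filter fun x => x.place < d with hs₀
    set t₀ := t.filter fun x => x.place < d with ht₀
    have hs : s.filter (fun x => ¬ x.place < d) + s₀ = s := by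
      rw [add_comm]; exact Multiset.filter_add_not _ s
    have ht : s.filter (fun x => ¬ x.place < d) + t₀ = t := by
      rw [hfe, add_comm]; exact Multiset.filter_add_not _ t
    have hlt₀ : Lt o t₀ s₀ := by
      rwa [← hs, ← ht, Lt.add_left_iff] at hlt
    obtain ⟨⟨s', t', o'⟩, hq, ι, hι, h⟩ := hF (s₀, t₀, o) ⟨hfc, hlt₀, by
      intro x hx
      simp only [hs₀, ht₀, Multiset.mem_add, Multiset.mem_filter] at hx
      rcases hx with hx | hx
      exacts [hx.2, hx.2]⟩
    have hmem : ∀ x ∈ s' + t', ι x ∈ s + t := by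
      intro x hx
      have h1 := (h x (by simpa [A] using hx)).1
      simp only [A, Multiset.mem_toFinset, Multiset.mem_add, hs₀, ht₀, Multiset.mem_filter] at h1 ⊢
      tauto
    refine ⟨(s'.map ι, t'.map ι), ⟨(s', t'), ?_, ι, hι, rfl⟩, ?_, ?_, ?_, ?_⟩
    · exact Finset.mem_coe.2 (Finset.mem_image.2 ⟨_, hq, rfl⟩)
    · intro x hx
      obtain ⟨y, hy, rfl⟩ := Multiset.mem_map.1 hx
      exact hmem y (Multiset.mem_add.2 (.inl hy))
    · intro x hx
      obtain ⟨y, hy, rfl⟩ := Multiset.mem_map.1 hx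
      exact hmem y (Multiset.mem_add.2 (.inr hy))
    · refine le_trans (Multiset.le_iff_count.2 fun y => ?_) (Multiset.filter_le (fun x => x.place < d) s)
      by_cases hy : y ∈ s'.map ι
      · obtain ⟨x, hx, rfl⟩ := Multiset.mem_map.1 hy
        rw [Multiset.count_map_eq_count' ι _ hι.injective]
        exact (h x (by simp [A, hx])).2.1
      · rw [Multiset.count_eq_zero.2 hy]
        exact Nat.zero_le _
    · refine (lt_map_iff (o := o') hι.strictMono ?_).2 (hFP _ hq).2.1
      intro x hx
      have h2 := (h x (by simpa [A, add_comm, or_comm] using hx)).2.2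
      simpa [A] using h2

end Orb


/-! ### Natural coordinates -/

/-- The number of elements of `C` below `q`. -/
def rank (C : Finset ℚ) (q : ℚ) : ℕ := (C.filter (· < q)).card

theorem rank_strictMonoOn (C : Finset ℚ) : StrictMonoOn (rank C) C := by
  intro a ha b _ hab
  refine Finset.card_lt_card (Finset.ssubset_iff_of_subset (fun x hx => ?_) |>.2 ⟨a, ?_, ?_⟩)
  · rw [Finset.mem_filter] at hx ⊢
    exact ⟨hx.1, hx.2.trans hab⟩
  · exact Finset.mem_filter.2 ⟨ha, hab⟩
  · simp

theorem rank_lt_card {C : Finset ℚ} {q : ℚ} (hq : q ∈ C) : rank C q < C.card :=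
  Finset.card_lt_card (Finset.filter_ssubset.2 ⟨q, hq, lt_irrefl q⟩)

/-- Tokens with natural coordinates, as tokens with rational coordinates. -/
def castTok {n : ℕ} (x : Tok ℕ n) : Tok ℚ n := x.map (Nat.cast : ℕ → ℚ)

theorem isEmb_castTok {n : ℕ} : IsEmb (castTok (n := n)) := IsEmb.map Nat.strictMono_cast

/-- A left inverse of `castTok`. -/
def floorTok {n : ℕ} (x : Tok ℚ n) : Tok ℕ n := x.map Nat.floor

@[simp] theorem floorTok_castTok {n : ℕ} (x : Tok ℕ n) : floorTok (castTok x) = x := by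
  rw [floorTok, castTok, Tok.map_map]
  exact Tok.map_eq_self x fun a _ => Nat.floor_natCast a

theorem sameTp_castTok {n : ℕ} {x y x' y' : Tok ℕ n} :
    SameTp (castTok x) (castTok y) (castTok x') (castTok y') ↔ SameTp x y x' y' :=
  ⟨fun h => ((isEmb_castTok x y).trans h).trans (isEmb_castTok x' y').symm,
    fun h => ((isEmb_castTok x y).symm.trans h).trans (isEmb_castTok x' y')⟩

/-- Finitely many tokens are moved to small natural coordinates by an embedding, and back by
another one. -/
theorem exists_naturalize {n : ℕ} (S : List (Tok ℚ n)) :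
    ∃ (ν : Tok ℚ n → Tok ℕ n) (κ κ' : Tok ℚ n → Tok ℚ n), IsEmb κ ∧ IsEmb κ' ∧
      (∀ x ∈ S, κ (castTok (ν x)) = x) ∧ (∀ x ∈ S, κ' x = castTok (ν x)) ∧
      ∀ x ∈ S, ∀ c ∈ (ν x).coords, c < n * S.length := by
  -- each coordinate is replaced by its rank among the at most `n * S.length` coordinates in `S`
  let C : Finset ℚ := (S.flatMap Tok.coords).toFinset
  let ν : Tok ℚ n → Tok ℕ n := fun x => x.map (rank C)
  have hC : ∀ x ∈ S, ∀ c ∈ x.coords, c ∈ C := fun x hx c hc => by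
    simpa [C] using ⟨x, hx, hc⟩
  have hν : ∀ x ∈ S, ∀ y ∈ S, SameTp x y (castTok (ν x)) (castTok (ν y)) := fun x hx y hy =>
    (SameTp.map (rank_strictMonoOn C) (hC x hx) (hC y hy)).trans (isEmb_castTok _ _)
  obtain ⟨κ, hκ, hκS⟩ := exists_isEmb_of_pairs (S.map fun x => (castTok (ν x), x)) (by
    simp only [List.mem_map]
    rintro _ ⟨x, hx, rfl⟩ _ ⟨y, hy, rfl⟩
    exact (hν x hx y hy).symm)
  obtain ⟨κ', hκ', hκS'⟩ := exists_isEmb_of_pairs (S.map fun x => (x, castTok (ν x))) (by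
    simp only [List.mem_map]
    rintro _ ⟨x, hx, rfl⟩ _ ⟨y, hy, rfl⟩
    exact hν x hx y hy)
  refine ⟨ν, κ, κ', hκ, hκ', fun x hx => hκS _ (List.mem_map_of_mem hx),
    fun x hx => hκS' _ (List.mem_map_of_mem hx), fun x hx c hc => ?_⟩
  rw [Tok.coords_map, List.mem_map] at hc
  obtain ⟨q, hq, rfl⟩ := hc
  refine (rank_lt_card (hC x hx q hq)).trans_le ((List.toFinset_card_le _).trans ?_)
  rw [List.length_flatMap]
  simp [Tok.length_coords, mul_comm]

/-! ### Words and finite instances of rules -/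

section Words

variable {n : ℕ}

/-- Words of tokens with natural coordinates; they denote monomials. -/
abbrev Word (n : ℕ) : Type := List (Tok ℕ n)

/-- Rules between words. -/
abbrev WRule (n : ℕ) : Type := Word n × Word n

/-- The monomial denoted by a word. -/
def sem (w : Word n) : Multiset (Tok ℚ n) := (w : Multiset (Tok ℕ n)).map castTok

/-- The rules denoted by a list of rules between words. -/
def semRules (G : List (WRule n)) : Set (Multiset (Tok ℚ n) × Multiset (Tok ℚ n)) :=
  {p | ∃ r ∈ G, p = (sem r.1, sem r.2)}

theorem sem_append (v w : Word n) : sem (v ++ w) = sem v + sem w := by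
  simp [sem]

theorem sem_eq_iff {v w : Word n} : sem v = sem w ↔ v.Perm w := by
  rw [sem, sem, (Multiset.map_injective isEmb_castTok.injective).eq_iff, Multiset.coe_eq_coe]

theorem mem_sem {w : Word n} {x : Tok ℚ n} : x ∈ sem w ↔ ∃ y ∈ w, castTok y = x := by
  simp [sem]

theorem castTok_mem_sem {w : Word n} {y : Tok ℕ n} : castTok y ∈ sem w ↔ y ∈ w := by
  rw [mem_sem]
  exact ⟨fun ⟨z, hz, h⟩ => isEmb_castTok.injective h ▸ hz, fun h => ⟨y, h, rfl⟩⟩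

theorem mem_semRules {G : List (WRule n)} {r : WRule n} (hr : r ∈ G) :
    (sem r.1, sem r.2) ∈ semRules G := ⟨r, hr, rfl⟩

theorem swap_mem_semRules {G : List (WRule n)} (hG : ∀ r ∈ G, r.swap ∈ G) :
    ∀ r ∈ semRules G, r.swap ∈ semRules G := by
  rintro _ ⟨r, hr, rfl⟩
  exact ⟨r.swap, hG r hr, rfl⟩

theorem lt_sem_iff {o : Option (Tok ℕ n)} {v w : Word n} :
    Lt (o.map castTok) (sem v) (sem w) ↔ Lt o (v : Multiset (Tok ℕ n)) w := by
  refine lt_map_iff isEmb_castTok.strictMono fun x _ => ?_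
  rw [Option.map_eq_some_iff]
  refine ⟨fun h => ⟨x, h, rfl⟩, ?_⟩
  rintro ⟨y, hy, h⟩
  rw [hy, isEmb_castTok.injective h]

/-- `r'` is the image of the rule `r` under a renaming of its tokens that preserves types. -/
def InstR (r r' : WRule n) : Prop :=
  r'.1.length = r.1.length ∧ r'.2.length = r.2.length ∧
    ∀ p ∈ (r.1 ++ r.2).zip (r'.1 ++ r'.2), ∀ q ∈ (r.1 ++ r.2).zip (r'.1 ++ r'.2),
      SameTp p.1 q.1 p.2 q.2

theorem map_eq_map_iff_zip {α β γ : Type*} {f : α → γ} {g : β → γ} {l : List α} {l' : List β} :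
    l'.map g = l.map f ↔ l'.length = l.length ∧ ∀ p ∈ l.zip l', g p.2 = f p.1 := by
  rw [eq_comm, ← List.forall₂_eq_eq_eq, List.forall₂_map_left_iff, List.forall₂_map_right_iff,
    List.forall₂_iff_zip]
  exact ⟨fun h => ⟨h.1.symm, fun p hp => (h.2 hp).symm⟩,
    fun h => ⟨h.1.symm, fun {a b} hp => (h.2 (a, b) hp).symm⟩⟩

theorem instR_iff {r r' : WRule n} : InstR r r' ↔ ∃ ι : Tok ℚ n → Tok ℚ n, IsEmb ι ∧
    r'.1.map castTok = r.1.map (fun x => ι (castTok x)) ∧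
    r'.2.map castTok = r.2.map (fun x => ι (castTok x)) := by
  constructor
  · rintro ⟨h₁, h₂, h⟩
    obtain ⟨ι, hι, hZ⟩ := exists_isEmb_of_pairs
      (((r.1 ++ r.2).zip (r'.1 ++ r'.2)).map fun p => (castTok p.1, castTok p.2)) (by
        simp only [List.mem_map]
        rintro _ ⟨p, hp, rfl⟩ _ ⟨q, hq, rfl⟩
        exact sameTp_castTok.2 (h p hp q hq))
    have hZ' : ∀ p ∈ (r.1 ++ r.2).zip (r'.1 ++ r'.2), castTok p.2 = ι (castTok p.1) := fun p hp =>
      (hZ _ (List.mem_map_of_mem hp)).symm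
    rw [List.zip_append h₁.symm] at hZ'
    exact ⟨ι, hι, map_eq_map_iff_zip.2 ⟨h₁, fun p hp => hZ' p (List.mem_append_left _ hp)⟩,
      map_eq_map_iff_zip.2 ⟨h₂, fun p hp => hZ' p (List.mem_append_right _ hp)⟩⟩
  · rintro ⟨ι, hι, h₁, h₂⟩
    rw [map_eq_map_iff_zip] at h₁ h₂
    refine ⟨h₁.1, h₂.1, ?_⟩
    have hZ : ∀ p ∈ (r.1 ++ r.2).zip (r'.1 ++ r'.2), castTok p.2 = ι (castTok p.1) := by
      rw [List.zip_append h₁.1.symm]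
      intro p hp
      rcases List.mem_append.1 hp with hp | hp
      exacts [h₁.2 p hp, h₂.2 p hp]
    intro p hp q hq
    rw [← sameTp_castTok, hZ p hp, hZ q hq]
    exact hι _ _

theorem InstR.exists_emb {r r' : WRule n} (h : InstR r r') : ∃ ι : Tok ℚ n → Tok ℚ n, IsEmb ι ∧
    sem r'.1 = (sem r.1).map ι ∧ sem r'.2 = (sem r.2).map ι := by
  obtain ⟨ι, hι, h₁, h₂⟩ := instR_iff.1 h
  refine ⟨ι, hι, ?_, ?_⟩
  · simp [sem, h₁, Function.comp_def]
  · simp [sem, h₂, Function.comp_def]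

theorem InstR.symm {r r' : WRule n} (h : InstR r r') : InstR r' r := by
  refine ⟨h.1.symm, h.2.1.symm, fun p hp q hq => ?_⟩
  have hs : ∀ p ∈ (r'.1 ++ r'.2).zip (r.1 ++ r.2), p.swap ∈ (r.1 ++ r.2).zip (r'.1 ++ r'.2) := by
    intro p hp
    rw [← List.zip_swap]
    exact List.mem_map_of_mem hp
  exact (h.2.2 _ (hs p hp) _ (hs q hq)).symm

theorem InstR.mem_orb {G : List (WRule n)} {r r' : WRule n} (hr : r ∈ G) (h : InstR r r') :
    (sem r'.1, sem r'.2) ∈ orb (semRules G) := by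
  obtain ⟨ι, hι, h₁, h₂⟩ := h.exists_emb
  exact ⟨_, mem_semRules hr, ι, hι, by rw [h₁, h₂]⟩

/-- An instance of a rule between words, moved to natural coordinates. -/
theorem exists_instR {G : List (WRule n)} {p : Multiset (Tok ℚ n) × Multiset (Tok ℚ n)}
    (hp : p ∈ orb (semRules G)) {ν : Tok ℚ n → Tok ℕ n} {κ' : Tok ℚ n → Tok ℚ n} (hκ' : IsEmb κ')
    (hν : ∀ x ∈ p.1 + p.2, κ' x = castTok (ν x)) :
    ∃ r ∈ G, ∃ r', InstR r r' ∧ (r'.1 : Multiset (Tok ℕ n)) = p.1.map ν ∧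
      (r'.2 : Multiset (Tok ℕ n)) = p.2.map ν := by
  obtain ⟨_, ⟨r, hr, rfl⟩, ι, hι, rfl⟩ := hp
  refine ⟨r, hr, (r.1.map fun x => ν (ι (castTok x)), r.2.map fun x => ν (ι (castTok x))), ?_,
    by simp [sem, Function.comp_def], by simp [sem, Function.comp_def]⟩
  refine instR_iff.2 ⟨fun x => κ' (ι x), hκ'.comp hι, ?_, ?_⟩
  · simp only [List.map_map]
    refine List.map_congr_left fun x hx => (hν _ ?_).symm
    exact Multiset.mem_add.2 (.inl (Multiset.mem_map_of_mem ι (castTok_mem_sem.2 hx)))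
  · simp only [List.map_map]
    refine List.map_congr_left fun x hx => (hν _ ?_).symm
    exact Multiset.mem_add.2 (.inr (Multiset.mem_map_of_mem ι (castTok_mem_sem.2 hx)))

/-! ### Reachability on words -/

/-- `c'` results from `c` by replacing the left side of the instance `r'` of a rule in `G` by its
right side. -/
def ApplyC (G : List (WRule n)) (r' : WRule n) (c c' : Word n) : Prop :=
  ∃ r ∈ G, ∃ g : Word n, InstR r r' ∧ c.Perm (g ++ r'.1) ∧ c'.Perm (g ++ r'.2)

/-- A step between words. -/
def StepC (G : List (WRule n)) (c c' : Word n) : Prop := ∃ r', ApplyC G r' c c'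

/-- Chains of steps, up to the order of the letters at both ends. -/
def ChainC (R : Word n → Word n → Prop) (s t : Word n) : Prop :=
  ∃ u v, s.Perm u ∧ Relation.ReflTransGen R u v ∧ v.Perm t

/-- Reachability between words: some instance of the pair `(s, t)` is connected by steps with
natural coordinates. Passing to an instance makes room for the coordinates of the steps. -/
def ReachC (T : List (WRule n)) (s t : Word n) : Prop :=
  ∃ s' t', InstR (s, t) (s', t') ∧ ChainC (StepC T) s' t'

theorem ApplyC.stepOn {G : List (WRule n)} {r' : WRule n} {c c' : Word n} (h : ApplyC G r' c c')
    {Q : Multiset (Tok ℚ n) → Prop} {V : Set (Tok ℚ n)} (hc : Q (sem c)) (hc' : Q (sem c'))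
    (hV : ∀ x ∈ r'.1 ++ r'.2, castTok x ∈ V) : StepOn (orb (semRules G)) Q V (sem c) (sem c') := by
  obtain ⟨r, hr, g, hi, h₁, h₂⟩ := h
  refine ⟨hc, hc', _, hi.mem_orb hr, sem g, fun x hx => ?_, fun x hx => ?_, ?_, ?_⟩
  · obtain ⟨y, hy, rfl⟩ := mem_sem.1 hx
    exact hV y (List.mem_append_left _ hy)
  · obtain ⟨y, hy, rfl⟩ := mem_sem.1 hx
    exact hV y (List.mem_append_right _ hy)
  · rw [← sem_append]; exact sem_eq_iff.2 h₁
  · rw [← sem_append]; exact sem_eq_iff.2 h₂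

/-- The word of a monomial that is moved to natural coordinates. -/
noncomputable def toWord (ν : Tok ℚ n → Tok ℕ n) (c : Multiset (Tok ℚ n)) : Word n :=
  (c.map ν).toList

theorem coe_toWord (ν : Tok ℚ n → Tok ℕ n) (c : Multiset (Tok ℚ n)) :
    (toWord ν c : Multiset (Tok ℕ n)) = c.map ν := Multiset.coe_toList _

theorem toWord_perm {ν : Tok ℚ n → Tok ℕ n} {w : Word n} (h : ∀ x ∈ w, ν (castTok x) = x) :
    (toWord ν (sem w)).Perm w := by
  rw [← Multiset.coe_eq_coe, coe_toWord, sem, Multiset.map_map]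
  exact (Multiset.map_congr rfl h).trans (Multiset.map_id _)

theorem sem_toWord {ν : Tok ℚ n → Tok ℕ n} {c : Multiset (Tok ℚ n)}
    (h : ∀ x ∈ c, castTok (ν x) = x) : sem (toWord ν c) = c := by
  rw [sem, coe_toWord, Multiset.map_map]
  exact (Multiset.map_congr rfl h).trans (Multiset.map_id _)

/-- A step moves to words along an embedding that has natural coordinates on the tokens of the step. -/
theorem StepOn.applyC {G : List (WRule n)} {Q : Multiset (Tok ℚ n) → Prop} {V : Set (Tok ℚ n)}
    {c c' : Multiset (Tok ℚ n)} (h : StepOn (orb (semRules G)) Q V c c') {ν : Tok ℚ n → Tok ℕ n}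
    {κ' : Tok ℚ n → Tok ℚ n} (hκ' : IsEmb κ') (hν : ∀ x ∈ V, κ' x = castTok (ν x)) :
    ∃ r', ApplyC G r' (toWord ν c) (toWord ν c') ∧ ∀ x ∈ r'.1 ++ r'.2, ∃ y ∈ V, x = ν y := by
  obtain ⟨-, -, p, hp, g, hp₁, hp₂, rfl, rfl⟩ := h
  obtain ⟨r, hr, r', hi, h₁, h₂⟩ := exists_instR hp hκ' (fun x hx => by
    rcases Multiset.mem_add.1 hx with hx | hx
    exacts [hν x (hp₁ x hx), hν x (hp₂ x hx)])
  refine ⟨r', ⟨r, hr, toWord ν g, hi, ?_, ?_⟩, fun x hx => ?_⟩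
  · rw [← Multiset.coe_eq_coe, ← Multiset.coe_add, coe_toWord, coe_toWord, h₁, Multiset.map_add]
  · rw [← Multiset.coe_eq_coe, ← Multiset.coe_add, coe_toWord, coe_toWord, h₂, Multiset.map_add]
  · rcases List.mem_append.1 hx with hx | hx
    · rw [← Multiset.mem_coe, h₁] at hx
      obtain ⟨y, hy, rfl⟩ := Multiset.mem_map.1 hx
      exact ⟨y, hp₁ y hy, rfl⟩
    · rw [← Multiset.mem_coe, h₂] at hx
      obtain ⟨y, hy, rfl⟩ := Multiset.mem_map.1 hx
      exact ⟨y, hp₂ y hy, rfl⟩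

/-- A derivation uses finitely many tokens, which an embedding moves to natural coordinates; this
replaces its two ends by an instance. -/
theorem reachC_iff {T : List (WRule n)} {s t : Word n} :
    ReachC T s t ↔ Conn (orb (semRules T)) (sem s) (sem t) := by
  constructor
  · rintro ⟨s', t', hi, u, v, hu, huv, hv⟩
    obtain ⟨κ, hκ, hs, ht⟩ := hi.symm.exists_emb
    rw [hs, ht]
    refine Conn.map_emb ?_ hκ
    change Conn _ (sem s') (sem t')
    rw [sem_eq_iff.2 hu, ← sem_eq_iff.2 hv]
    refine Relation.ReflTransGen.lift sem (fun a b hab => ?_) _ _ huv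
    obtain ⟨r', h⟩ := hab
    exact h.stepOn trivial trivial fun _ _ => Set.mem_univ _
  · intro h
    obtain ⟨V, hV⟩ := h.exists_connIn
    obtain ⟨ν, κ, κ', -, hκ', -, hν, -⟩ := exists_naturalize (V.toList ++ (s ++ t).map castTok)
    refine ⟨s.map fun x => ν (castTok x), t.map fun x => ν (castTok x), ?_, toWord ν (sem s),
      toWord ν (sem t), ?_, ?_, ?_⟩
    · refine instR_iff.2 ⟨κ', hκ', ?_, ?_⟩
      all_goals
        simp only [List.map_map]
        refine List.map_congr_left fun x hx => (hν _ ?_).symm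
        simp only [List.mem_append, List.mem_map]
        exact .inr ⟨x, by simp [hx], rfl⟩
    · rw [← Multiset.coe_eq_coe, coe_toWord]
      simp [sem, Function.comp_def]
    · refine Relation.ReflTransGen.lift (toWord ν) (fun a b hab => ?_) _ _ hV
      obtain ⟨r', h, -⟩ := hab.applyC hκ' (fun x hx => hν x (by simpa using .inl hx))
      exact ⟨r', h⟩
    · rw [← Multiset.coe_eq_coe, coe_toWord]
      simp [sem, Function.comp_def]

end Words


/-! ### Certificates of non-reachability -/

/-- All tokens on places in `P` with coordinates below `K`. -/
def grid (P : List ℕ) (K : ℕ) : (n : ℕ) → List (Tok ℕ n)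
  | 0 => P
  | n + 1 => (List.range K).flatMap fun a => (grid P K n).map (Tok.cons a)

theorem mem_grid {P : List ℕ} {K : ℕ} : ∀ {n : ℕ} {x : Tok ℕ n},
    x ∈ grid P K n ↔ x.place ∈ P ∧ ∀ c ∈ x.coords, c < K
  | 0, x => ⟨fun h => ⟨h, fun _ hc => absurd hc List.not_mem_nil⟩, fun h => h.1⟩
  | n + 1, x => by
    simp only [grid, List.mem_flatMap, List.mem_range, List.mem_map, Tok.coords, List.forall_mem_cons]
    constructor
    · rintro ⟨a, ha, y, hy, rfl⟩
      exact ⟨(mem_grid.1 hy).1, ha, (mem_grid.1 hy).2⟩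
    · rintro ⟨hp, hh, ht⟩
      exact ⟨x.head, hh, x.tail, mem_grid.2 ⟨hp, ht⟩, rfl⟩

/-- All words of length `k` over an alphabet. -/
def words {α : Type*} (A : List α) : ℕ → List (List α)
  | 0 => [[]]
  | k + 1 => A.flatMap fun a => (words A k).map (List.cons a)

theorem mem_words {α : Type*} {A : List α} : ∀ {k : ℕ} {w : List α},
    w ∈ words A k ↔ w.length = k ∧ ∀ x ∈ w, x ∈ A
  | 0, w => by
    simp only [words, List.mem_singleton, List.length_eq_zero_iff]
    exact ⟨fun h => ⟨h, by simp [h]⟩, fun h => h.1⟩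
  | k + 1, w => by
    simp only [words, List.mem_flatMap, List.mem_map]
    constructor
    · rintro ⟨a, ha, v, hv, rfl⟩
      have := mem_words.1 hv
      simpa [this.1] using ⟨ha, this.2⟩
    · rintro ⟨hl, hA⟩
      obtain ⟨a, v, rfl⟩ := List.exists_cons_of_length_eq_add_one hl
      exact ⟨a, hA a (by simp), v, mem_words.2 ⟨by simpa using hl, fun x hx => hA x (by simp [hx])⟩,
        rfl⟩

section Certificates

variable {n : ℕ}

open Classical in
/-- All instances of a rule over an alphabet. -/
noncomputable def insts (A : List (Tok ℕ n)) (r : WRule n) : List (WRule n) :=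
  ((words A r.1.length).flatMap fun a => (words A r.2.length).map fun b => (a, b)).filter
    fun r' => InstR r r'

theorem mem_insts {A : List (Tok ℕ n)} {r r' : WRule n} :
    r' ∈ insts A r ↔ InstR r r' ∧ ∀ x ∈ r'.1 ++ r'.2, x ∈ A := by
  simp only [insts, List.mem_filter, List.mem_flatMap, List.mem_map, mem_words, decide_eq_true_eq,
    List.mem_append]
  constructor
  · rintro ⟨⟨a, ha, b, hb, rfl⟩, hi⟩
    refine ⟨hi, fun x hx => ?_⟩
    rcases hx with hx | hx
    exacts [ha.2 x hx, hb.2 x hx]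
  · rintro ⟨hi, h⟩
    exact ⟨⟨r'.1, ⟨hi.1, fun x hx => h x (.inl hx)⟩, r'.2, ⟨hi.2.1, fun x hx => h x (.inr hx)⟩, rfl⟩,
      hi⟩

/-- The tokens of two rules. -/
def toks (r r' : WRule n) : Word n := r.1 ++ r.2 ++ (r'.1 ++ r'.2)

/-- A finite set of tokens that contains a copy of all pairs of instances of two rules. -/
def pairGrid (r r' : WRule n) : List (Tok ℕ n) :=
  grid ((toks r r').map Tok.place) (n * (toks r r').length) n

/-- A step below `m`, in the variables `V`. -/
def StepBelow (G : List (WRule n)) (V : Word n) (o : Option (Tok ℕ n)) (m : Word n)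
    (c c' : Word n) : Prop :=
  ∃ r', ApplyC G r' c c' ∧ (∀ x ∈ r'.1 ++ r'.2, x ∈ V) ∧ (∀ x ∈ c, x ∈ V) ∧ (∀ x ∈ c', x ∈ V) ∧
    Lt o (c : Multiset (Tok ℕ n)) m ∧ Lt o (c' : Multiset (Tok ℕ n)) m

/-- The critical peak of two instances of rules is connected below its top. -/
def PeakC (G : List (WRule n)) (p q : WRule n) (o : Option (Tok ℕ n)) : Prop :=
  ∃ g g' : Word n, (g ++ p.1).Perm (g' ++ q.1) ∧ (∀ x ∈ g, x ∉ g') ∧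
    ChainC (StepBelow G (toks p q) o (g ++ p.1)) (g ++ p.2) (g' ++ q.2)

/-- The finite form of `CriticalPeaks`. -/
def CritC (G : List (WRule n)) : Prop :=
  ∀ r ∈ G, ∀ r' ∈ G, ∀ p ∈ insts (pairGrid r r') r, ∀ q ∈ insts (pairGrid r r') r',
    ∀ o ∈ none :: (toks p q).map some,
      ¬ Lt o (p.2 : Multiset (Tok ℕ n)) p.1 ∨ ¬ Lt o (q.2 : Multiset (Tok ℕ n)) q.1 ∨ PeakC G p q o

theorem eq_of_add_eq_add_of_disjoint {X : Type*} {a a' g g' h h' : Multiset X}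
    (e : g + a = g' + a') (d : Disjoint g g') (e' : h + a = h' + a') (d' : Disjoint h h') :
    g = h ∧ g' = h' := by
  classical
  have key : ∀ x, g.count x = h.count x ∧ g'.count x = h'.count x := by
    intro x
    have h1 := congrArg (Multiset.count x) e
    have h2 := congrArg (Multiset.count x) e'
    rw [Multiset.count_add, Multiset.count_add] at h1 h2
    have aux : ∀ {u v : Multiset X}, Disjoint u v → u.count x = 0 ∨ v.count x = 0 := by
      intro u v huv
      by_cases hx : x ∈ u
      · exact .inr (Multiset.count_eq_zero.2 (Multiset.disjoint_left.1 huv hx))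
      · exact .inl (Multiset.count_eq_zero.2 hx)
    have h3 := aux d
    have h4 := aux d'
    omega
  exact ⟨Multiset.ext.2 fun x => (key x).1, Multiset.ext.2 fun x => (key x).2⟩

theorem mem_toks_iff {p q : WRule n} {x : Tok ℚ n} :
    x ∈ sem p.1 + sem p.2 + sem q.1 + sem q.2 ↔ x ∈ sem (toks p q) := by
  simp only [toks, sem_append, Multiset.mem_add]
  tauto

/-- Every pair of instances of two rules is the image, under an embedding, of a pair of instances on
the finite grid, and embeddings carry the derivation of the latter over to the former. -/
theorem CritC.criticalPeaks {G : List (WRule n)} (h : CritC G) :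
    CriticalPeaks (orb (semRules G)) := by
  intro p hp q hq o g g' hgg hdis hlt hlt'
  obtain ⟨r, hr, ι, hι, hpι⟩ : ∃ r ∈ G, ∃ ι : Tok ℚ n → Tok ℚ n, IsEmb ι ∧
      p = ((sem r.1).map ι, (sem r.2).map ι) := by
    obtain ⟨_, ⟨r, hr, rfl⟩, ι, hι, h⟩ := hp
    exact ⟨r, hr, ι, hι, h⟩
  obtain ⟨r', hr', ι', hι', hqι⟩ : ∃ r ∈ G, ∃ ι : Tok ℚ n → Tok ℚ n, IsEmb ι ∧
      q = ((sem r.1).map ι, (sem r.2).map ι) := by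
    obtain ⟨_, ⟨r, hr, rfl⟩, ι, hι, h⟩ := hq
    exact ⟨r, hr, ι, hι, h⟩
  -- the two instances move to the grid
  let S : List (Tok ℚ n) := (r.1 ++ r.2).map (fun x => ι (castTok x)) ++
    (r'.1 ++ r'.2).map fun x => ι' (castTok x)
  obtain ⟨ν, κ, κ', hκ, hκ', hκS, hκS', hK⟩ := exists_naturalize S
  have hSl : S.length = (toks r r').length := by simp [S, toks]
  have hmemS : ∀ x, x ∈ S ↔ x ∈ p.1 + p.2 + q.1 + q.2 := by
    intro x
    rw [hpι, hqι]
    simp only [S, List.mem_append, List.mem_map, Multiset.mem_add, Multiset.mem_map, mem_sem]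
    constructor
    · rintro (⟨y, hy | hy, rfl⟩ | ⟨y, hy | hy, rfl⟩)
      · exact .inl (.inl (.inl ⟨_, ⟨y, hy, rfl⟩, rfl⟩))
      · exact .inl (.inl (.inr ⟨_, ⟨y, hy, rfl⟩, rfl⟩))
      · exact .inl (.inr ⟨_, ⟨y, hy, rfl⟩, rfl⟩)
      · exact .inr ⟨_, ⟨y, hy, rfl⟩, rfl⟩
    · rintro (((⟨_, ⟨y, hy, rfl⟩, rfl⟩ | ⟨_, ⟨y, hy, rfl⟩, rfl⟩) | ⟨_, ⟨y, hy, rfl⟩, rfl⟩) |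
        ⟨_, ⟨y, hy, rfl⟩, rfl⟩)
      · exact .inl ⟨y, .inl hy, rfl⟩
      · exact .inl ⟨y, .inr hy, rfl⟩
      · exact .inr ⟨y, .inl hy, rfl⟩
      · exact .inr ⟨y, .inr hy, rfl⟩
  have hgridS : ∀ x ∈ S, x.place ∈ (toks r r').map Tok.place → ν x ∈ pairGrid r r' := by
    intro x hx hpl
    refine mem_grid.2 ⟨?_, by rw [← hSl]; exact hK x hx⟩
    rwa [← isEmb_castTok.place_eq, ← hκS' x hx, hκ'.place_eq]
  have hinst : ∀ (r₀ : WRule n) (ι₀ : Tok ℚ n → Tok ℚ n), IsEmb ι₀ →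
      (∀ x ∈ r₀.1 ++ r₀.2, ι₀ (castTok x) ∈ S ∧ x ∈ toks r r') →
      (r₀.1.map (fun x => ν (ι₀ (castTok x))), r₀.2.map (fun x => ν (ι₀ (castTok x)))) ∈
        insts (pairGrid r r') r₀ := by
    intro r₀ ι₀ hι₀ h₀
    refine mem_insts.2 ⟨instR_iff.2 ⟨fun x => κ' (ι₀ x), hκ'.comp hι₀, ?_, ?_⟩, ?_⟩
    · simp only [List.map_map]
      exact List.map_congr_left fun x hx => (hκS' _ (h₀ x (List.mem_append_left _ hx)).1).symm
    · simp only [List.map_map]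
      exact List.map_congr_left fun x hx => (hκS' _ (h₀ x (List.mem_append_right _ hx)).1).symm
    · intro x hx
      rw [← List.map_append] at hx
      obtain ⟨y, hy, rfl⟩ := List.mem_map.1 hx
      refine hgridS _ (h₀ y hy).1 ?_
      rw [hι₀.place_eq, isEmb_castTok.place_eq]
      exact List.mem_map_of_mem (h₀ y hy).2
  have hp' := hinst r ι hι fun x hx =>
    ⟨List.mem_append_left _ (List.mem_map.2 ⟨x, hx, rfl⟩), List.mem_append_left _ hx⟩
  have hq' := hinst r' ι' hι' fun x hx =>
    ⟨List.mem_append_right _ (List.mem_map.2 ⟨x, hx, rfl⟩), List.mem_append_right _ hx⟩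
  set p' : WRule n := (r.1.map (fun x => ν (ι (castTok x))), r.2.map (fun x => ν (ι (castTok x))))
    with hp'_def
  set q' : WRule n :=
    (r'.1.map (fun x => ν (ι' (castTok x))), r'.2.map (fun x => ν (ι' (castTok x)))) with hq'_def
  have hback : ∀ (w : Word n) (ι₀ : Tok ℚ n → Tok ℚ n), (∀ x ∈ w, ι₀ (castTok x) ∈ S) →
      (sem (w.map fun x => ν (ι₀ (castTok x)))).map κ = (sem w).map ι₀ := by
    intro w ι₀ hw
    simp only [sem, Multiset.map_coe, List.map_map]
    rw [Multiset.coe_eq_coe]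
    exact List.Perm.of_eq (List.map_congr_left fun x hx => hκS _ (hw x hx))
  have hS₁ : ∀ x ∈ r.1 ++ r.2, ι (castTok x) ∈ S := fun x hx =>
    List.mem_append_left _ (List.mem_map.2 ⟨x, hx, rfl⟩)
  have hS₂ : ∀ x ∈ r'.1 ++ r'.2, ι' (castTok x) ∈ S := fun x hx =>
    List.mem_append_right _ (List.mem_map.2 ⟨x, hx, rfl⟩)
  have e₁ : (sem p'.1).map κ = p.1 := by
    rw [hpι]; exact hback r.1 ι fun x hx => hS₁ x (List.mem_append_left _ hx)
  have e₂ : (sem p'.2).map κ = p.2 := by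
    rw [hpι]; exact hback r.2 ι fun x hx => hS₁ x (List.mem_append_right _ hx)
  have e₃ : (sem q'.1).map κ = q.1 := by
    rw [hqι]; exact hback r'.1 ι' fun x hx => hS₂ x (List.mem_append_left _ hx)
  have e₄ : (sem q'.2).map κ = q.2 := by
    rw [hqι]; exact hback r'.2 ι' fun x hx => hS₂ x (List.mem_append_right _ hx)
  have hW : ∀ x, x ∈ toks p' q' → κ (castTok x) ∈ p.1 + p.2 + q.1 + q.2 := by
    intro x hx
    rw [← e₁, ← e₂, ← e₃, ← e₄, ← Multiset.map_add, ← Multiset.map_add, ← Multiset.map_add]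
    exact Multiset.mem_map_of_mem κ (mem_toks_iff.2 (castTok_mem_sem.2 hx))
  -- the mark moves along, or is dropped if it does not occur
  obtain ⟨o', ho', hoo'⟩ : ∃ o' ∈ none :: (toks p' q').map some,
      ∀ x ∈ toks p' q', o' = some x ↔ o = some (κ (castTok x)) := by
    by_cases ho : ∃ x ∈ toks p' q', o = some (κ (castTok x))
    · obtain ⟨x, hx, rfl⟩ := ho
      refine ⟨some x, List.mem_cons_of_mem _ (List.mem_map_of_mem hx), fun y _ => ?_⟩
      rw [Option.some_inj, Option.some_inj, hκ.injective.eq_iff, isEmb_castTok.injective.eq_iff]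
    · push Not at ho
      exact ⟨none, by simp, fun x hx => ⟨fun h => by simp at h, fun h => absurd h (ho x hx)⟩⟩
  have hltiff : ∀ {v w : Word n}, (∀ x ∈ v, x ∈ toks p' q') → (∀ x ∈ w, x ∈ toks p' q') →
      (Lt o ((sem v).map κ) ((sem w).map κ) ↔
        Lt o' (v : Multiset (Tok ℕ n)) (w : Multiset (Tok ℕ n))) := by
    intro v w hv hw
    rw [sem, sem, Multiset.map_map, Multiset.map_map]
    refine lt_map_iff (hκ.strictMono.comp isEmb_castTok.strictMono) fun x hx => hoo' x ?_
    rcases Multiset.mem_add.1 hx with hx | hx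
    exacts [hv x (Multiset.mem_coe.1 hx), hw x (Multiset.mem_coe.1 hx)]
  have m₁ : ∀ x ∈ p'.1, x ∈ toks p' q' := fun x hx => by simp [toks, hx]
  have m₂ : ∀ x ∈ p'.2, x ∈ toks p' q' := fun x hx => by simp [toks, hx]
  have m₃ : ∀ x ∈ q'.1, x ∈ toks p' q' := fun x hx => by simp [toks, hx]
  have m₄ : ∀ x ∈ q'.2, x ∈ toks p' q' := fun x hx => by simp [toks, hx]
  obtain ⟨k, k', hkk, hkd, u, v, hu, huv, hv⟩ :=
    ((h r hr r' hr' p' hp' q' hq' o' ho').resolve_left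
      (not_not.2 ((hltiff m₂ m₁).1 (by rwa [e₁, e₂])))).resolve_left
      (not_not.2 ((hltiff m₄ m₃).1 (by rwa [e₃, e₄])))
  have hk : g = (sem k).map κ ∧ g' = (sem k').map κ := by
    refine eq_of_add_eq_add_of_disjoint hgg hdis ?_ ?_
    · rw [← e₁, ← e₃, ← Multiset.map_add, ← Multiset.map_add, ← sem_append, ← sem_append,
        sem_eq_iff.2 hkk]
    · rw [Multiset.disjoint_left]
      intro x hx hx'
      obtain ⟨y, hy, rfl⟩ := Multiset.mem_map.1 hx
      obtain ⟨z, hz, hzy⟩ := Multiset.mem_map.1 hx'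
      obtain rfl := hκ.injective hzy
      obtain ⟨y', hy', rfl⟩ := mem_sem.1 hy
      exact hkd y' hy' (castTok_mem_sem.1 hz)
  have mk : ∀ x ∈ k ++ p'.1, x ∈ toks p' q' := by
    intro x hx
    rcases List.mem_append.1 hx with hxk | hxp
    · rcases List.mem_append.1 (hkk.subset hx) with hx' | hx'
      · exact absurd hx' (hkd x hxk)
      · exact m₃ x hx'
    · exact m₁ x hxp
  have hstart : g + p.2 = (sem u).map κ := by
    rw [hk.1, ← e₂, ← Multiset.map_add, ← sem_append, sem_eq_iff.2 hu]
  have hend : g' + q.2 = (sem v).map κ := by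
    rw [hk.2, ← e₄, ← Multiset.map_add, ← sem_append, sem_eq_iff.2 hv]
  have htop : g + p.1 = (sem (k ++ p'.1)).map κ := by
    rw [hk.1, ← e₁, ← Multiset.map_add, ← sem_append]
  rw [hstart, hend, htop]
  refine Relation.ReflTransGen.lift (fun w => (sem w).map κ) (fun a b hab => ?_) _ _ huv
  obtain ⟨s', hs', hs'V, haV, hbV, hal, hbl⟩ := hab
  have hst := hs'.stepOn (Q := fun c => c = sem a ∨ c = sem b) (V := {x | x ∈ sem (toks p' q')})
    (.inl rfl) (.inr rfl) (fun x hx => castTok_mem_sem.2 (hs'V x hx))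
  refine hst.map_emb hκ ?_ ?_
  · rintro c (rfl | rfl)
    · refine ⟨fun x hx => ?_, (hltiff haV mk).2 hal⟩
      obtain ⟨y, hy, rfl⟩ := Multiset.mem_map.1 hx
      obtain ⟨z, hz, rfl⟩ := mem_sem.1 hy
      exact hW z (haV z hz)
    · refine ⟨fun x hx => ?_, (hltiff hbV mk).2 hbl⟩
      obtain ⟨y, hy, rfl⟩ := Multiset.mem_map.1 hx
      obtain ⟨z, hz, rfl⟩ := mem_sem.1 hy
      exact hW z (hbV z hz)
  · intro x hx
    obtain ⟨z, hz, rfl⟩ := mem_sem.1 hx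
    exact hW z hz

/-- A derivation in the variables of two rules with natural coordinates is a derivation of words. -/
theorem critC_of_criticalPeaks {G : List (WRule n)} (h : CriticalPeaks (orb (semRules G))) :
    CritC G := by
  intro r hr r' hr' p hp q hq o _
  by_cases hlt : Lt o (p.2 : Multiset (Tok ℕ n)) p.1
  swap
  · exact .inl hlt
  by_cases hlt' : Lt o (q.2 : Multiset (Tok ℕ n)) q.1
  swap
  · exact .inr (.inl hlt')
  refine .inr (.inr ?_)
  -- the cofactors of the two left sides in their least common multiple
  let G₁ : Multiset (Tok ℕ n) := (q.1 : Multiset (Tok ℕ n)) - p.1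
  let G₂ : Multiset (Tok ℕ n) := (p.1 : Multiset (Tok ℕ n)) - q.1
  have hG₁ : ((G₁.toList : Word n) : Multiset (Tok ℕ n)) = G₁ := Multiset.coe_toList _
  have hG₂ : ((G₂.toList : Word n) : Multiset (Tok ℕ n)) = G₂ := Multiset.coe_toList _
  have hperm : (G₁.toList ++ p.1).Perm (G₂.toList ++ q.1) := by
    rw [← Multiset.coe_eq_coe, ← Multiset.coe_add, ← Multiset.coe_add, hG₁, hG₂]
    ext x
    simp only [G₁, G₂, Multiset.count_add, Multiset.count_sub]
    omega
  have hdis : ∀ x ∈ G₁.toList, x ∉ G₂.toList := by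
    intro x hx hx'
    rw [Multiset.mem_toList, ← Multiset.count_pos, Multiset.count_sub] at hx hx'
    omega
  refine ⟨G₁.toList, G₂.toList, hperm, hdis, ?_⟩
  have hc := h _ ((mem_insts.1 hp).1.mem_orb hr) _ ((mem_insts.1 hq).1.mem_orb hr')
    (o.map castTok) (sem G₁.toList) (sem G₂.toList)
    (by simpa only [← sem_append] using sem_eq_iff.2 hperm)
    (by
      rw [Multiset.disjoint_left]
      intro x hx hx'
      obtain ⟨y, hy, rfl⟩ := mem_sem.1 hx
      exact hdis y hy (castTok_mem_sem.1 hx'))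
    (lt_sem_iff.2 hlt) (lt_sem_iff.2 hlt')
  simp only [← sem_append] at hc
  have hself : ∀ w : Word n, (toWord floorTok (sem w)).Perm w := fun w =>
    toWord_perm fun x _ => floorTok_castTok x
  refine ⟨toWord floorTok (sem (G₁.toList ++ p.2)), toWord floorTok (sem (G₂.toList ++ q.2)),
    (hself _).symm, ?_, hself _⟩
  refine Relation.ReflTransGen.lift (toWord floorTok) (fun a b hab => ?_) _ _ hc
  have hfl : ∀ x : Tok ℚ n, x ∈ sem (p.1 ++ p.2 ++ q.1 ++ q.2) → castTok (floorTok x) = x := by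
    intro x hx
    obtain ⟨y, -, rfl⟩ := mem_sem.1 hx
    rw [floorTok_castTok]
  obtain ⟨r₀, hr₀, hr₀V⟩ := hab.applyC (ν := floorTok) IsEmb.id fun x hx => (hfl x hx).symm
  have hV : ∀ {x : Tok ℚ n}, x ∈ sem (p.1 ++ p.2 ++ q.1 ++ q.2) → floorTok x ∈ toks p q := by
    intro x hx
    obtain ⟨y, hy, rfl⟩ := mem_sem.1 hx
    rw [floorTok_castTok]
    simpa [toks, or_assoc] using hy
  have haux : ∀ c : Multiset (Tok ℚ n), (∀ x ∈ c, x ∈ sem (p.1 ++ p.2 ++ q.1 ++ q.2)) →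
      Lt (o.map castTok) c (sem (G₁.toList ++ p.1)) →
      (∀ x ∈ toWord floorTok c, x ∈ toks p q) ∧
      Lt o (toWord floorTok c : Multiset (Tok ℕ n)) (G₁.toList ++ p.1 : Word n) := by
    refine fun c hcV hlt => ⟨fun x hx => ?_, ?_⟩
    · rw [← Multiset.mem_coe, coe_toWord] at hx
      obtain ⟨y, hy, rfl⟩ := Multiset.mem_map.1 hx
      exact hV (hcV y hy)
    · rw [← lt_sem_iff, sem_toWord fun x hx => hfl x (hcV x hx)]
      exact hlt
  have ha := haux a hab.1.1 hab.1.2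
  have hb := haux b hab.2.1.1 hab.2.1.2
  refine ⟨r₀, hr₀, fun x hx => ?_, ha.1, hb.1, ha.2, hb.2⟩
  obtain ⟨y, hy, rfl⟩ := hr₀V x hx
  exact hV hy

/-- The finite form of `Irred`. -/
def IrredC (G : List (WRule n)) (V u : Word n) : Prop :=
  ∀ r ∈ G, ∀ p ∈ insts V r, ¬ (p.1 : Multiset (Tok ℕ n)) ≤ u ∨
    ¬ Lt none (p.2 : Multiset (Tok ℕ n)) p.1

theorem irredC_iff {G : List (WRule n)} {V u : Word n} :
    IrredC G V u ↔ Irred (orb (semRules G)) none {x | x ∈ sem V} (sem u) := by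
  constructor
  · intro h p hp hp₁ hp₂ hle hlt
    have hfl : ∀ x ∈ sem V, castTok (floorTok x) = x := by
      intro x hx
      obtain ⟨y, -, rfl⟩ := mem_sem.1 hx
      rw [floorTok_castTok]
    have hpV : ∀ x ∈ p.1 + p.2, x ∈ sem V := by
      intro x hx
      rcases Multiset.mem_add.1 hx with hx | hx
      exacts [hp₁ x hx, hp₂ x hx]
    obtain ⟨r, hr, p', hi, h₁, h₂⟩ := exists_instR hp (ν := floorTok) IsEmb.id
      fun x hx => (hfl x (hpV x hx)).symm
    have e₁ : sem p'.1 = p.1 := by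
      rw [sem, h₁, Multiset.map_map]
      exact (Multiset.map_congr rfl fun x hx => hfl x (hp₁ x hx)).trans (Multiset.map_id _)
    have e₂ : sem p'.2 = p.2 := by
      rw [sem, h₂, Multiset.map_map]
      exact (Multiset.map_congr rfl fun x hx => hfl x (hp₂ x hx)).trans (Multiset.map_id _)
    have hmem : p' ∈ insts V r := by
      refine mem_insts.2 ⟨hi, fun x hx => castTok_mem_sem.1 (hpV _ ?_)⟩
      rw [← e₁, ← e₂, ← sem_append]
      exact castTok_mem_sem.2 hx
    rcases h r hr p' hmem with h' | h'
    · rw [← e₁, sem, sem, Multiset.map_le_map_iff isEmb_castTok.injective] at hle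
      exact h' hle
    · rw [← e₁, ← e₂] at hlt
      exact h' ((lt_sem_iff (o := none)).1 hlt)
  · intro h r hr p hp
    have hp' := mem_insts.1 hp
    by_contra hcon
    push Not at hcon
    refine h _ (hp'.1.mem_orb hr) ?_ ?_ ?_ ((lt_sem_iff (o := none)).2 hcon.2)
    · intro x hx
      obtain ⟨y, hy, rfl⟩ := mem_sem.1 hx
      exact castTok_mem_sem.2 (hp'.2 y (List.mem_append_left _ hy))
    · intro x hx
      obtain ⟨y, hy, rfl⟩ := mem_sem.1 hx
      exact castTok_mem_sem.2 (hp'.2 y (List.mem_append_right _ hy))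
    · exact Multiset.map_le_map hcon.1

/-- A finite certificate that `t` is not reachable from `s`: a list `G` of rules that generates the
congruence of `T` and has connected critical peaks, with distinct irreducible words that are
congruent to `s` and to `t`. -/
def NonReachC (T : List (WRule n)) (s t : Word n) : Prop :=
  ∃ (G : List (WRule n)) (s' t' : Word n), (∀ r ∈ T, r ∈ G) ∧ (∀ r ∈ G, r.swap ∈ G) ∧
    (∀ r ∈ G, ReachC T r.1 r.2) ∧ CritC G ∧ ReachC T s s' ∧ ReachC T t t' ∧
    IrredC G (s' ++ t') s' ∧ IrredC G (s' ++ t') t' ∧ ¬ s'.Perm t'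

/-- A rule is an image of a rule between words, and conversely. -/
theorem exists_wRule (p : Multiset (Tok ℚ n) × Multiset (Tok ℚ n)) :
    ∃ r : WRule n, ∃ κ κ' : Tok ℚ n → Tok ℚ n, IsEmb κ ∧ IsEmb κ' ∧
      p.1 = (sem r.1).map κ ∧ p.2 = (sem r.2).map κ ∧
      sem r.1 = p.1.map κ' ∧ sem r.2 = p.2.map κ' := by
  obtain ⟨ν, κ, κ', hκ, hκ', h₁, h₂, -⟩ := exists_naturalize (p.1 + p.2).toList
  have h₁' : ∀ x ∈ p.1 + p.2, κ (castTok (ν x)) = x := fun x hx => h₁ x (by simpa using hx)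
  have h₂' : ∀ x ∈ p.1 + p.2, κ' x = castTok (ν x) := fun x hx => h₂ x (by simpa using hx)
  refine ⟨(toWord ν p.1, toWord ν p.2), κ, κ', hκ, hκ', ?_, ?_, ?_, ?_⟩
  · simp only [sem, coe_toWord, Multiset.map_map]
    exact ((Multiset.map_congr rfl fun x hx => h₁' x (Multiset.mem_add.2 (.inl hx))).trans
      (Multiset.map_id _)).symm
  · simp only [sem, coe_toWord, Multiset.map_map]
    exact ((Multiset.map_congr rfl fun x hx => h₁' x (Multiset.mem_add.2 (.inr hx))).trans
      (Multiset.map_id _)).symm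
  · simp only [sem, coe_toWord, Multiset.map_map]
    exact Multiset.map_congr rfl fun x hx => (h₂' x (Multiset.mem_add.2 (.inl hx))).symm
  · simp only [sem, coe_toWord, Multiset.map_map]
    exact Multiset.map_congr rfl fun x hx => (h₂' x (Multiset.mem_add.2 (.inr hx))).symm

/-- The pairs of `exists_finite_basis`, as rules between words, together with the rules of `T` and all
inverses. -/
theorem exists_basis {T : List (WRule n)} (hT : ∀ r ∈ T, r.swap ∈ T) :
    ∃ G : List (WRule n), (∀ r ∈ T, r ∈ G) ∧ (∀ r ∈ G, r.swap ∈ G) ∧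
      (∀ r ∈ G, ReachC T r.1 r.2) ∧ IsBasis (orb (semRules G)) := by
  have hsymT := swap_mem_orb (swap_mem_semRules hT)
  -- a bound for the places that occur in `T`
  let d := ((T.flatMap fun r => r.1 ++ r.2).map fun x => x.place + 1).sum
  have hd : ∀ r ∈ semRules T, ∀ x ∈ r.1 + r.2, x.place < d := by
    rintro _ ⟨r, hr, rfl⟩ x hx
    rw [← sem_append] at hx
    obtain ⟨y, hy, rfl⟩ := mem_sem.1 hx
    rw [isEmb_castTok.place_eq]
    exact Nat.lt_of_succ_le <| List.le_sum_of_mem (List.mem_map.2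
      ⟨y, List.mem_flatMap.2 ⟨r, hr, hy⟩, rfl⟩ : y.place + 1 ∈ _)
  obtain ⟨F, hF, hF'⟩ := exists_finite_basis hd
  choose nat κ κ' hκ hκ' hnat₁ hnat₂ hnat₁' hnat₂' using exists_wRule (n := n)
  let G₀ : List (WRule n) := F.toList.map nat
  have hmem : ∀ r, r ∈ T ++ G₀ ++ G₀.map Prod.swap ↔ r ∈ T ∨ r ∈ G₀ ∨ r.swap ∈ G₀ := by
    intro r
    simp only [List.mem_append, List.mem_map, or_assoc]
    refine or_congr Iff.rfl (or_congr Iff.rfl ⟨?_, fun h => ⟨_, h, Prod.swap_swap _⟩⟩)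
    rintro ⟨q, hq, rfl⟩
    rwa [Prod.swap_swap]
  have hG₀ : ∀ r ∈ G₀, Conn (orb (semRules T)) (sem r.1) (sem r.2) := by
    intro r hr
    obtain ⟨p, hp, rfl⟩ := List.mem_map.1 hr
    have h := (hF p (by simpa using hp)).map_emb (hκ' p)
    rwa [← hnat₁', ← hnat₂'] at h
  have hG : ∀ r ∈ T ++ G₀ ++ G₀.map Prod.swap, Conn (orb (semRules T)) (sem r.1) (sem r.2) := by
    intro r hr
    rcases (hmem r).1 hr with h | h | h
    · simpa using Conn.of_mem (mem_orb_of_mem (mem_semRules h)) 0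
    · exact hG₀ r h
    · exact (hG₀ _ h).symm hsymT
  refine ⟨T ++ G₀ ++ G₀.map Prod.swap, fun r hr => (hmem r).2 (.inl hr), fun r hr => ?_,
    fun r hr => reachC_iff.2 (hG r hr), ?_⟩
  · rw [hmem] at hr ⊢
    rw [Prod.swap_swap]
    rcases hr with h | h | h
    exacts [.inl (hT r h), .inr (.inr h), .inr (.inl h)]
  · intro o s t hst hlt
    obtain ⟨p, hp, h⟩ := hF' o s t (hst.of_orb (by
      rintro _ ⟨r, hr, rfl⟩
      exact hG r hr)) hlt
    refine ⟨p, ?_, h⟩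
    obtain ⟨q, hq, ι, hι, rfl⟩ := hp
    refine ⟨_, mem_semRules ((hmem (nat q)).2 (.inr (.inl ?_))), fun x => ι (κ q x),
      hι.comp (hκ q), ?_⟩
    · exact List.mem_map_of_mem (by simpa using hq)
    · exact Prod.ext ((congrArg (Multiset.map ι) (hnat₁ q)).trans (Multiset.map_map ι (κ q) _))
        ((congrArg (Multiset.map ι) (hnat₂ q)).trans (Multiset.map_map ι (κ q) _))

/-- Soundness and completeness of the certificates: a certificate separates the congruence classes by
`eq_of_conn_of_irred`, and a finite basis, with irreducible descendants of `s` and `t`, yields one. -/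
theorem nonReachC_iff {T : List (WRule n)} (hT : ∀ r ∈ T, r.swap ∈ T) {s t : Word n} :
    NonReachC T s t ↔ ¬ ReachC T s t := by
  have hsymT := swap_mem_orb (swap_mem_semRules hT)
  constructor
  · rintro ⟨G, s', t', hTG, hG, -, hcrit, hs, ht, hs', ht', hne⟩ hst
    have hsymG := swap_mem_orb (swap_mem_semRules hG)
    rw [reachC_iff] at hs ht hst
    rw [irredC_iff, sem_append] at hs' ht'
    refine hne (sem_eq_iff.1 (eq_of_conn_of_irred hsymG hcrit.criticalPeaks none hs' ht' ?_))
    refine Conn.of_orb ?_ ((hs.symm hsymT).trans (hst.trans ht))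
    rintro _ ⟨r, hr, rfl⟩
    simpa using Conn.of_mem (mem_orb_of_mem (mem_semRules (hTG r hr))) 0
  · intro hst
    obtain ⟨G, hTG, hG, hGT, hB⟩ := exists_basis hT
    have hsymG := swap_mem_orb (swap_mem_semRules hG)
    have hconn : ∀ {a b}, Conn (orb (semRules G)) a b → Conn (orb (semRules T)) a b := by
      refine Conn.of_orb ?_
      rintro _ ⟨r, hr, rfl⟩
      exact reachC_iff.1 (hGT r hr)
    let V : Finset (Tok ℚ n) := (sem s + sem t).toFinset
    have hV : ∀ x ∈ V, castTok (floorTok x) = x := by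
      intro x hx
      rw [Multiset.mem_toFinset, ← sem_append] at hx
      obtain ⟨y, -, rfl⟩ := mem_sem.1 hx
      rw [floorTok_castTok]
    obtain ⟨u, huV, hu, hsu⟩ := exists_irred_descendant (O := orb (semRules G)) none V (sem s)
      (fun x hx => by simp [V, hx])
    obtain ⟨w, hwV, hw, htw⟩ := exists_irred_descendant (O := orb (semRules G)) none V (sem t)
      (fun x hx => by simp [V, hx])
    have hsu' : Conn (orb (semRules T)) (sem s) u := hconn (reflTransGen_mono
      (fun _ _ h => h.1.mono (fun _ _ => trivial) (Set.subset_univ _)) hsu)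
    have htw' : Conn (orb (semRules T)) (sem t) w := hconn (reflTransGen_mono
      (fun _ _ h => h.1.mono (fun _ _ => trivial) (Set.subset_univ _)) htw)
    have eu := sem_toWord fun x hx => hV x (huV x hx)
    have ew := sem_toWord fun x hx => hV x (hwV x hx)
    have hmono : ∀ {c}, Irred (orb (semRules G)) none V c →
        Irred (orb (semRules G)) none {x | x ∈ u + w} c := by
      intro c hc r hr h₁ h₂
      have hsub : ∀ x ∈ u + w, x ∈ (V : Set (Tok ℚ n)) := by
        intro x hx
        rcases Multiset.mem_add.1 hx with hx | hx
        exacts [huV x hx, hwV x hx]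
      exact hc r hr (fun x hx => hsub x (h₁ x hx)) fun x hx => hsub x (h₂ x hx)
    refine ⟨G, toWord floorTok u, toWord floorTok w, hTG, hG, hGT,
      critC_of_criticalPeaks (hB.criticalPeaks hsymG), ?_, ?_, ?_, ?_, ?_⟩
    · rwa [reachC_iff, eu]
    · rwa [reachC_iff, ew]
    · rw [irredC_iff, sem_append, eu, ew]
      exact hmono hu
    · rw [irredC_iff, sem_append, eu, ew]
      exact hmono hw
    · intro hp
      rw [← sem_eq_iff, eu, ew] at hp
      rw [reachC_iff] at hst
      exact hst (hsu'.trans (hp ▸ htw'.symm hsymT))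

end Certificates


/-! ### Primitive recursive and recursively enumerable predicates -/

theorem _root_.Relation.reflTransGen_iff_zip {β : Type*} {S : β → β → Prop} {x y : β} :
    Relation.ReflTransGen S x y ↔
      ∃ L : List β, (∀ p ∈ (x :: L).zip L, S p.1 p.2) ∧ L.foldl (fun _ b => b) x = y := by
  constructor
  · intro h
    induction h using Relation.ReflTransGen.head_induction_on with
    | refl => exact ⟨[], by simp, rfl⟩
    | head h _ ih =>
      obtain ⟨L, hL, hy⟩ := ih
      exact ⟨_ :: L, by simpa [h] using hL, hy⟩
  · rintro ⟨L, hL, rfl⟩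
    induction L generalizing x with
    | nil => exact .refl
    | cons b L ih =>
      rw [List.zip_cons_cons, List.forall_mem_cons] at hL
      exact .head hL.1 (ih hL.2)

section Computability

variable {α β γ δ : Type*} [Primcodable α] [Primcodable β] [Primcodable γ] [Primcodable δ]

theorem _root_.Primrec.list_zip {f : α → List β} {g : α → List γ} (hf : Primrec f)
    (hg : Primrec g) : Primrec fun a => (f a).zip (g a) := by
  have h : Primrec fun a => (List.range (f a).length).filterMap fun i =>
      (f a)[i]?.bind fun b => (g a)[i]?.map fun c => (b, c) := by
    refine Primrec.listFilterMap (Primrec.list_range.comp (Primrec.list_length.comp hf)) ?_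
    refine Primrec.option_bind
      (Primrec.list_getElem?.comp (hf.comp Primrec.fst) Primrec.snd) ?_
    refine Primrec.option_map (Primrec.list_getElem?.comp
      (hg.comp (Primrec.fst.comp Primrec.fst)) (Primrec.snd.comp Primrec.fst)) ?_
    exact Primrec.pair (Primrec.snd.comp Primrec.fst) Primrec.snd
  refine h.of_eq fun a => ?_
  generalize f a = l
  generalize g a = m
  induction l generalizing m with
  | nil => simp
  | cons b l ih =>
    rw [List.length_cons, List.range_succ_eq_map]
    cases m with
    | nil => simp
    | cons c m => simpa [List.filterMap_map, Function.comp_def] using ih m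

theorem _root_.PrimrecPred.ball {l : α → List β} {p : α → β → Prop} (hl : Primrec l)
    (hp : PrimrecPred fun x : α × β => p x.1 x.2) : PrimrecPred fun a => ∀ b ∈ l a, p a b :=
  (PrimrecRel.forall_mem_list (R := fun b a => p a b)
    (hp.comp (Primrec.pair Primrec.snd Primrec.fst))).comp hl Primrec.id

theorem _root_.PrimrecPred.bex {l : α → List β} {p : α → β → Prop} (hl : Primrec l)
    (hp : PrimrecPred fun x : α × β => p x.1 x.2) : PrimrecPred fun a => ∃ b ∈ l a, p a b :=
  (PrimrecRel.exists_mem_list (R := fun b a => p a b)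
    (hp.comp (Primrec.pair Primrec.snd Primrec.fst))).comp hl Primrec.id

theorem _root_.PrimrecPred.eq' {f g : α → β} (hf : Primrec f) (hg : Primrec g) :
    PrimrecPred fun a => f a = g a :=
  Primrec.eq.comp hf hg

theorem _root_.PrimrecPred.mem {f : α → β} {l : α → List β} (hf : Primrec f) (hl : Primrec l) :
    PrimrecPred fun a => f a ∈ l a :=
  (PrimrecPred.bex (p := fun a b => b = f a) hl
    (PrimrecPred.eq' Primrec.snd (hf.comp Primrec.fst))).of_eq fun a => by simp

theorem _root_.PrimrecPred.imp {p q : α → Prop} (hp : PrimrecPred p) (hq : PrimrecPred q) :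
    PrimrecPred fun a => p a → q a :=
  (hp.not.or hq).of_eq fun _ => imp_iff_not_or.symm

theorem _root_.PrimrecPred.iff {p q : α → Prop} (hp : PrimrecPred p) (hq : PrimrecPred q) :
    PrimrecPred fun a => p a ↔ q a :=
  ((hp.imp hq).and (hq.imp hp)).of_eq fun _ => iff_def.symm

theorem _root_.Primrec.list_count [DecidableEq β] {f : α → β} {l : α → List β} (hf : Primrec f)
    (hl : Primrec l) : Primrec fun a => (l a).count (f a) := by
  have h : PrimrecRel fun b c : β => b = c := Primrec.eq
  refine (Primrec.list_length.comp ((PrimrecRel.listFilter h).comp hl hf)).of_eq fun a => ?_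
  rw [List.count, List.countP_eq_length_filter]
  rfl

theorem _root_.PrimrecPred.perm {f g : α → List β} (hf : Primrec f) (hg : Primrec g) :
    PrimrecPred fun a => (f a).Perm (g a) := by
  classical
  refine (PrimrecPred.ball (l := fun a => f a ++ g a)
    (p := fun a b => (f a).count b = (g a).count b) (Primrec.list_append.comp hf hg)
    (PrimrecPred.eq' (Primrec.list_count Primrec.snd (hf.comp Primrec.fst))
      (Primrec.list_count Primrec.snd (hg.comp Primrec.fst)))).of_eq fun a => ?_
  rw [List.perm_iff_count]
  refine ⟨fun h b => ?_, fun h b _ => h b⟩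
  by_cases hb : b ∈ f a ++ g a
  · exact h b hb
  · rw [List.mem_append, not_or] at hb
    rw [List.count_eq_zero_of_not_mem hb.1, List.count_eq_zero_of_not_mem hb.2]

theorem _root_.PrimrecPred.coe_le {f g : α → List β} (hf : Primrec f) (hg : Primrec g) :
    PrimrecPred fun a => (f a : Multiset β) ≤ (g a : Multiset β) := by
  classical
  refine (PrimrecPred.ball (l := f)
    (p := fun a b => (f a).count b ≤ (g a).count b) hf
    (Primrec.nat_le.comp (Primrec.list_count Primrec.snd (hf.comp Primrec.fst))
      (Primrec.list_count Primrec.snd (hg.comp Primrec.fst)))).of_eq fun a => ?_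
  rw [Multiset.le_iff_count]
  simp only [Multiset.coe_count]
  refine ⟨fun h b => ?_, fun h b _ => h b⟩
  by_cases hb : b ∈ f a
  · exact h b hb
  · rw [List.count_eq_zero_of_not_mem hb]
    exact Nat.zero_le _

/-- Predicates of the form `∃ n, R a n` with `R` primitive recursive. -/
def IsSigma (p : α → Prop) : Prop :=
  ∃ R : α × ℕ → Prop, PrimrecPred R ∧ ∀ a, p a ↔ ∃ n, R (a, n)

namespace IsSigma

theorem rePred {p : α → Prop} (h : IsSigma p) : REPred p := by
  obtain ⟨R, ⟨_, hR⟩, h⟩ := h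
  have hr : Partrec fun a => Nat.rfind fun n => Part.some (decide (R (a, n))) :=
    Partrec.rfind hR.to_comp.partrec
  exact hr.dom_re.of_eq fun a => Nat.rfind_dom.trans (by simp [h])

theorem of_eq {p q : α → Prop} (hp : IsSigma p) (h : ∀ a, p a ↔ q a) : IsSigma q :=
  (funext fun a => propext (h a) : p = q) ▸ hp

theorem of_primrecPred {p : α → Prop} (hp : PrimrecPred p) : IsSigma p :=
  ⟨fun x => p x.1, hp.comp Primrec.fst, fun a => by simp⟩

theorem comp {p : β → Prop} (hp : IsSigma p) {f : α → β} (hf : Primrec f) :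
    IsSigma fun a => p (f a) := by
  obtain ⟨R, hR, h⟩ := hp
  exact ⟨fun x => R (f x.1, x.2), hR.comp ((hf.comp Primrec.fst).pair Primrec.snd), fun a => h _⟩

theorem ex {p : α → β → Prop} (hp : IsSigma fun x : α × β => p x.1 x.2) :
    IsSigma fun a => ∃ b, p a b := by
  obtain ⟨R, hR, h⟩ := hp
  have hu : Primrec fun x : α × ℕ => x.2.unpair := Primrec.unpair.comp Primrec.snd
  refine ⟨fun x => ∃ b ∈ (Encodable.decode (α := β) x.2.unpair.1).toList,
    R ((x.1, b), x.2.unpair.2), ?_, fun a => ?_⟩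
  · refine PrimrecPred.bex (p := fun x b => R ((x.1, b), x.2.unpair.2))
      (Primrec.optionToList.comp (Primrec.decode.comp (Primrec.fst.comp hu))) (hR.comp ?_)
    exact ((Primrec.fst.comp Primrec.fst).pair Primrec.snd).pair
      (Primrec.snd.comp (hu.comp Primrec.fst))
  · constructor
    · rintro ⟨b, hb⟩
      obtain ⟨n, hn⟩ := (h (a, b)).1 hb
      exact ⟨Nat.pair (Encodable.encode b) n, b, by simp, by simpa using hn⟩
    · rintro ⟨n, b, -, hb⟩
      exact ⟨b, (h (a, b)).2 ⟨_, hb⟩⟩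

theorem and {p q : α → Prop} (hp : IsSigma p) (hq : IsSigma q) : IsSigma fun a => p a ∧ q a := by
  obtain ⟨R, hR, h⟩ := hp
  obtain ⟨S, hS, h'⟩ := hq
  have : IsSigma fun a => ∃ n : ℕ × ℕ, R (a, n.1) ∧ S (a, n.2) := by
    refine ex (of_primrecPred (PrimrecPred.and (hR.comp ?_) (hS.comp ?_)))
    · exact Primrec.fst.pair (Primrec.fst.comp Primrec.snd)
    · exact Primrec.fst.pair (Primrec.snd.comp Primrec.snd)
  exact this.of_eq fun a => by simp [h, h']

theorem or {p q : α → Prop} (hp : IsSigma p) (hq : IsSigma q) : IsSigma fun a => p a ∨ q a := by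
  obtain ⟨R, hR, h⟩ := hp
  obtain ⟨S, hS, h'⟩ := hq
  exact ⟨fun x => R x ∨ S x, hR.or hS, fun a => by simp [h, h', exists_or]⟩

theorem bex {l : α → List β} {p : α → β → Prop} (hl : Primrec l)
    (hp : IsSigma fun x : α × β => p x.1 x.2) : IsSigma fun a => ∃ b ∈ l a, p a b :=
  ex ((of_primrecPred (PrimrecPred.mem Primrec.snd (hl.comp Primrec.fst))).and hp)

/-- The witnesses for the finitely many instances have a common bound. -/
theorem ball {l : α → List β} {p : α → β → Prop} (hl : Primrec l)
    (hp : IsSigma fun x : α × β => p x.1 x.2) : IsSigma fun a => ∀ b ∈ l a, p a b := by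
  obtain ⟨R, hR, h⟩ := hp
  refine ⟨fun x => ∀ b ∈ l x.1, ∃ n ∈ List.range x.2, R ((x.1, b), n), ?_, fun a => ?_⟩
  · refine PrimrecPred.ball (p := fun x b => ∃ n ∈ List.range x.2, R ((x.1, b), n))
      (hl.comp Primrec.fst) ?_
    refine PrimrecPred.bex (p := fun (x : (α × ℕ) × β) n => R ((x.1.1, x.2), n))
      (Primrec.list_range.comp (Primrec.snd.comp Primrec.fst)) (hR.comp ?_)
    exact ((Primrec.fst.comp (Primrec.fst.comp Primrec.fst)).pair
      (Primrec.snd.comp Primrec.fst)).pair Primrec.snd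
  · simp only [fun b => h (a, b), List.mem_range]
    constructor
    · intro H
      generalize l a = L at H
      induction L with
      | nil => exact ⟨0, by simp⟩
      | cons b L ih =>
        rw [List.forall_mem_cons] at H
        obtain ⟨N, hN⟩ := ih H.2
        obtain ⟨n, hn⟩ := H.1
        refine ⟨max N (n + 1), List.forall_mem_cons.2 ⟨⟨n, by simp, hn⟩, fun c hc => ?_⟩⟩
        obtain ⟨m, hm, hm'⟩ := hN c hc
        exact ⟨m, lt_max_of_lt_left hm, hm'⟩
    · rintro ⟨N, hN⟩ b hb
      obtain ⟨n, -, hn⟩ := hN b hb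
      exact ⟨n, hn⟩

theorem reflTransGen {S : α → β → β → Prop} (hS : IsSigma fun x : α × β × β => S x.1 x.2.1 x.2.2)
    {f g : α → β} (hf : Primrec f) (hg : Primrec g) :
    IsSigma fun a => Relation.ReflTransGen (S a) (f a) (g a) := by
  have : IsSigma fun a => ∃ L : List β, (∀ p ∈ (f a :: L).zip L, S a p.1 p.2) ∧
      L.foldl (fun _ b => b) (f a) = g a := by
    refine ex (and (ball (p := fun (x : α × List β) (p : β × β) => S x.1 p.1 p.2) ?_ ?_)
      (of_primrecPred (PrimrecPred.eq' ?_ (hg.comp Primrec.fst))))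
    · exact Primrec.list_zip (Primrec.list_cons.comp (hf.comp Primrec.fst) Primrec.snd) Primrec.snd
    · exact hS.comp ((Primrec.fst.comp Primrec.fst).pair Primrec.snd)
    · exact Primrec.list_foldl Primrec.snd (hf.comp Primrec.fst)
        (Primrec.snd.comp Primrec.snd).to₂
  exact this.of_eq fun a => Relation.reflTransGen_iff_zip.symm

end IsSigma

end Computability

/-! ### Recursive enumerability of reachability and non-reachability -/

/-- Tokens with natural coordinates are coded as nested pairs of numbers. -/
instance Tok.instPrimcodable : (n : ℕ) → Primcodable (Tok ℕ n)
  | 0 => inferInstanceAs (Primcodable ℕ)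
  | n + 1 =>
    letI : Primcodable (Tok ℕ n) := Tok.instPrimcodable n
    inferInstanceAs (Primcodable (ℕ × Tok ℕ n))

section Tok

variable {α β : Type*} [Primcodable α] [Primcodable β]

theorem primrec_head {n : ℕ} : Primrec (Tok.head : Tok ℕ (n + 1) → ℕ) :=
  (Primrec.fst : Primrec (Prod.fst : ℕ × Tok ℕ n → ℕ))

theorem primrec_tail {n : ℕ} : Primrec (Tok.tail : Tok ℕ (n + 1) → Tok ℕ n) :=
  (Primrec.snd : Primrec (Prod.snd : ℕ × Tok ℕ n → Tok ℕ n))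

theorem primrec_cons {n : ℕ} : Primrec₂ (Tok.cons : ℕ → Tok ℕ n → Tok ℕ (n + 1)) :=
  (Primrec.id : Primrec (id : ℕ × Tok ℕ n → ℕ × Tok ℕ n))

theorem primrec_place : ∀ {n : ℕ}, Primrec (Tok.place : Tok ℕ n → ℕ)
  | 0 => (Primrec.id : Primrec (id : ℕ → ℕ))
  | n + 1 => (primrec_place (n := n)).comp (primrec_tail (n := n))

theorem primrecRel_lt : ∀ {n : ℕ}, PrimrecRel fun x y : Tok ℕ n => x < y
  | 0 => (Primrec.nat_lt : PrimrecRel fun x y : ℕ => x < y)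
  | n + 1 => by
    have h1 : Primrec fun x : Tok ℕ (n + 1) × Tok ℕ (n + 1) => x.1.head :=
      primrec_head.comp Primrec.fst
    have h2 : Primrec fun x : Tok ℕ (n + 1) × Tok ℕ (n + 1) => x.2.head :=
      primrec_head.comp Primrec.snd
    have h3 : PrimrecPred fun x : Tok ℕ (n + 1) × Tok ℕ (n + 1) => x.1.tail < x.2.tail :=
      (primrecRel_lt (n := n)).comp (primrec_tail.comp Primrec.fst) (primrec_tail.comp Primrec.snd)
    exact ((Primrec.nat_lt.comp h1 h2).or ((PrimrecPred.eq' h1 h2).and h3)).of_eq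
      fun x => Tok.lt_iff.symm

theorem primrecPred_sameTp {n : ℕ} {f g f' g' : α → Tok ℕ n} (hf : Primrec f) (hg : Primrec g)
    (hf' : Primrec f') (hg' : Primrec g') :
    PrimrecPred fun a => SameTp (f a) (g a) (f' a) (g' a) := by
  induction n with
  | zero =>
    exact (PrimrecPred.eq' (primrec_place.comp hf) (primrec_place.comp hf')).and
      (PrimrecPred.eq' (primrec_place.comp hg) (primrec_place.comp hg'))
  | succ n ih =>
    have h := primrec_head.comp hf
    have h' := primrec_head.comp hf'
    have k := primrec_head.comp hg
    have k' := primrec_head.comp hg'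
    exact ((Primrec.nat_lt.comp h k).iff (Primrec.nat_lt.comp h' k')).and
      (((Primrec.nat_lt.comp k h).iff (Primrec.nat_lt.comp k' h')).and
        ((PrimrecPred.eq' h k).imp (ih (primrec_tail.comp hf) (primrec_tail.comp hg)
          (primrec_tail.comp hf') (primrec_tail.comp hg'))))

theorem primrec_weight {n : ℕ} {o : α → Option (Tok ℕ n)} {f : α → Word n} (ho : Primrec o)
    (hf : Primrec f) : Primrec fun a => weight (o a) (f a : Multiset (Tok ℕ n)) := by
  refine (Primrec.option_casesOn ho (Primrec.const 0)
    (Primrec.list_count Primrec.snd (hf.comp Primrec.fst)).to₂).of_eq fun a => ?_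
  cases o a <;> simp [weight]

/-- Only the variables that occur in one of the two words have to be compared. -/
theorem primrecPred_lt {n : ℕ} {o : α → Option (Tok ℕ n)} {f g : α → Word n} (ho : Primrec o)
    (hf : Primrec f) (hg : Primrec g) :
    PrimrecPred fun a => Lt (o a) (f a : Multiset (Tok ℕ n)) (g a) := by
  refine ((Primrec.nat_lt.comp (primrec_weight ho hf) (primrec_weight ho hg)).or
    ((PrimrecPred.eq' (primrec_weight ho hf) (primrec_weight ho hg)).and
    (PrimrecPred.bex (p := fun a x => (∀ y ∈ f a ++ g a, y < x → (f a).count y = (g a).count y) ∧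
      (f a).count x < (g a).count x) hg (PrimrecPred.and (PrimrecPred.ball
        (p := fun (z : α × Tok ℕ n) y => y < z.2 → (f z.1).count y = (g z.1).count y)
        ?_ (PrimrecPred.imp ?_ (PrimrecPred.eq' ?_ ?_))) (Primrec.nat_lt.comp ?_ ?_))))).of_eq
    fun a => ?_
  · exact Primrec.list_append.comp (hf.comp Primrec.fst) (hg.comp Primrec.fst)
  · exact primrecRel_lt.comp Primrec.snd (Primrec.snd.comp Primrec.fst)
  · exact Primrec.list_count Primrec.snd (hf.comp (Primrec.fst.comp Primrec.fst))
  · exact Primrec.list_count Primrec.snd (hg.comp (Primrec.fst.comp Primrec.fst))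
  · exact Primrec.list_count Primrec.snd (hf.comp Primrec.fst)
  · exact Primrec.list_count Primrec.snd (hg.comp Primrec.fst)
  · simp only [Lt, Multiset.coe_count]
    refine or_congr_right (and_congr_right fun _ => ⟨?_, ?_⟩)
    · rintro ⟨x, -, h, hx⟩
      refine ⟨x, fun y hy => ?_, hx⟩
      by_cases hm : y ∈ f a ++ g a
      · exact h y hm hy
      · rw [List.mem_append, not_or] at hm
        rw [List.count_eq_zero_of_not_mem hm.1, List.count_eq_zero_of_not_mem hm.2]
    · rintro ⟨x, h, hx⟩
      exact ⟨x, List.count_pos_iff.1 (by omega), fun y _ => h y, hx⟩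

theorem primrec_grid {P : α → List ℕ} {K : α → ℕ} (hP : Primrec P) (hK : Primrec K) :
    ∀ n, Primrec fun a => grid (P a) (K a) n
  | 0 => hP
  | n + 1 => Primrec.list_flatMap (Primrec.list_range.comp hK)
      (Primrec.list_map ((primrec_grid hP hK n).comp Primrec.fst)
        (primrec_cons.comp (Primrec.snd.comp Primrec.fst) Primrec.snd).to₂).to₂

theorem primrec_words {A : α → List β} {k : α → ℕ} (hA : Primrec A) (hk : Primrec k) :
    Primrec fun a => words (A a) (k a) := by
  refine (Primrec.nat_rec' (β := List (List β)) (g := fun _ => [[]])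
    (h := fun a x => (A a).flatMap fun b => x.2.map (List.cons b)) hk (Primrec.const _)
    (Primrec.list_flatMap (f := fun x : α × ℕ × List (List β) => A x.1)
      (g := fun x b => x.2.2.map (List.cons b)) (hA.comp Primrec.fst)
      (Primrec.list_map (f := fun y : (α × ℕ × List (List β)) × β => y.1.2.2)
        (g := fun y => List.cons y.2) ?_ ?_).to₂).to₂).of_eq fun a => ?_
  · exact Primrec.snd.comp (Primrec.snd.comp Primrec.fst)
  · exact (Primrec.list_cons.comp (Primrec.snd.comp Primrec.fst) Primrec.snd).to₂
  · induction k a with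
    | zero => rfl
    | succ m ih => simp only [words, ← ih]

variable {n : ℕ}

theorem primrecPred_instR {r r' : α → WRule n} (hr : Primrec r) (hr' : Primrec r') :
    PrimrecPred fun a => InstR (r a) (r' a) := by
  have h1 := Primrec.fst.comp hr
  have h2 := Primrec.snd.comp hr
  have h1' := Primrec.fst.comp hr'
  have h2' := Primrec.snd.comp hr'
  have hz := Primrec.list_zip (Primrec.list_append.comp h1 h2) (Primrec.list_append.comp h1' h2')
  refine (PrimrecPred.eq' (Primrec.list_length.comp h1') (Primrec.list_length.comp h1)).and
    ((PrimrecPred.eq' (Primrec.list_length.comp h2') (Primrec.list_length.comp h2)).and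
    (PrimrecPred.ball (p := fun a p => ∀ q ∈ ((r a).1 ++ (r a).2).zip ((r' a).1 ++ (r' a).2),
      SameTp p.1 q.1 p.2 q.2) hz (PrimrecPred.ball
      (p := fun (x : α × Tok ℕ n × Tok ℕ n) q => SameTp x.2.1 q.1 x.2.2 q.2)
      (hz.comp Primrec.fst) (primrecPred_sameTp ?_ ?_ ?_ ?_))))
  · exact Primrec.fst.comp (Primrec.snd.comp Primrec.fst)
  · exact Primrec.fst.comp Primrec.snd
  · exact Primrec.snd.comp (Primrec.snd.comp Primrec.fst)
  · exact Primrec.snd.comp Primrec.snd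

theorem primrec_insts {A : α → Word n} {r : α → WRule n} (hA : Primrec A) (hr : Primrec r) :
    Primrec fun a => insts (A a) (r a) := by
  classical
  have h : PrimrecRel fun r' r : WRule n => InstR r r' :=
    primrecPred_instR Primrec.snd Primrec.fst
  refine ((PrimrecRel.listFilter h).comp (Primrec.list_flatMap
    (primrec_words hA (Primrec.list_length.comp (Primrec.fst.comp hr)))
    (Primrec.list_map (primrec_words (hA.comp Primrec.fst)
      (Primrec.list_length.comp (Primrec.snd.comp (hr.comp Primrec.fst))))
      (Primrec.pair (Primrec.snd.comp Primrec.fst) Primrec.snd).to₂).to₂) hr).of_eq fun a => ?_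
  simp only [insts]

theorem primrec_toks {r r' : α → WRule n} (hr : Primrec r) (hr' : Primrec r') :
    Primrec fun a => toks (r a) (r' a) :=
  Primrec.list_append.comp
    (Primrec.list_append.comp (Primrec.fst.comp hr) (Primrec.snd.comp hr))
    (Primrec.list_append.comp (Primrec.fst.comp hr') (Primrec.snd.comp hr'))

theorem primrec_pairGrid {r r' : α → WRule n} (hr : Primrec r) (hr' : Primrec r') :
    Primrec fun a => pairGrid (r a) (r' a) :=
  primrec_grid (Primrec.list_map (primrec_toks hr hr') (primrec_place.comp Primrec.snd).to₂)
    (Primrec.nat_mul.comp (Primrec.const n) (Primrec.list_length.comp (primrec_toks hr hr'))) n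

theorem isSigma_applyC {G : α → List (WRule n)} {r : α → WRule n} {c c' : α → Word n}
    (hG : Primrec G) (hr : Primrec r) (hc : Primrec c) (hc' : Primrec c') :
    IsSigma fun a => ApplyC (G a) (r a) (c a) (c' a) := by
  refine IsSigma.bex hG (IsSigma.ex (p := fun (x : α × WRule n) g => InstR x.2 (r x.1) ∧
    (c x.1).Perm (g ++ (r x.1).1) ∧ (c' x.1).Perm (g ++ (r x.1).2)) (IsSigma.of_primrecPred ?_))
  have h : Primrec fun x : (α × WRule n) × Word n => x.1.1 := Primrec.fst.comp Primrec.fst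
  have hr := hr.comp h
  exact (primrecPred_instR (Primrec.snd.comp Primrec.fst) hr).and
    ((PrimrecPred.perm (hc.comp h) (Primrec.list_append.comp Primrec.snd (Primrec.fst.comp hr))).and
    (PrimrecPred.perm (hc'.comp h) (Primrec.list_append.comp Primrec.snd (Primrec.snd.comp hr))))

theorem isSigma_chainC {R : α → Word n → Word n → Prop} {s t : α → Word n}
    (hR : IsSigma fun x : α × Word n × Word n => R x.1 x.2.1 x.2.2) (hs : Primrec s)
    (ht : Primrec t) : IsSigma fun a => ChainC (R a) (s a) (t a) := by
  have h : Primrec fun x : (α × Word n) × Word n => x.1.1 := Primrec.fst.comp Primrec.fst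
  refine IsSigma.ex (p := fun a u => ∃ v, (s a).Perm u ∧ Relation.ReflTransGen (R a) u v ∧
    v.Perm (t a)) (IsSigma.ex (p := fun (x : α × Word n) v => (s x.1).Perm x.2 ∧
      Relation.ReflTransGen (R x.1) x.2 v ∧ v.Perm (t x.1))
    (IsSigma.and (.of_primrecPred (PrimrecPred.perm (hs.comp h) (Primrec.snd.comp Primrec.fst)))
    (IsSigma.and (IsSigma.reflTransGen
      (S := fun (x : (α × Word n) × Word n) u v => R x.1.1 u v) ?_
      (Primrec.snd.comp Primrec.fst) Primrec.snd)
    (.of_primrecPred (PrimrecPred.perm Primrec.snd (ht.comp h))))))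
  exact hR.comp (Primrec.pair (h.comp Primrec.fst) Primrec.snd)

theorem isSigma_reachC {T : α → List (WRule n)} {s t : α → Word n} (hT : Primrec T)
    (hs : Primrec s) (ht : Primrec t) : IsSigma fun a => ReachC (T a) (s a) (t a) := by
  have h : Primrec fun x : (α × Word n) × Word n => x.1.1 := Primrec.fst.comp Primrec.fst
  refine IsSigma.ex (p := fun a s' => ∃ t', InstR (s a, t a) (s', t') ∧
    ChainC (StepC (T a)) s' t') (IsSigma.ex (p := fun (x : α × Word n) t' =>
      InstR (s x.1, t x.1) (x.2, t') ∧ ChainC (StepC (T x.1)) x.2 t')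
    (IsSigma.and (.of_primrecPred (primrecPred_instR ((hs.comp h).pair (ht.comp h))
      ((Primrec.snd.comp Primrec.fst).pair Primrec.snd)))
    (isSigma_chainC (R := fun (x : (α × Word n) × Word n) => StepC (T x.1.1))
      (IsSigma.ex (isSigma_applyC ?_ ?_ ?_ ?_)) (Primrec.snd.comp Primrec.fst) Primrec.snd)))
  · exact hT.comp (h.comp (Primrec.fst.comp Primrec.fst))
  · exact Primrec.snd
  · exact Primrec.fst.comp (Primrec.snd.comp Primrec.fst)
  · exact Primrec.snd.comp (Primrec.snd.comp Primrec.fst)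

theorem primrecPred_subset {v w : α → List β} (hv : Primrec v) (hw : Primrec w) :
    PrimrecPred fun a => ∀ x ∈ v a, x ∈ w a :=
  PrimrecPred.ball hv (PrimrecPred.mem Primrec.snd (hw.comp Primrec.fst))

theorem isSigma_stepBelow {G : α → List (WRule n)} {V m c c' : α → Word n}
    {o : α → Option (Tok ℕ n)} (hG : Primrec G) (hV : Primrec V) (ho : Primrec o)
    (hm : Primrec m) (hc : Primrec c) (hc' : Primrec c') :
    IsSigma fun a => StepBelow (G a) (V a) (o a) (m a) (c a) (c' a) := by
  have f : Primrec fun x : α × WRule n => x.1 := Primrec.fst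
  exact IsSigma.ex (IsSigma.and
    (isSigma_applyC (hG.comp f) Primrec.snd (hc.comp f) (hc'.comp f))
    (IsSigma.of_primrecPred (PrimrecPred.and (primrecPred_subset (Primrec.list_append.comp
      (Primrec.fst.comp Primrec.snd) (Primrec.snd.comp Primrec.snd)) (hV.comp f))
    (((primrecPred_subset hc hV).and ((primrecPred_subset hc' hV).and
      ((primrecPred_lt ho hc hm).and (primrecPred_lt ho hc' hm)))).comp f))))

theorem isSigma_peakC {G : α → List (WRule n)} {p q : α → WRule n}
    {o : α → Option (Tok ℕ n)} (hG : Primrec G) (hp : Primrec p) (hq : Primrec q)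
    (ho : Primrec o) : IsSigma fun a => PeakC (G a) (p a) (q a) (o a) := by
  have f : Primrec fun x : (α × Word n) × Word n => x.1.1 := Primrec.fst.comp Primrec.fst
  have g : Primrec fun x : (α × Word n) × Word n => x.1.2 := Primrec.snd.comp Primrec.fst
  have g' : Primrec fun x : (α × Word n) × Word n => x.2 := Primrec.snd
  have hp' := hp.comp f
  have hq' := hq.comp f
  have hm := Primrec.list_append.comp g (Primrec.fst.comp hp')
  refine IsSigma.ex (p := fun a g => ∃ g' : Word n, (g ++ (p a).1).Perm (g' ++ (q a).1) ∧
    (∀ x ∈ g, x ∉ g') ∧ ChainC (StepBelow (G a) (toks (p a) (q a)) (o a) (g ++ (p a).1))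
      (g ++ (p a).2) (g' ++ (q a).2)) (IsSigma.ex (IsSigma.and (.of_primrecPred
    (PrimrecPred.perm hm (Primrec.list_append.comp g' (Primrec.fst.comp hq'))))
    (IsSigma.and (.of_primrecPred (PrimrecPred.ball g (PrimrecPred.not
      (PrimrecPred.mem Primrec.snd (g'.comp Primrec.fst)))))
    (isSigma_chainC (isSigma_stepBelow ?_ ?_ ?_ ?_ ?_ ?_)
      (Primrec.list_append.comp g (Primrec.snd.comp hp'))
      (Primrec.list_append.comp g' (Primrec.snd.comp hq'))))))
  · exact (hG.comp f).comp Primrec.fst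
  · exact (primrec_toks hp' hq').comp Primrec.fst
  · exact (ho.comp f).comp Primrec.fst
  · exact hm.comp Primrec.fst
  · exact Primrec.fst.comp Primrec.snd
  · exact Primrec.snd.comp Primrec.snd

theorem isSigma_critC {G : α → List (WRule n)} (hG : Primrec G) :
    IsSigma fun a => CritC (G a) := by
  have hr : Primrec fun x : (α × WRule n) × WRule n => x.1.2 := Primrec.snd.comp Primrec.fst
  have hA := primrec_pairGrid hr Primrec.snd
  have hp : Primrec fun x : (((α × WRule n) × WRule n) × WRule n) × WRule n => x.1.2 :=
    Primrec.snd.comp Primrec.fst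
  have hq : Primrec fun x : (((α × WRule n) × WRule n) × WRule n) × WRule n => x.2 := Primrec.snd
  have f : Primrec fun x : ((((α × WRule n) × WRule n) × WRule n) × WRule n) ×
    Option (Tok ℕ n) => x.1 := Primrec.fst
  have hp' := hp.comp f
  have hq' := hq.comp f
  refine IsSigma.ball hG (IsSigma.ball (hG.comp Primrec.fst) (IsSigma.ball
    (primrec_insts hA hr) (IsSigma.ball
      ((primrec_insts hA Primrec.snd).comp Primrec.fst) (IsSigma.ball
    (Primrec.list_cons.comp (Primrec.const none) (Primrec.list_map (primrec_toks hp hq)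
      (Primrec.option_some.comp Primrec.snd).to₂))
    (IsSigma.or (.of_primrecPred (PrimrecPred.not ?_))
    (IsSigma.or (.of_primrecPred (PrimrecPred.not ?_)) (isSigma_peakC ?_ hp' hq' Primrec.snd)))))))
  · exact primrecPred_lt Primrec.snd (Primrec.snd.comp hp') (Primrec.fst.comp hp')
  · exact primrecPred_lt Primrec.snd (Primrec.snd.comp hq') (Primrec.fst.comp hq')
  · exact hG.comp (Primrec.fst.comp (Primrec.fst.comp (Primrec.fst.comp (Primrec.fst.comp f))))

theorem primrecPred_irredC {G : α → List (WRule n)} {V u : α → Word n} (hG : Primrec G)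
    (hV : Primrec V) (hu : Primrec u) : PrimrecPred fun a => IrredC (G a) (V a) (u a) := by
  have f : Primrec fun x : (α × WRule n) × WRule n => x.1.1 := Primrec.fst.comp Primrec.fst
  have hp : Primrec fun x : (α × WRule n) × WRule n => x.2 := Primrec.snd
  refine PrimrecPred.ball hG (PrimrecPred.ball (primrec_insts (hV.comp Primrec.fst) Primrec.snd)
    (PrimrecPred.or (PrimrecPred.not (PrimrecPred.coe_le (Primrec.fst.comp hp) (hu.comp f)))
    (PrimrecPred.not (primrecPred_lt (Primrec.const none) (Primrec.snd.comp hp)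
      (Primrec.fst.comp hp)))))

theorem primrec_swap : Primrec (Prod.swap : α × β → β × α) := Primrec.snd.pair Primrec.fst

theorem isSigma_nonReachC {T : α → List (WRule n)} {s t : α → Word n} (hT : Primrec T)
    (hs : Primrec s) (ht : Primrec t) : IsSigma fun a => NonReachC (T a) (s a) (t a) := by
  have f : Primrec fun x : ((α × List (WRule n)) × Word n) × Word n => x.1.1.1 :=
    Primrec.fst.comp (Primrec.fst.comp Primrec.fst)
  have hG : Primrec fun x : ((α × List (WRule n)) × Word n) × Word n => x.1.1.2 :=
    Primrec.snd.comp (Primrec.fst.comp Primrec.fst)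
  have hs' : Primrec fun x : ((α × List (WRule n)) × Word n) × Word n => x.1.2 :=
    Primrec.snd.comp Primrec.fst
  have ht' : Primrec fun x : ((α × List (WRule n)) × Word n) × Word n => x.2 := Primrec.snd
  have hV := Primrec.list_append.comp hs' ht'
  exact IsSigma.ex (IsSigma.ex (IsSigma.ex
    (IsSigma.and (.of_primrecPred (primrecPred_subset (hT.comp f) hG))
    (IsSigma.and (.of_primrecPred (PrimrecPred.ball hG (PrimrecPred.mem
      (primrec_swap.comp Primrec.snd) (hG.comp Primrec.fst))))
    (IsSigma.and (IsSigma.ball hG (isSigma_reachC ((hT.comp f).comp Primrec.fst)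
      (Primrec.fst.comp Primrec.snd) (Primrec.snd.comp Primrec.snd)))
    (IsSigma.and (isSigma_critC hG)
    (IsSigma.and (isSigma_reachC (hT.comp f) (hs.comp f) hs')
    (IsSigma.and (isSigma_reachC (hT.comp f) (ht.comp f) ht')
    (.of_primrecPred (PrimrecPred.and (primrecPred_irredC hG hV hs') (PrimrecPred.and
      (primrecPred_irredC hG hV ht') (PrimrecPred.not (PrimrecPred.perm hs' ht')))))))))))))

/-- Reachability and non-reachability are both recursively enumerable, so that both are decidable. -/
theorem computablePred_reachC {T : α → List (WRule n)} {s t : α → Word n} (hT : Primrec T)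
    (hs : Primrec s) (ht : Primrec t) (hsymm : ∀ a, ∀ r ∈ T a, r.swap ∈ T a) :
    ComputablePred fun a => ReachC (T a) (s a) (t a) :=
  ComputablePred.computable_iff_re_compl_re'.2 ⟨(isSigma_reachC hT hs ht).rePred,
    (isSigma_nonReachC hT hs ht).rePred.of_eq fun a => nonReachC_iff (hsymm a)⟩

end Tok


open PetriData FirstOrder.Language.Structure

/-! ### Embeddings of lexicographic products of orders -/

/-- The token with given data value and place number. -/
def tokOf : (ℓ : ℕ) → (ratOrder.pow ℓ).Carrier → ℕ → Tok ℚ ℓ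
  | 0, _, p => (p : ℕ)
  | 1, q, p => Tok.cons (q : ℚ) (tokOf 0 () p)
  | n + 2, x, p => Tok.cons (x.1 : ℚ) (tokOf (n + 1) x.2 p)

/-- The data value of a token. -/
def dataOf : (ℓ : ℕ) → Tok ℚ ℓ → (ratOrder.pow ℓ).Carrier
  | 0, _ => ()
  | 1, x => x.head
  | n + 2, x => (x.head, dataOf (n + 1) x.tail)

theorem dataOf_tokOf : ∀ (ℓ : ℕ) (x : (ratOrder.pow ℓ).Carrier) (p : ℕ), dataOf ℓ (tokOf ℓ x p) = x
  | 0, _, _ => rfl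
  | 1, _, _ => rfl
  | n + 2, x, p => Prod.ext_iff.2 ⟨rfl, dataOf_tokOf (n + 1) x.2 p⟩

theorem place_tokOf : ∀ (ℓ : ℕ) (x : (ratOrder.pow ℓ).Carrier) (p : ℕ), (tokOf ℓ x p).place = p
  | 0, _, _ => rfl
  | 1, _, _ => rfl
  | n + 2, x, p => place_tokOf (n + 1) x.2 p

theorem tokOf_dataOf : ∀ (ℓ : ℕ) (x : Tok ℚ ℓ), tokOf ℓ (dataOf ℓ x) x.place = x
  | 0, _ => rfl
  | 1, _ => rfl
  | n + 2, x => Tok.ext_iff.2 ⟨rfl, tokOf_dataOf (n + 1) x.tail⟩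

/-- The pairs `(x, y)` and `(x', y')` satisfy the same binary relations. -/
def SameRel (A : RelStr) (x y x' y' : A.Carrier) : Prop :=
  ∀ (r : A.Lang.Relations 2) (v : Fin 2 → Bool),
    RelMap r (fun i => bif v i then x else y) ↔ RelMap r (fun i => bif v i then x' else y')

theorem SameRel.of_lex_left {A B : RelStr} {x y x' y' : (A.lex B).Carrier}
    (h : SameRel (A.lex B) x y x' y') : SameRel A x.1 y.1 x'.1 y'.1 := fun r v => by
  have := h (Sum.inl r) v
  have e : ∀ x y : (A.lex B).Carrier, (fun i => (bif v i then x else y).1) =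
      fun i => bif v i then x.1 else y.1 := fun x y => by
    funext i
    cases v i <;> rfl
  change RelMap r (fun i => (bif v i then x else y).1) ↔
    RelMap r (fun i => (bif v i then x' else y').1) at this
  rwa [e, e] at this

theorem SameRel.of_lex_right {A B : RelStr} {x y x' y' : (A.lex B).Carrier}
    (h : SameRel (A.lex B) x y x' y') (hxy : x.1 = y.1) (hxy' : x'.1 = y'.1) :
    SameRel B x.2 y.2 x'.2 y'.2 := fun r v => by
  have := h (Sum.inr r) v
  have e : ∀ x y : (A.lex B).Carrier, (fun i => (bif v i then x else y).2) =
      fun i => bif v i then x.2 else y.2 := fun x y => by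
    funext i
    cases v i <;> rfl
  have e' : ∀ x y : (A.lex B).Carrier, x.1 = y.1 → ∀ i j,
      (bif v i then x else y).1 = (bif v j then x else y).1 := fun x y hxy i j => by
    cases v i <;> cases v j <;> simp [hxy]
  change (_ ∧ RelMap r (fun i => (bif v i then x else y).2)) ↔
    (_ ∧ RelMap r (fun i => (bif v i then x' else y').2)) at this
  rw [e, e] at this
  exact ⟨fun h => (this.1 ⟨e' _ _ hxy, h⟩).2, fun h => (this.2 ⟨e' _ _ hxy', h⟩).2⟩

theorem SameRel.le_iff {α : Type} [LinearOrder α] {x y x' y' : α}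
    (h : SameRel (RelStr.ofOrder α) x y x' y') : (x ≤ y ↔ x' ≤ y') ∧ (y ≤ x ↔ y' ≤ x') :=
  ⟨h .le ![true, false], h .le ![false, true]⟩

theorem SameRel.lt_iff {α : Type} [LinearOrder α] {x y x' y' : α}
    (h : SameRel (RelStr.ofOrder α) x y x' y') :
    (x < y ↔ x' < y') ∧ (y < x ↔ y' < x') ∧ (x = y ↔ x' = y') := by
  have h1 := h.le_iff.1
  have h2 := h.le_iff.2
  rw [← not_le, ← not_le, ← not_le, ← not_le, le_antisymm_iff, le_antisymm_iff, h1, h2]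
  exact ⟨Iff.rfl, Iff.rfl, Iff.rfl⟩

/-- The relations of the lexicographic power determine the type of a pair. -/
theorem SameRel.sameTp : ∀ {ℓ : ℕ} {x y x' y' : (ratOrder.pow ℓ).Carrier},
    SameRel (ratOrder.pow ℓ) x y x' y' → ∀ p q : ℕ,
      SameTp (tokOf ℓ x p) (tokOf ℓ y q) (tokOf ℓ x' p) (tokOf ℓ y' q)
  | 0, _, _, _, _, _, _, _ => ⟨rfl, rfl⟩
  | 1, x, y, x', y', h, p, q => by
    have h' := SameRel.lt_iff (α := ℚ) h
    exact ⟨h'.1, h'.2.1, fun _ => ⟨rfl, rfl⟩⟩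
  | n + 2, x, y, x', y', h, p, q => by
    have h' := SameRel.lt_iff (α := ℚ) (SameRel.of_lex_left h)
    exact ⟨h'.1, h'.2.1, fun e => SameRel.sameTp (SameRel.of_lex_right h e (h'.2.2.1 e)) p q⟩

theorem SameTp.dataOf_eq_iff : ∀ {ℓ : ℕ} {x y x' y' : Tok ℚ ℓ}, SameTp x y x' y' →
    (dataOf ℓ x = dataOf ℓ y ↔ dataOf ℓ x' = dataOf ℓ y')
  | 0, _, _, _, _, _ => Iff.rfl
  | 1, _, _, _, _, h => eq_iff_of_lt_iff (α := ℚ) (β := ℚ) h.1 h.2.1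
  | n + 2, x, y, x', y', h => by
    have h1 : x.head = y.head ↔ x'.head = y'.head := eq_iff_of_lt_iff h.1 h.2.1
    refine Prod.ext_iff.trans (Iff.trans ?_ Prod.ext_iff.symm)
    constructor
    · rintro ⟨e, e'⟩
      exact ⟨h1.1 e, (SameTp.dataOf_eq_iff (h.2.2 e)).1 e'⟩
    · rintro ⟨e, e'⟩
      exact ⟨h1.2 e, (SameTp.dataOf_eq_iff (h.2.2 (h1.2 e))).2 e'⟩

/-- Types of pairs determine the relations of the lexicographic power. -/
theorem relMap_dataOf_iff : ∀ {ℓ k : ℕ} (r : (ratOrder.pow ℓ).Lang.Relations k)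
    {t t' : Fin k → Tok ℚ ℓ}, (∀ i j, SameTp (t i) (t j) (t' i) (t' j)) →
    (RelMap r (fun i => dataOf ℓ (t i)) ↔ RelMap r fun i => dataOf ℓ (t' i))
  | 0, _, r, _, _, _ => r.elim
  | 1, _, .le, t, t', h => by
    change (t 0).head ≤ (t 1).head ↔ (t' 0).head ≤ (t' 1).head
    simpa using not_congr (h 0 1).2.1
  | n + 2, _, .inl .le, t, t', h => by
    change (t 0).head ≤ (t 1).head ↔ (t' 0).head ≤ (t' 1).head
    simpa using not_congr (h 0 1).2.1
  | n + 2, _, .inr r, t, t', h => by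
    have h1 : ∀ i j, (t i).head = (t j).head ↔ (t' i).head = (t' j).head := fun i j =>
      eq_iff_of_lt_iff (h i j).1 (h i j).2.1
    change ((∀ i j, (t i).head = (t j).head) ∧
        RelMap r (fun i => dataOf (n + 1) (t i).tail)) ↔
      ((∀ i j, (t' i).head = (t' j).head) ∧ RelMap r (fun i => dataOf (n + 1) (t' i).tail))
    constructor
    · rintro ⟨e, e'⟩
      exact ⟨fun i j => (h1 i j).1 (e i j),
        (relMap_dataOf_iff r fun i j => (h i j).2.2 (e i j)).1 e'⟩
    · rintro ⟨e, e'⟩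
      exact ⟨fun i j => (h1 i j).2 (e i j),
        (relMap_dataOf_iff r fun i j => (h i j).2.2 ((h1 i j).2 (e i j))).2 e'⟩

section Transfer

variable {ℓ d : ℕ}

/-- Tokens of a Petri net with data, as tokens with numbered places. -/
def toTok (a : (tokens ℓ d).Carrier) : Tok ℚ ℓ := tokOf ℓ a.1 (Fin.val (n := d) a.2)

theorem place_toTok (a : (tokens ℓ d).Carrier) : (toTok a).place = Fin.val (n := d) a.2 :=
  place_tokOf _ _ _

theorem dataOf_toTok (a : (tokens ℓ d).Carrier) : dataOf ℓ (toTok a) = a.1 := dataOf_tokOf _ _ _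

theorem toTok_injective : Function.Injective (toTok (ℓ := ℓ) (d := d)) := fun a b h =>
  Prod.ext_iff.2 ⟨by rw [← dataOf_toTok a, h, dataOf_toTok],
    Fin.ext (by rw [← place_toTok a, h, place_toTok])⟩

theorem sameRel_emb {A : RelStr} (ι : A.Emb) (x y : A.Carrier) : SameRel A x y (ι x) (ι y) :=
  fun r v => by
    rw [← ι.map_rel r]
    refine iff_of_eq (congrArg _ (funext fun i => ?_))
    simp only [Function.comp]
    cases v i <;> rfl

/-- Embeddings preserve places, as the identity is the only strictly monotone map of `Fin d` to
itself. -/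
theorem emb_place (ι : (tokens ℓ d).Emb) (a : (tokens ℓ d).Carrier) : (ι a).2 = a.2 := by
  obtain ⟨x, p⟩ := a
  -- copies of one data value are sent to copies of one data value, in the order of their places
  have hx : ∀ p q : Fin d, (ι (x, p)).1 = (ι (x, q)).1 := fun p q => by
    have h := ((sameRel_emb ι (x, p) (x, q)).of_lex_left.sameTp 0 0).dataOf_eq_iff
    simp only [dataOf_tokOf] at h
    exact h.1 trivial
  let f : Fin d → Fin d := fun p => (ι (x, p)).2
  have hf : StrictMono f := by
    have hle : ∀ p q : Fin d, p ≤ q ↔ f p ≤ f q := fun p q =>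
      (SameRel.le_iff (α := Fin d) ((sameRel_emb ι (x, p) (x, q)).of_lex_right rfl (hx p q))).1
    intro p q hpq
    rw [lt_iff_not_ge] at hpq ⊢
    rwa [← hle]
  exact le_antisymm (α := Fin d) (hf.apply_le (x := p)) (hf.le_apply (x := p))

theorem sameTp_emb (ι : (tokens ℓ d).Emb) (a b : (tokens ℓ d).Carrier) :
    SameTp (toTok a) (toTok b) (toTok (ι a)) (toTok (ι b)) := by
  have h := (sameRel_emb ι a b).of_lex_left.sameTp (Fin.val (n := d) a.2) (Fin.val (n := d) b.2)
  simp only [toTok, emb_place]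
  exact h

/-- Every embedding of tokens with numbered places comes from an embedding of the structure. -/
theorem exists_emb {κ : Tok ℚ ℓ → Tok ℚ ℓ} (hκ : IsEmb κ) :
    ∃ ι : (tokens ℓ d).Emb, ∀ a, toTok (ι a) = κ (toTok a) := by
  let f : (tokens ℓ d).Carrier → (tokens ℓ d).Carrier := fun a => (dataOf ℓ (κ (toTok a)), a.2)
  have hf : ∀ a, toTok (f a) = κ (toTok a) := fun a => by
    have := tokOf_dataOf ℓ (κ (toTok a))
    rwa [hκ.place_eq, place_toTok] at this
  refine ⟨⟨⟨f, fun a b h => toTok_injective (hκ.injective ?_)⟩, ?_, ?_⟩, hf⟩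
  · rw [← hf, ← hf, h]
  · intro k g
    exact isEmptyElim g
  · rintro k (r | r) x
    · have := relMap_dataOf_iff r (t := fun i => κ (toTok (x i))) (t' := fun i => toTok (x i))
        fun i j => (hκ _ _).symm
      simp only [dataOf_toTok] at this
      exact this
    · cases r
      have := fun i j => (hκ (toTok (x i)) (toTok (x j))).dataOf_eq_iff
      simp only [dataOf_toTok] at this
      exact and_congr (forall_congr' fun i => forall_congr' fun j => (this i j).symm) Iff.rfl

/-- Monomials over the tokens of a Petri net, as multisets of tokens with numbered places. -/
noncomputable def toMul (m : Monom (tokens ℓ d)) : Multiset (Tok ℚ ℓ) :=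
  (Finsupp.toMultiset m).map toTok

theorem toMul_add (m m' : Monom (tokens ℓ d)) : toMul (m + m') = toMul m + toMul m' := by
  simp [toMul]

theorem toMul_injective : Function.Injective (toMul (ℓ := ℓ) (d := d)) := by
  classical
  exact (Multiset.map_injective toTok_injective).comp
    (Function.LeftInverse.injective Finsupp.toMultiset_toFinsupp)

theorem toMul_monomOf (w : List (tokens ℓ d).Carrier) :
    toMul (monomOf w) = ((w.map toTok : List (Tok ℚ ℓ)) : Multiset (Tok ℚ ℓ)) := by
  induction w with
  | nil => simp [toMul, monomOf]
  | cons a w ih =>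
    have : monomOf (a :: w) = Finsupp.single a 1 + monomOf w := by simp [monomOf]
    rw [this, toMul_add, ih]
    simp [toMul, Finsupp.toMultiset_single]

theorem toMul_rename (ι : (tokens ℓ d).Emb) (κ : Tok ℚ ℓ → Tok ℚ ℓ) (m : Monom (tokens ℓ d))
    (h : ∀ a ∈ Finsupp.toMultiset m, toTok (ι a) = κ (toTok a)) :
    toMul (rename ι m) = (toMul m).map κ := by
  rw [toMul, rename, ← Finsupp.toMultiset_map, toMul, Multiset.map_map, Multiset.map_map]
  exact Multiset.map_congr rfl h

/-- The image of `toMul` consists of the multisets of tokens on the first `d` places. -/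
theorem exists_toMul_eq {c : Multiset (Tok ℚ ℓ)} (h : ∀ x ∈ c, x.place < d) :
    ∃ m : Monom (tokens ℓ d), toMul m = c := by
  induction c using Multiset.induction with
  | empty => exact ⟨0, by simp [toMul]⟩
  | cons x c ih =>
    obtain ⟨m, rfl⟩ := ih fun y hy => h y (Multiset.mem_cons_of_mem hy)
    let a : (tokens ℓ d).Carrier := (dataOf ℓ x, (⟨x.place, h x (Multiset.mem_cons_self _ _)⟩ : Fin d))
    have ha : toTok a = x := tokOf_dataOf ℓ x
    exact ⟨Finsupp.single a 1 + m, by simp [toMul, Finsupp.toMultiset_single, ha]⟩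

theorem place_lt_of_mem_toMul {m : Monom (tokens ℓ d)} {x : Tok ℚ ℓ} (hx : x ∈ toMul m) :
    x.place < d := by
  obtain ⟨a, -, rfl⟩ := Multiset.mem_map.1 hx
  rw [place_toTok]
  exact Fin.isLt (n := d) a.2

/-- The rules of a Petri net together with their inverses, as rules between multisets. -/
def symmRules (R : Rules (tokens ℓ d)) : Set (Multiset (Tok ℚ ℓ) × Multiset (Tok ℚ ℓ)) :=
  {p | ∃ r ∈ R, p = (toMul r.1, toMul r.2) ∨ p = (toMul r.2, toMul r.1)}

/-- By homogeneity, the action of an embedding on the tokens of one rule extends to all tokens with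
numbered places. -/
theorem conn_of_step {R : Rules (tokens ℓ d)} {c c' : Monom (tokens ℓ d)}
    (h : Step (orbit R) c c') : Conn (orb (symmRules R)) (toMul c) (toMul c') := by
  obtain ⟨g, _, ⟨ι, r, hr, rfl⟩, rfl, rfl⟩ := h
  let S := Finsupp.toMultiset r.1 + Finsupp.toMultiset r.2
  obtain ⟨κ, hκ, hκι⟩ := exists_isEmb_of_pairs
    (S.toList.map fun a => (toTok a, toTok (ι a))) (by
      simp only [List.mem_map]
      rintro _ ⟨a, -, rfl⟩ _ ⟨b, -, rfl⟩
      exact sameTp_emb ι a b)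
  have hS : ∀ a ∈ S, toTok (ι a) = κ (toTok a) := fun a ha =>
    (hκι _ (List.mem_map.2 ⟨a, Multiset.mem_toList.2 ha, rfl⟩)).symm
  refine .single ⟨trivial, trivial, _, ⟨_, ⟨r, hr, .inl rfl⟩, κ, hκ, rfl⟩, toMul g, by simp, by simp,
    ?_, ?_⟩
  · simp only [toMul_add]
    rw [toMul_rename ι κ r.1 fun a ha => hS a (Multiset.mem_add.2 (.inl ha))]
  · simp only [toMul_add]
    rw [toMul_rename ι κ r.2 fun a ha => hS a (Multiset.mem_add.2 (.inr ha))]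

/-- In a reversible net, reachability is the congruence generated by the rules, for a step with an
inverted rule undoes a step of the net, and so is itself a derivation of the net. -/
theorem Reversible.reach_iff_conn {R : Rules (tokens ℓ d)} (hR : Reversible (orbit R))
    {s t : Monom (tokens ℓ d)} :
    Reach (orbit R) s t ↔ Conn (orb (symmRules R)) (toMul s) (toMul t) := by
  constructor
  · intro h
    induction h with
    | refl => exact .refl
    | tail _ h ih => exact ih.trans (conn_of_step h)
  · intro h
    have key : ∀ c, Conn (orb (symmRules R)) (toMul s) c → ∃ m, toMul m = c ∧
        Reach (orbit R) s m := by
      intro c hc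
      induction hc with
      | refl => exact ⟨s, rfl, .refl⟩
      | tail _ h ih =>
        obtain ⟨m, rfl, hm⟩ := ih
        obtain ⟨-, -, _, ⟨p, ⟨r, hr, hp⟩, κ, hκ, rfl⟩, g, -, -, h, rfl⟩ := h
        obtain ⟨g, rfl⟩ : ∃ g' : Monom (tokens ℓ d), toMul g' = g := exists_toMul_eq fun x hx =>
          place_lt_of_mem_toMul (m := m) (h ▸ Multiset.mem_add.2 (.inl hx))
        obtain ⟨ι, hι⟩ := exists_emb (d := d) hκ
        have hren := fun m => toMul_rename ι κ m fun a _ => hι a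
        rcases hp with rfl | rfl
        · refine ⟨g + rename ι r.2, by simp only [toMul_add, hren], hm.tail ?_⟩
          refine ⟨g, _, ⟨ι, r, hr, rfl⟩, toMul_injective ?_, rfl⟩
          simp only [h, toMul_add, hren]
        · refine ⟨g + rename ι r.1, by simp only [toMul_add, hren], hm.trans (hR _ _ (.single ?_))⟩
          refine ⟨g, _, ⟨ι, r, hr, rfl⟩, rfl, toMul_injective ?_⟩
          simp only [h, toMul_add, hren]
    obtain ⟨m, hm, h⟩ := key _ h
    rwa [← toMul_injective hm]

end Transfer

/-! ### Scaling the coordinates to natural numbers -/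

/-- The affine map `q ↦ N q + M` on all coordinates. -/
def affine {n : ℕ} (N M : ℚ) (x : Tok ℚ n) : Tok ℚ n := x.map fun q => N * q + M

theorem isEmb_affine {n : ℕ} {N : ℚ} (hN : 0 < N) (M : ℚ) : IsEmb (affine (n := n) N M) :=
  IsEmb.map fun a b h => by
    have := mul_lt_mul_of_pos_left h hN
    linarith

theorem exists_isEmb_affine_inverse {n : ℕ} {N : ℚ} (hN : 0 < N) (M : ℚ) :
    ∃ κ : Tok ℚ n → Tok ℚ n, IsEmb κ ∧ ∀ x, κ (affine N M x) = x := by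
  refine ⟨affine N⁻¹ (-(N⁻¹ * M)), isEmb_affine (inv_pos.2 hN) _, fun x => ?_⟩
  rw [affine, affine, Tok.map_map]
  refine Tok.map_eq_self x fun a _ => ?_
  simp only [Function.comp]
  field_simp
  ring

/-- An embedding with an inverse changes neither the orbit of the rules nor the congruence. -/
theorem conn_map_iff {n : ℕ} {G : Set (Multiset (Tok ℚ n) × Multiset (Tok ℚ n))}
    {φ κ : Tok ℚ n → Tok ℚ n} (hφ : IsEmb φ) (hκ : IsEmb κ) (h : ∀ x, κ (φ x) = x)
    {s t : Multiset (Tok ℚ n)} :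
    Conn (orb ((fun r => (r.1.map φ, r.2.map φ)) '' G)) (s.map φ) (t.map φ) ↔
      Conn (orb G) s t := by
  have hmap : ∀ c : Multiset (Tok ℚ n), (c.map φ).map κ = c := fun c => by simp [Multiset.map_map, h]
  have step : ∀ {G G' : Set (Multiset (Tok ℚ n) × Multiset (Tok ℚ n))}, G ⊆ orb G' →
      ∀ {c c'}, Conn (orb G) c c' → Conn (orb G') c c' := fun hG _ _ hc =>
    hc.of_orb fun r hr => .single ⟨trivial, trivial, r, hG hr, 0, by simp, by simp, by simp, by simp⟩
  constructor
  · intro hc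
    rw [← hmap s, ← hmap t]
    refine (step ?_ hc).map_emb hκ
    rintro _ ⟨r, hr, rfl⟩
    exact ⟨r, hr, φ, hφ, rfl⟩
  · intro hc
    refine (step ?_ hc).map_emb hφ
    intro r hr
    exact ⟨_, ⟨r, hr, rfl⟩, κ, hκ, by simp [hmap]⟩

/-- The natural number `N q + M`, for a code of a rational number `q`. The division is exact and the
subtraction does not truncate as long as `N` is a multiple of the denominator of `q` and `M` is at
least `N |q|`. -/
def scaleRat (N M : ℕ) (c : Bool × ℕ × ℕ) : ℕ :=
  bif c.1 then M - c.2.1 * (N / c.2.2) else M + c.2.1 * (N / c.2.2)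

/-- The token with natural coordinates that results from scaling a token with a given code. A code
with too few coordinates, which codes no token, is padded with default values. -/
def scaleTok (N M : ℕ) : (n : ℕ) → TokenCode → Tok ℕ n
  | 0, c => c.2
  | n + 1, c => Tok.cons (scaleRat N M c.1.headI) (scaleTok N M n (c.1.tail, c.2))

/-- The codes of the rational numbers that occur in an instance. -/
def ratCodes (c : InstanceCode) : List (Bool × ℕ × ℕ) :=
  ((c.2.1.flatMap fun r => r.1 ++ r.2) ++ (c.2.2.1 ++ c.2.2.2)).flatMap Prod.fst

/-- The product of the denominators in an instance. -/
def scaleMul (c : InstanceCode) : ℕ := (ratCodes c).foldr (fun q N => q.2.2 * N) 1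

/-- A bound for the scaled absolute values in an instance. -/
def scaleAdd (c : InstanceCode) : ℕ :=
  scaleMul c * (ratCodes c).foldr (fun q N => q.2.1 + N) 0

theorem cast_scaleRat {N M : ℕ} {q : ℚ} (hN : q.den ∣ N) (hM : q.num.natAbs * N ≤ M) :
    (scaleRat N M (codeRat q) : ℚ) = N * q + M := by
  obtain ⟨k, rfl⟩ := hN
  have hd : (q.den : ℚ) ≠ 0 := by exact_mod_cast q.den_ne_zero
  have hk : q.den * k / q.den = k := Nat.mul_div_cancel_left _ q.den_pos
  have hq : ((q.den * k : ℕ) : ℚ) * q = q.num * k := by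
    have : (q.den : ℚ) * q = q.num := by rw [mul_comm]; exact Rat.mul_den_eq_num q
    rw [← this]
    push_cast
    ring
  have hle : q.num.natAbs * k ≤ M :=
    (Nat.mul_le_mul_left _ (Nat.le_mul_of_pos_left k q.den_pos)).trans hM
  rw [hq]
  by_cases h : q < 0
  · have hn : (q.num.natAbs : ℚ) = -q.num := by
      have : (q.num.natAbs : ℤ) = -q.num := by
        have := Rat.num_neg.2 h
        omega
      rw [← Int.cast_natCast, this]
      simp
    simp only [scaleRat, codeRat, h, decide_true, cond_true, hk]
    rw [Nat.cast_sub hle]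
    push_cast [hn]
    ring
  · have hn : (q.num.natAbs : ℚ) = q.num := by
      have : (q.num.natAbs : ℤ) = q.num := by
        have := Rat.num_nonneg.2 (not_lt.1 h)
        omega
      rw [← Int.cast_natCast, this]
    simp only [scaleRat, codeRat, h, decide_false, cond_false, hk]
    push_cast [hn]
    ring

theorem cast_scaleTok {N M : ℕ} : ∀ {ℓ : ℕ} (x : (ratOrder.pow ℓ).Carrier) (p : ℕ),
    (∀ c ∈ codeData ℓ x, c.2.2 ∣ N ∧ c.2.1 * N ≤ M) →
    castTok (scaleTok N M ℓ (codeData ℓ x, p)) = affine N M (tokOf ℓ x p)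
  | 0, _, _, _ => rfl
  | 1, x, p, h => by
    have := h _ (List.mem_singleton_self _)
    exact Tok.ext_iff.2 ⟨cast_scaleRat this.1 this.2, rfl⟩
  | n + 2, x, p, h => by
    have := h _ List.mem_cons_self
    exact Tok.ext_iff.2 ⟨cast_scaleRat this.1 this.2,
      cast_scaleTok (ℓ := n + 1) x.2 p fun c hc => h c (List.mem_cons_of_mem _ hc)⟩

theorem dvd_foldr_mul {l : List (Bool × ℕ × ℕ)} {q : Bool × ℕ × ℕ} (hq : q ∈ l) :
    q.2.2 ∣ l.foldr (fun q N => q.2.2 * N) 1 := by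
  induction l with
  | nil => simp at hq
  | cons a l ih =>
    rcases List.mem_cons.1 hq with rfl | hq
    · exact Dvd.intro _ rfl
    · exact (ih hq).mul_left _

theorem le_foldr_add {l : List (Bool × ℕ × ℕ)} {q : Bool × ℕ × ℕ} (hq : q ∈ l) :
    q.2.1 ≤ l.foldr (fun q N => q.2.1 + N) 0 := by
  induction l with
  | nil => simp at hq
  | cons a l ih =>
    rcases List.mem_cons.1 hq with rfl | hq
    · exact Nat.le_add_right _ _
    · exact (ih hq).trans (Nat.le_add_left _ _)

theorem foldr_mul_pos {l : List (Bool × ℕ × ℕ)} (h : ∀ q ∈ l, 0 < q.2.2) :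
    0 < l.foldr (fun q N => q.2.2 * N) 1 := by
  induction l with
  | nil => simp
  | cons a l ih =>
    exact Nat.mul_pos (h a List.mem_cons_self) (ih fun q hq => h q (List.mem_cons_of_mem _ hq))

/-- The word with natural coordinates that results from scaling a word. -/
def scaleWord (ℓ : ℕ) (c : InstanceCode) (w : List TokenCode) : Word ℓ :=
  w.map (scaleTok (scaleMul c) (scaleAdd c) ℓ)

/-- The scaled rules of an instance and their inverses. -/
def scaleRules (ℓ : ℕ) (c : InstanceCode) : List (WRule ℓ) :=
  (c.2.1.map fun r => (scaleWord ℓ c r.1, scaleWord ℓ c r.2)) ++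
    c.2.1.map fun r => (scaleWord ℓ c r.2, scaleWord ℓ c r.1)

theorem swap_mem_scaleRules {ℓ : ℕ} {c : InstanceCode} :
    ∀ r ∈ scaleRules ℓ c, r.swap ∈ scaleRules ℓ c := by
  simp only [scaleRules, List.mem_append, List.mem_map]
  rintro _ (⟨r, hr, rfl⟩ | ⟨r, hr, rfl⟩)
  exacts [.inr ⟨r, hr, rfl⟩, .inl ⟨r, hr, rfl⟩]

theorem pos_of_mem_codeData : ∀ {ℓ : ℕ} {x : (ratOrder.pow ℓ).Carrier} {c : Bool × ℕ × ℕ},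
    c ∈ codeData ℓ x → 0 < c.2.2
  | 0, _, _, h => absurd h List.not_mem_nil
  | 1, q, c, h => by
    rw [List.mem_singleton.1 h]
    exact Rat.den_pos q
  | n + 2, x, c, h => by
    rcases List.mem_cons.1 h with rfl | h
    · exact Rat.den_pos x.1
    · exact pos_of_mem_codeData (ℓ := n + 1) h

section Instance

variable {ℓ d : ℕ} (T : List (List (tokens ℓ d).Carrier × List (tokens ℓ d).Carrier))
  (s t : List (tokens ℓ d).Carrier)

/-- Scaling acts on the words of an instance as an affine embedding. -/
theorem exists_isEmb_sem_scaleWord : ∃ φ κ : Tok ℚ ℓ → Tok ℚ ℓ, IsEmb φ ∧ IsEmb κ ∧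
    (∀ x, κ (φ x) = x) ∧
    ∀ w : List (tokens ℓ d).Carrier, (w = s ∨ w = t ∨ ∃ r ∈ T, w = r.1 ∨ w = r.2) →
      sem (scaleWord ℓ (codeInstance d T s t) (w.map codeToken)) = (toMul (monomOf w)).map φ := by
  set c := codeInstance d T s t with hc
  have hmem : ∀ q, q ∈ ratCodes c ↔ ∃ w : List (tokens ℓ d).Carrier,
      (w = s ∨ w = t ∨ ∃ r ∈ T, w = r.1 ∨ w = r.2) ∧ ∃ a ∈ w, q ∈ codeData ℓ a.1 := by
    intro q
    simp only [ratCodes, hc, codeInstance, List.mem_flatMap, List.mem_append, List.mem_map]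
    constructor
    · rintro ⟨_, ⟨_, ⟨r, hr, rfl⟩, ha⟩ | ha, hq⟩
      · rcases ha with ha | ha <;> obtain ⟨a, h, rfl⟩ := List.mem_map.1 ha
        exacts [⟨r.1, .inr (.inr ⟨r, hr, .inl rfl⟩), a, h, hq⟩,
          ⟨r.2, .inr (.inr ⟨r, hr, .inr rfl⟩), a, h, hq⟩]
      · rcases ha with ⟨a, ha, rfl⟩ | ⟨a, ha, rfl⟩
        exacts [⟨s, .inl rfl, a, ha, hq⟩, ⟨t, .inr (.inl rfl), a, ha, hq⟩]
    · rintro ⟨w, hw, a, ha, hq⟩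
      refine ⟨codeToken a, ?_, hq⟩
      rcases hw with rfl | rfl | ⟨r, hr, rfl | rfl⟩
      exacts [.inr (.inl ⟨a, ha, rfl⟩), .inr (.inr ⟨a, ha, rfl⟩),
        .inl ⟨_, ⟨r, hr, rfl⟩, .inl (List.mem_map.2 ⟨a, ha, rfl⟩)⟩,
        .inl ⟨_, ⟨r, hr, rfl⟩, .inr (List.mem_map.2 ⟨a, ha, rfl⟩)⟩]
  have hN : 0 < scaleMul c := foldr_mul_pos fun q hq => by
    obtain ⟨w, -, a, -, hq⟩ := (hmem q).1 hq
    exact pos_of_mem_codeData hq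
  have hN' : (0 : ℚ) < scaleMul c := Nat.cast_pos.2 hN
  obtain ⟨κ, hκ, hκφ⟩ := exists_isEmb_affine_inverse (n := ℓ) hN' (scaleAdd c)
  refine ⟨_, κ, isEmb_affine hN' (scaleAdd c), hκ, hκφ, fun w hw => ?_⟩
  rw [toMul_monomOf, sem, scaleWord, Multiset.map_coe, Multiset.map_coe, List.map_map, List.map_map,
    List.map_map]
  refine congrArg _ (List.map_congr_left fun a ha => cast_scaleTok _ _ fun q hq => ?_)
  have hq := (hmem q).2 ⟨w, hw, a, ha, hq⟩
  refine ⟨dvd_foldr_mul hq, ?_⟩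
  rw [mul_comm]
  exact Nat.mul_le_mul_left _ (le_foldr_add hq)

/-- Scaling an instance does not change the congruence between its source and its target. -/
theorem reachC_scale_iff :
    ReachC (scaleRules ℓ (codeInstance d T s t))
        (scaleWord ℓ (codeInstance d T s t) (s.map codeToken))
        (scaleWord ℓ (codeInstance d T s t) (t.map codeToken)) ↔
      Conn (orb (symmRules (rulesOf T))) (toMul (monomOf s)) (toMul (monomOf t)) := by
  obtain ⟨φ, κ, hφ, hκ, hκφ, h⟩ := exists_isEmb_sem_scaleWord T s t
  rw [reachC_iff, h s (.inl rfl), h t (.inr (.inl rfl)),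
    ← conn_map_iff (G := symmRules (rulesOf T)) hφ hκ hκφ]
  suffices semRules (scaleRules ℓ (codeInstance d T s t)) =
      (fun r => (r.1.map φ, r.2.map φ)) '' symmRules (rulesOf T) by rw [this]
  have h1 := fun r hr => h r.1 (.inr (.inr ⟨r, hr, .inl rfl⟩))
  have h2 := fun r hr => h r.2 (.inr (.inr ⟨r, hr, .inr rfl⟩))
  ext p
  simp only [semRules, scaleRules, Set.mem_ofPred_eq, List.mem_append, List.mem_map, Set.mem_image,
    symmRules, rulesOf, codeInstance]
  constructor
  · rintro ⟨_, ⟨_, ⟨r, hr, rfl⟩, rfl⟩ | ⟨_, ⟨r, hr, rfl⟩, rfl⟩, rfl⟩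
    · exact ⟨_, ⟨_, ⟨r, hr, rfl⟩, .inl rfl⟩, Prod.ext_iff.2 ⟨(h1 r hr).symm, (h2 r hr).symm⟩⟩
    · exact ⟨_, ⟨_, ⟨r, hr, rfl⟩, .inr rfl⟩, Prod.ext_iff.2 ⟨(h2 r hr).symm, (h1 r hr).symm⟩⟩
  · rintro ⟨_, ⟨_, ⟨r, hr, rfl⟩, rfl | rfl⟩, rfl⟩
    · exact ⟨_, .inl ⟨_, ⟨r, hr, rfl⟩, rfl⟩, Prod.ext_iff.2 ⟨(h1 r hr).symm, (h2 r hr).symm⟩⟩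
    · exact ⟨_, .inr ⟨_, ⟨r, hr, rfl⟩, rfl⟩, Prod.ext_iff.2 ⟨(h2 r hr).symm, (h1 r hr).symm⟩⟩

end Instance

section ScalePrimrec

variable {α : Type*} [Primcodable α]

theorem primrec_scaleRat {N M : α → ℕ} {c : α → Bool × ℕ × ℕ} (hN : Primrec N) (hM : Primrec M)
    (hc : Primrec c) : Primrec fun a => scaleRat (N a) (M a) (c a) := by
  have hc2 := Primrec.snd.comp hc
  have h := Primrec.nat_mul.comp (Primrec.fst.comp hc2)
    (Primrec.nat_div.comp hN (Primrec.snd.comp hc2))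
  exact Primrec.cond (Primrec.fst.comp hc) (Primrec.nat_sub.comp hM h) (Primrec.nat_add.comp hM h)

theorem primrec_scaleTok {N M : α → ℕ} (hN : Primrec N) (hM : Primrec M) :
    ∀ (n : ℕ) {c : α → TokenCode}, Primrec c → Primrec fun a => scaleTok (N a) (M a) n (c a)
  | 0, _, hc => Primrec.snd.comp hc
  | n + 1, _, hc => primrec_cons.comp
      (primrec_scaleRat hN hM (Primrec.list_headI.comp (Primrec.fst.comp hc)))
      (primrec_scaleTok hN hM n
        ((Primrec.list_tail.comp (Primrec.fst.comp hc)).pair (Primrec.snd.comp hc)))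

theorem primrec_ratCodes : Primrec ratCodes := by
  have h1 : Primrec fun c : InstanceCode => c.2.1 := Primrec.fst.comp Primrec.snd
  have h2 : Primrec fun c : InstanceCode => c.2.2 := Primrec.snd.comp Primrec.snd
  exact Primrec.list_flatMap (Primrec.list_append.comp
    (Primrec.list_flatMap h1 (Primrec.list_append.comp
      (Primrec.fst.comp Primrec.snd) (Primrec.snd.comp Primrec.snd)).to₂)
    (Primrec.list_append.comp (Primrec.fst.comp h2) (Primrec.snd.comp h2)))
    (Primrec.fst.comp Primrec.snd).to₂

theorem primrec_scaleMul : Primrec scaleMul := by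
  refine Primrec.list_foldr (h := fun _ x => x.1.2.2 * x.2) primrec_ratCodes (Primrec.const 1) ?_
  have h : Primrec fun x : InstanceCode × (Bool × ℕ × ℕ) × ℕ => x.2.1.2.2 :=
    Primrec.snd.comp (Primrec.snd.comp (Primrec.fst.comp Primrec.snd))
  exact (Primrec.nat_mul.comp h (Primrec.snd.comp Primrec.snd)).to₂

theorem primrec_scaleAdd : Primrec scaleAdd := by
  refine Primrec.nat_mul.comp primrec_scaleMul
    (Primrec.list_foldr (h := fun _ x => x.1.2.1 + x.2) primrec_ratCodes (Primrec.const 0) ?_)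
  have h : Primrec fun x : InstanceCode × (Bool × ℕ × ℕ) × ℕ => x.2.1.2.1 :=
    Primrec.fst.comp (Primrec.snd.comp (Primrec.fst.comp Primrec.snd))
  exact (Primrec.nat_add.comp h (Primrec.snd.comp Primrec.snd)).to₂

theorem primrec_scaleWord {ℓ : ℕ} {c : α → InstanceCode} {w : α → List TokenCode} (hc : Primrec c)
    (hw : Primrec w) : Primrec fun a => scaleWord ℓ (c a) (w a) :=
  Primrec.list_map hw (primrec_scaleTok (primrec_scaleMul.comp (hc.comp Primrec.fst))
    (primrec_scaleAdd.comp (hc.comp Primrec.fst)) ℓ Primrec.snd).to₂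

theorem primrec_scaleRules {ℓ : ℕ} : Primrec (scaleRules ℓ) := by
  have h : Primrec fun c : InstanceCode => c.2.1 := Primrec.fst.comp Primrec.snd
  have h1 : Primrec fun x : InstanceCode × List TokenCode × List TokenCode =>
      scaleWord ℓ x.1 x.2.1 := primrec_scaleWord Primrec.fst (Primrec.fst.comp Primrec.snd)
  have h2 : Primrec fun x : InstanceCode × List TokenCode × List TokenCode =>
      scaleWord ℓ x.1 x.2.2 := primrec_scaleWord Primrec.fst (Primrec.snd.comp Primrec.snd)
  exact Primrec.list_append.comp (Primrec.list_map h (h1.pair h2).to₂)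
    (Primrec.list_map h (h2.pair h1).to₂)

end ScalePrimrec

end DataNet

theorem mainTheorem9 (ℓ : ℕ) (hℓ : 1 ≤ ℓ) :
    ∃ accepts : PetriData.InstanceCode → Prop, ComputablePred accepts ∧
      ∀ (d : ℕ)
        (T : List (List (PetriData.tokens ℓ d).Carrier × List (PetriData.tokens ℓ d).Carrier))
        (s t : List (PetriData.tokens ℓ d).Carrier),
        PetriData.Reversible (PetriData.orbit (PetriData.rulesOf T)) →
        (accepts (PetriData.codeInstance d T s t) ↔
          PetriData.Reach (PetriData.orbit (PetriData.rulesOf T))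
            (PetriData.monomOf s) (PetriData.monomOf t)) := by
  have hs : Primrec fun c : PetriData.InstanceCode => DataNet.scaleWord ℓ c c.2.2.1 :=
    DataNet.primrec_scaleWord Primrec.id (Primrec.fst.comp (Primrec.snd.comp Primrec.snd))
  have ht : Primrec fun c : PetriData.InstanceCode => DataNet.scaleWord ℓ c c.2.2.2 :=
    DataNet.primrec_scaleWord Primrec.id (Primrec.snd.comp (Primrec.snd.comp Primrec.snd))
  refine ⟨_, DataNet.computablePred_reachC DataNet.primrec_scaleRules hs ht
    fun _ => DataNet.swap_mem_scaleRules, fun d T s t hT => ?_⟩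
  exact (DataNet.reachC_scale_iff T s t).trans
    (DataNet.Reversible.reach_iff_conn hT).symm
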